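/- Let $N\ge 3$, $0<\gamma<\frac{(N-2)^2}{4}$, $2^\star=\frac{2N}{N-2}$ and $\varepsilon=\sqrt{\frac{(N-2)^2}{4}-\gamma}$. Let $H^1(\mathbb R^N)$ be the completion of $C_c^\infty(\mathbb R^N)$ with respect to $\|\nabla u\|_{L^2}$, write $\|u\|_\gamma^2=\int_{\mathbb R^N}\big(|\nabla u|^2-\frac{\gamma}{|x|^2}u^2\big)\,dx$, and let $S$ and $S_\gamma$ be the largest constants such that $$S\,\|u\|_{L^{2^\star}}^2\le\|\nabla u\|_{L^2}^2,\qquad S_\gamma\,\|u\|_{L^{2^\star}}^2\le\|u\|_\gamma^2\qquad\text{for all }u\in H^1(\mathbb R^N).$$ Let $$U_\gamma(x)=C_{\gamma,N}\Big(|x|^{\frac{2\beta_+}{N-2}}+|x|^{\frac{2\beta_-}{N-2}}\Big)^{-\frac{N-2}{2}},\qquad \beta_\pm=\tfrac{N-2}{2}\pm\varepsilon,$$ with $C_{\gamma,N}>0$ such that $\|U_\gamma\|_{L^{2^\star}}=1$, let $U_\gamma[\lambda](x)=\lambda^{\frac{N-2}{2}}U_\gamma(\lambda x)$, $\mathcal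 M=\{cU_\gamma[\lambda]:c\in\mathbb R,\ \lambda>0\}$, and define the best Bianchi--Egnell constant $$C_{BE}(\gamma)=\inf_{u\in H^1(\mathbb R^N)\setminus\mathcal M}\frac{\|u\|_\gamma^2-S_\gamma\|u\|_{L^{2^\star}}^2}{\operatorname{dist}(u,\mathcal M)^2},\qquad \operatorname{dist}(u,\mathcal M)^2=\inf_{c\in\mathbb R,\ \lambda>0}\|u-cU_\gamma[\lambda]\|_\gamma^2 .$$ On the cylinder $\mathbb R\times\mathbb S^{N-1}$, with the measure $dt\,d\sigma$ ($d\sigma$ the unnormalized surface measure), let $H^1(\mathbb R\times\mathbb S^{N-1})$ be the completion of $C_c^\infty(\mathbb R\times\mathbb S^{N-1})$ with respect to the norm whose square is $\int\big(|\partial_t\hat u|^2+|\nabla_{\mathbb S^{N-1}}\hat u|^2+\frac{(N-2)^2}{4}\hat u^2\big)\,dt\,d\sigma$, and write $\|\hat u\|_\varepsilon^2=\int\big(|\partial_t\hat u|^2+|\nabla_{\mathbb S^{N-1}}\hat u|^2+\varepsilon^2\hat u^2\big)\,dt\,d\sigma$. Let $\hat U_\gamma(t)=e^{-\frac{N-2}{2}t}U_\gamma(e^{-t}\sigma)$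 (which is independent of $\sigma\in\mathbb S^{N-1}$), $\hat{\mathcal M}=\{c\,\hat U_\gamma(\cdot+s):c,s\in\mathbb R\}$, and $\operatorname{dist}(\hat u,\hat{\mathcal M})^2=\inf_{c,s\in\mathbb R}\|\hat u-c\,\hat U_\gamma(\cdot+s)\|_\varepsilon^2$. Suppose that $$C_{BE}(\gamma)<1-\frac{S_\gamma}{S},$$ and let $(\hat\phi_n)_{n\in\mathbb N}\subset H^1(\mathbb R\times\mathbb S^{N-1})\setminus\hat{\mathcal M}$ be a minimizing sequence for $C_{BE}(\gamma)$ on the cylinder, that is, $$\frac{\|\hat\phi_n\|_\varepsilon^2-S_\gamma\|\hat\phi_n\|_{L^{2^\star}(\mathbb R\times\mathbb S^{N-1})}^2}{\operatorname{dist}(\hat\phi_n,\hat{\mathcal M})^2}\longrightarrow C_{BE}(\gamma),$$ with $\|\hat\phi_n\|_{L^{2^\star}(\mathbb R\times\mathbb S^{N-1})}=1$ for every $n$. Then there exist a sequence $(s_n)\subset\mathbb R$ and a function $\hat\phi\in H^1(\mathbb R\times\mathbb S^{N-1})$, $\hat\phi\not\equiv0$, such that, along a subsequence, $\tau_{s_n}\hat\phi_n\rightharpoonup\hat\phi$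 weakly in $H^1(\mathbb R\times\mathbb S^{N-1})$, where $\tau_s\hat\phi(t,\sigma)=\hat\phi(t-s,\sigma)$. -/

import Mathlib

open Filter Topology MeasureTheory

noncomputable section

namespace HardySobolev

/-! ### Exponents and bubbles -/

/-- The space `ℝ^N` with its Euclidean norm. -/
abbrev Eu (N : ℕ) : Type := EuclideanSpace ℝ (Fin N)

/-- The critical Sobolev exponent `2⋆ = 2N/(N-2)`. -/
def critExp (N : ℕ) : ENNReal := ENNReal.ofReal (2 * N / (N - 2))

/-- `ε = √((N-2)²/4 - γ)`. -/
def eps (N : ℕ) (γ : ℝ) : ℝ := Real.sqrt (((N : ℝ) - 2) ^ 2 / 4 - γ)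

/-- `β₊ = (N-2)/2 + ε`. -/
def betaPlus (N : ℕ) (γ : ℝ) : ℝ := ((N : ℝ) - 2) / 2 + eps N γ

/-- `β₋ = (N-2)/2 - ε`. -/
def betaMinus (N : ℕ) (γ : ℝ) : ℝ := ((N : ℝ) - 2) / 2 - eps N γ

/-- The radial profile of the (not yet normalized) Hardy-Sobolev bubble,
`r ↦ (r^(2β₊/(N-2)) + r^(2β₋/(N-2)))^(-(N-2)/2)`. -/
def bubbleProfile (N : ℕ) (γ r : ℝ) : ℝ :=
  ((r ^ (2 * betaPlus N γ / ((N : ℝ) - 2)) + r ^ (2 * betaMinus N γ / ((N : ℝ) - 2))) ^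
    (((N : ℝ) - 2) / 2))⁻¹

/-- The constant that normalizes the bubble in `L^{2⋆}(ℝ^N)`. -/
def bubbleConst (N : ℕ) (γ : ℝ) : ℝ :=
  (lpNorm (fun x : Eu N => bubbleProfile N γ ‖x‖) (critExp N) volume)⁻¹

/-- The Hardy-Sobolev bubble `U_γ`, with `‖U_γ‖_{L^{2⋆}} = 1`. -/
def bubble (N : ℕ) (γ : ℝ) (x : Eu N) : ℝ := bubbleConst N γ * bubbleProfile N γ ‖x‖

/-- The dilated bubble `U_γ[l](x) = l^((N-2)/2) U_γ(l x)`. -/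
def dilatedBubble (N : ℕ) (γ l : ℝ) (x : Eu N) : ℝ :=
  l ^ (((N : ℝ) - 2) / 2) * bubble N γ (l • x)

/-! ### The inequalities on `ℝ^N` -/

/-- `u` belongs to `H¹(ℝ^N)`, the closure of `C_c^∞(ℝ^N)` for the norm `‖∇u‖_{L²}`, and `G` is its
gradient: some test functions converge to `u` in `L^{2⋆}`, and their gradients to `G` in `L²`. For
`N ≥ 3`, by the Sobolev inequality, every sequence of test functions that is Cauchy for `‖∇u‖_{L²}`
converges in this sense. -/
def IsH1 (N : ℕ) (u : Eu N → ℝ) (G : Eu N → Eu N) : Prop :=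
  MemLp u (critExp N) volume ∧ MemLp G 2 volume ∧
    ∃ f : ℕ → Eu N → ℝ, (∀ k, ContDiff ℝ (⊤ : ℕ∞) (f k) ∧ HasCompactSupport (f k)) ∧
      Tendsto (fun k => eLpNorm (fun x => f k x - u x) (critExp N) volume) atTop (𝓝 0) ∧
      Tendsto (fun k => eLpNorm (fun x => gradient (f k) x - G x) 2 volume) atTop (𝓝 0)

/-- `‖u‖_γ² = ∫ (|∇u|² - γ u² / |x|²)`, where `G` is the gradient of `u`. -/
def energy (N : ℕ) (γ : ℝ) (u : Eu N → ℝ) (G : Eu N → Eu N) : ℝ :=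
  ∫ x, (‖G x‖ ^ 2 - γ / ‖x‖ ^ 2 * u x ^ 2)

/-- The best constant `S` in the Sobolev inequality `S ‖u‖²_{L^{2⋆}} ≤ ‖∇u‖²_{L²}`. -/
def sobolevConst (N : ℕ) : ℝ :=
  sSup {C : ℝ | ∀ u G, IsH1 N u G → C * lpNorm u (critExp N) volume ^ 2 ≤ ∫ x, ‖G x‖ ^ 2}

/-- The best constant `S_γ` in the Hardy-Sobolev inequality `S_γ ‖u‖²_{L^{2⋆}} ≤ ‖u‖_γ²`. -/
def hardySobolevConst (N : ℕ) (γ : ℝ) : ℝ :=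
  sSup {C : ℝ | ∀ u G, IsH1 N u G → C * lpNorm u (critExp N) volume ^ 2 ≤ energy N γ u G}

/-- The deficit `δ(u) = ‖u‖_γ² - S_γ ‖u‖²_{L^{2⋆}}`. -/
def deficit (N : ℕ) (γ : ℝ) (u : Eu N → ℝ) (G : Eu N → Eu N) : ℝ :=
  energy N γ u G - hardySobolevConst N γ * lpNorm u (critExp N) volume ^ 2

/-- `dist(u, M_HS)²`, the infimum of `‖u - c U_γ[l]‖_γ²` over `c ∈ ℝ` and `l > 0`. The bubbles are
smooth away from the origin, so their gradient is the classical one almost everywhere. -/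
def distSq (N : ℕ) (γ : ℝ) (u : Eu N → ℝ) (G : Eu N → Eu N) : ℝ :=
  ⨅ q : ℝ × Set.Ioi (0 : ℝ),
    energy N γ (fun x => u x - q.1 * dilatedBubble N γ q.2 x)
      (fun x => G x - q.1 • gradient (dilatedBubble N γ q.2) x)

/-- `u` is one of the functions `c U_γ[l]` with `c ∈ ℝ`, `l > 0` (the case `c = 0` is included, so
that the quotient defining `C_BE(γ)` makes sense for all other `u`). -/
def IsOptimizer (N : ℕ) (γ : ℝ) (u : Eu N → ℝ) : Prop :=
  ∃ c l : ℝ, 0 < l ∧ u =ᵐ[volume] fun x => c * dilatedBubble N γ l x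

/-- The best Bianchi-Egnell constant
`C_BE(γ) = inf { δ(u) / dist(u, M_HS)² : u ∈ H¹(ℝ^N), u ∉ M_HS }`. -/
def bianchiEgnellConst (N : ℕ) (γ : ℝ) : ℝ :=
  sInf {r : ℝ | ∃ u G, IsH1 N u G ∧ ¬ IsOptimizer N γ u ∧
    r = deficit N γ u G / distSq N γ u G}

/-! ### The cylinder `ℝ × S^{N-1}` and its Sobolev space -/

/-- The cylinder `ℝ × S^{N-1}`. -/
abbrev Cyl (N : ℕ) : Type := ℝ × Metric.sphere (0 : Eu N) 1

/-- The measure `dt dσ`, where `dσ` is the unnormalized surface measure. -/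
def cylMeasure (N : ℕ) : Measure (Cyl N) :=
  (volume : Measure ℝ).prod (volume : Measure (Eu N)).toSphere

/-- The Euclidean space in which the gradients `(∂_t u, ∇_S u)` take their values. -/
abbrev CylVec (N : ℕ) : Type := WithLp 2 (ℝ × Eu N)

/-- The gradient `(∂_t F, ∇_S F)` on the cylinder of (the restriction of) a function `F` on
`ℝ × ℝ^N`. The spherical gradient at `σ` is the tangential part of the gradient in `ℝ^N`, which
depends only on the restriction of `F` to the cylinder. -/
def cylGrad (N : ℕ) (F : ℝ × Eu N → ℝ) (p : Cyl N) : CylVec N :=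
  WithLp.toLp 2
    (deriv (fun t => F (t, (p.2 : Eu N))) p.1,
      gradient (fun x => F (p.1, x)) (p.2 : Eu N) -
        (inner ℝ (p.2 : Eu N) (gradient (fun x => F (p.1, x)) (p.2 : Eu N))) • (p.2 : Eu N))

/-- `F` restricts to an element of `C_c^∞(ℝ × S^{N-1})`. (The smooth functions on the closed
submanifold `ℝ × S^{N-1}` of `ℝ × ℝ^N` are the restrictions of smooth functions.) -/
def IsCylTest (N : ℕ) (F : ℝ × Eu N → ℝ) : Prop :=
  ContDiff ℝ (⊤ : ℕ∞) F ∧ HasCompactSupport fun p : Cyl N => F (p.1, (p.2 : Eu N))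

/-- The Hilbert space `L² × L²` of pairs (function, vector field) on the cylinder. -/
abbrev CylPair (N : ℕ) : Type :=
  WithLp 2 (Lp ℝ 2 (cylMeasure N) × Lp (CylVec N) 2 (cylMeasure N))

/-- The pairs `(u, ∇u)` with `u ∈ C_c^∞(ℝ × S^{N-1})`. -/
def testGraph (N : ℕ) : Set (CylPair N) :=
  {w | ∃ F, IsCylTest N F ∧ w.fst =ᵐ[cylMeasure N] (fun p => F (p.1, (p.2 : Eu N))) ∧
    w.snd =ᵐ[cylMeasure N] cylGrad N F}

/-- `H¹(ℝ × S^{N-1})`: the completion of `C_c^∞(ℝ × S^{N-1})` for the norm of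
`∫ (|∂_t u|² + |∇_S u|² + (N-2)²/4 u²)`, realized as the closure of the pairs `(u, ∇u)` in
`L² × L²`. The set `testGraph` is already a linear subspace. The norm inherited from `L² × L²`,
without the weight `(N-2)²/4`, is an equivalent one for `N ≥ 3` and gives the same weak
topology. -/
def H1Cyl (N : ℕ) : Submodule ℝ (CylPair N) := (Submodule.span ℝ (testGraph N)).topologicalClosure

variable {N : ℕ}

/-- The function underlying an element of `H¹(ℝ × S^{N-1})`. -/
def h1Fn (φ : H1Cyl N) : Cyl N → ℝ := φ.1.fst

/-- The gradient of an element of `H¹(ℝ × S^{N-1})`. -/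
def h1Grad (φ : H1Cyl N) : Cyl N → CylVec N := φ.1.snd

/-! ### Translations in the `ℝ`-variable -/

theorem measurePreserving_shift (N : ℕ) (s : ℝ) :
    MeasurePreserving (fun p : Cyl N => (p.1 - s, p.2)) (cylMeasure N) (cylMeasure N) :=
  (measurePreserving_sub_right volume s).prod (MeasurePreserving.id _)

/-- The translation `(u, G)(t, σ) ↦ (u, G)(t - s, σ)` of pairs. -/
def pairTranslate (N : ℕ) (s : ℝ) : CylPair N →ₗᵢ[ℝ] CylPair N :=
  LinearIsometry.withLpProdMap 2
    (Lp.compMeasurePreservingₗᵢ ℝ _ (measurePreserving_shift N s))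
    (Lp.compMeasurePreservingₗᵢ ℝ _ (measurePreserving_shift N s))

theorem pairTranslate_fst (s : ℝ) (w : CylPair N) :
    (pairTranslate N s w).fst =ᵐ[cylMeasure N] fun p => w.fst (p.1 - s, p.2) :=
  Lp.coeFn_compMeasurePreserving w.fst (measurePreserving_shift N s)

theorem pairTranslate_snd (s : ℝ) (w : CylPair N) :
    (pairTranslate N s w).snd =ᵐ[cylMeasure N] fun p => w.snd (p.1 - s, p.2) :=
  Lp.coeFn_compMeasurePreserving w.snd (measurePreserving_shift N s)

theorem pairTranslate_testGraph (s : ℝ) {w : CylPair N} (hw : w ∈ testGraph N) :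
    pairTranslate N s w ∈ testGraph N := by
  obtain ⟨F, ⟨hF, hc⟩, h1, h2⟩ := hw
  refine ⟨fun q => F (q.1 - s, q.2), ⟨?_, ?_⟩, ?_, ?_⟩
  · exact hF.comp (by fun_prop)
  · exact hc.comp_homeomorph ((Homeomorph.subRight s).prodCongr (Homeomorph.refl _))
  · filter_upwards [pairTranslate_fst s w,
      (measurePreserving_shift N s).quasiMeasurePreserving.ae h1] with p hp hq
    rw [hp, hq]
  · filter_upwards [pairTranslate_snd s w,
      (measurePreserving_shift N s).quasiMeasurePreserving.ae h2] with p hp hq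
    rw [hp, hq]
    simp only [cylGrad]
    rw [deriv_comp_sub_const (fun t => F (t, (p.2 : Eu N))) s p.1]

theorem pairTranslate_mem (s : ℝ) {w : CylPair N} (hw : w ∈ H1Cyl N) :
    pairTranslate N s w ∈ H1Cyl N := by
  refine map_mem_closure (pairTranslate N s).continuous hw fun v hv => ?_
  have hle : Submodule.span ℝ (testGraph N) ≤
      (Submodule.span ℝ (testGraph N)).comap (pairTranslate N s).toLinearMap :=
    Submodule.span_le.2 fun x hx => Submodule.subset_span (pairTranslate_testGraph s hx)
  exact hle hv

/-- The translation `τ_s φ(t, σ) = φ(t - s, σ)` on `H¹(ℝ × S^{N-1})`. -/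
def tau (s : ℝ) (φ : H1Cyl N) : H1Cyl N := ⟨pairTranslate N s φ.1, pairTranslate_mem s φ.2⟩

/-! ### The Bianchi-Egnell quotient on the cylinder -/

/-- `‖u‖_ε² = ∫ (|∂_t u|² + |∇_S u|² + ε² u²) dt dσ`, where `G` is the gradient of `u`. -/
def cylEnergy (N : ℕ) (γ : ℝ) (u : Cyl N → ℝ) (G : Cyl N → CylVec N) : ℝ :=
  ∫ p, (‖G p‖ ^ 2 + eps N γ ^ 2 * u p ^ 2) ∂(cylMeasure N)

/-- The bubble in cylindrical coordinates, `e^{-(N-2)t/2} U_γ(e^{-t} σ)`, which does not depend on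
`σ`. -/
def cylBubble (N : ℕ) (γ t : ℝ) : ℝ :=
  Real.exp (-(((N : ℝ) - 2) / 2) * t) * (bubbleConst N γ * bubbleProfile N γ (Real.exp (-t)))

/-- The deficit `‖φ‖_ε² - S_γ ‖φ‖²_{L^{2⋆}}` on the cylinder. -/
def cylDeficit (γ : ℝ) (φ : H1Cyl N) : ℝ :=
  cylEnergy N γ (h1Fn φ) (h1Grad φ) -
    hardySobolevConst N γ * lpNorm (h1Fn φ) (critExp N) (cylMeasure N) ^ 2

/-- The squared distance from the set of optimizers on the cylinder: the infimum of
`‖φ - c Û_γ(· + s)‖_ε²` over `c, s ∈ ℝ`. -/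
def cylDistSq (γ : ℝ) (φ : H1Cyl N) : ℝ :=
  ⨅ q : ℝ × ℝ,
    cylEnergy N γ (fun p => h1Fn φ p - q.1 * cylBubble N γ (p.1 + q.2))
      (fun p => h1Grad φ p - q.1 • cylGrad N (fun z => cylBubble N γ (z.1 + q.2)) p)

/-- The set of the optimizers `c Û_γ(· + s)`, `c, s ∈ ℝ`, on the cylinder. -/
def cylOptimizers (N : ℕ) (γ : ℝ) : Set (H1Cyl N) :=
  {φ | ∃ c s : ℝ, (h1Fn φ) =ᵐ[cylMeasure N] fun p => c * cylBubble N γ (p.1 + s)}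

/-- A minimizing sequence for `C_BE(γ)` on the cylinder. The map
`u ↦ e^{-(N-2)t/2} u(e^{-t} σ)` carries `‖·‖_γ`, the `L^{2⋆}` norm and the optimizers on `ℝ^N` to
`‖·‖_ε`, the `L^{2⋆}` norm and the optimizers on the cylinder. -/
def IsMinimizingSeq (N : ℕ) (γ : ℝ) (φ : ℕ → H1Cyl N) : Prop :=
  (∀ n, φ n ∉ cylOptimizers N γ) ∧
    Tendsto (fun n => cylDeficit γ (φ n) / cylDistSq γ (φ n)) atTop (𝓝 (bianchiEgnellConst N γ))

/-- Weak convergence in the Hilbert space `H¹(ℝ × S^{N-1})`. -/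
def WeaklyConverges (ψ : ℕ → H1Cyl N) (φ : H1Cyl N) : Prop :=
  Tendsto (fun n => toWeakSpace ℝ (H1Cyl N) (ψ n)) atTop (𝓝 (toWeakSpace ℝ (H1Cyl N) φ))

end HardySobolev

end

noncomputable section

namespace HardySobolev

variable {N : ℕ}

/-! ### Polar coordinates -/

/-! The strict inequality on `C_BE(γ)` keeps the energy of a minimizing sequence below the Sobolev
level. Take `θ` with `C_BE(γ) < θ < 1 - S_γ/S`. The choice `c = 0` bounds the squared distance by
`E_n = ‖φ_n‖_ε²`, so eventually `E_n - S_γ ≤ θ E_n`, that is `E_n ≤ B` with `B = S_γ/(1-θ) < S`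
(`exists_eventually_cylEnergy_le`). Clearing the denominator requires a positive distance off the
optimizers (`cylDistSq_pos`).

A normalized function with energy at most `B < S` cannot spread out or concentrate: some average of
it over a piece of the cylinder of fixed size `δ` is at least `δ/2` (`exists_cylAvg_lower_bound`).
Suppose all these averages are small. By a Poincaré inequality (`lintegral_sub_localAvg_cyl_le`) the
set where `|F| ≥ 2δ` carries little `L²` mass. Split `F = (F - arctan F) + arctan F`. The bounded
part `arctan F` is small in `L^{2⋆}`. The part `F - arctan F` has gradient no larger than that of
`F` and small `L²` norm, so the Sobolev inequality with the sharp constant `S`, in which the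
zero-order term is now negligible, gives `S ≤ B + o(1)`, a contradiction. This replaces a
concentration-compactness alternative and needs no compact embedding.

After translating the large average to `t = 0`, bounded sequences have weak limits. The averages are
pairings with `L²` kernels depending Lipschitz-continuously on `σ` in a compact sphere, so the lower
bound survives in the limit (`tendsto_cylAvg`) and the limit is nonzero.

The inequalities on the cylinder come from those on `ℝ^N` through `emden` with `a = (N-2)/2`; the
local averages use `emden` with `a = 0`. -/

/-- Polar coordinates `(t, σ) ↦ e^{-t} σ`. -/
def polar (p : Cyl N) : Eu N := Real.exp (-p.1) • (p.2 : Eu N)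

theorem continuous_polar : Continuous (polar (N := N)) := by
  unfold polar; fun_prop

theorem norm_polar (p : Cyl N) : ‖polar p‖ = Real.exp (-p.1) := by
  rw [polar, norm_smul, norm_eq_of_mem_sphere p.2, mul_one, Real.norm_eq_abs,
    abs_of_pos (Real.exp_pos _)]

theorem lintegral_polar_Ioi (hN : 3 ≤ N) {f : Eu N → ENNReal} (hf : Measurable f) :
    ∫⁻ x, f x = ∫⁻ σ : Metric.sphere (0 : Eu N) 1, (∫⁻ r in Set.Ioi (0 : ℝ),
      ENNReal.ofReal (r ^ (N - 1)) * f (r • (σ : Eu N))) ∂(volume : Measure (Eu N)).toSphere := by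
  have : Nonempty (Fin N) := ⟨⟨0, by omega⟩⟩
  have hg : Measurable fun q : Metric.sphere (0 : Eu N) 1 × Set.Ioi (0 : ℝ) =>
      f ((q.2 : ℝ) • (q.1 : Eu N)) := by
    apply hf.comp; fun_prop
  have h0 : ∫⁻ x, f x = ∫⁻ x : ({0}ᶜ : Set (Eu N)), f x ∂((volume : Measure (Eu N)).comap (↑)) := by
    rw [lintegral_subtype_comap (measurableSet_singleton _).compl, restrict_compl_singleton]
  rw [h0]
  have h1 := (volume : Measure (Eu N)).measurePreserving_homeomorphUnitSphereProd.lintegral_comp hg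
  have h2 : ∀ x : ({0}ᶜ : Set (Eu N)), f x = f (((homeomorphUnitSphereProd (Eu N) x).2 : ℝ) •
      ((homeomorphUnitSphereProd (Eu N) x).1 : Eu N)) := by
    intro x
    congr 1
    have : ‖(x : Eu N)‖ ≠ 0 := norm_ne_zero_iff.2 x.2
    simp [smul_smul, this]
  simp_rw [← h2] at h1
  rw [h1, lintegral_prod _ hg.aemeasurable]
  refine lintegral_congr fun σ => ?_
  have h3 : Measurable fun r : Set.Ioi (0 : ℝ) => f ((r : ℝ) • (σ : Eu N)) := by
    apply hf.comp; fun_prop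
  simp only [finrank_euclideanSpace, Fintype.card_fin]
  rw [Measure.volumeIoiPow, lintegral_withDensity_eq_lintegral_mul _ (by fun_prop) h3]
  exact lintegral_subtype_comap measurableSet_Ioi
    fun r : ℝ => ENNReal.ofReal (r ^ (N - 1)) * f (r • (σ : Eu N))

theorem lintegral_Ioi_eq_lintegral_exp {g : ℝ → ENNReal} :
    ∫⁻ r in Set.Ioi (0 : ℝ), g r = ∫⁻ t, ENNReal.ofReal (Real.exp (-t)) * g (Real.exp (-t)) := by
  have h := lintegral_image_eq_lintegral_abs_deriv_mul (s := Set.univ)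
    (f := fun t : ℝ => Real.exp (-t)) (f' := fun t => -Real.exp (-t)) MeasurableSet.univ
    (fun t _ => by
      have := (hasDerivAt_neg t).exp
      rw [mul_neg_one] at this
      exact this.hasDerivWithinAt)
    (fun s _ t _ h => by simpa using h) g
  have himg : (fun t : ℝ => Real.exp (-t)) '' Set.univ = Set.Ioi 0 := by
    ext r
    simp only [Set.mem_image, Set.mem_univ, true_and, Set.mem_Ioi]
    constructor
    · rintro ⟨t, rfl⟩; exact Real.exp_pos _
    · intro hr; exact ⟨-Real.log r, by simp [Real.exp_log hr]⟩
  rw [himg] at h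
  rw [h, Measure.restrict_univ]
  simp [abs_of_pos (Real.exp_pos _)]

/-- With `r = e^{-t}`, the radial weight `r^{N-1} dr` becomes `e^{-Nt} dt`. -/
theorem lintegral_polar (hN : 3 ≤ N) {f : Eu N → ENNReal} (hf : Measurable f) :
    ∫⁻ x, f x = ∫⁻ p, ENNReal.ofReal (Real.exp (-(N * p.1))) * f (polar p) ∂(cylMeasure N) := by
  rw [lintegral_polar_Ioi hN hf, cylMeasure, lintegral_prod_symm]
  · refine lintegral_congr fun σ => ?_
    rw [lintegral_Ioi_eq_lintegral_exp]
    refine lintegral_congr fun t => ?_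
    rw [← mul_assoc, ← ENNReal.ofReal_mul (Real.exp_pos _).le, ← Real.exp_nat_mul, ← Real.exp_add]
    congr 3
    have : ((N - 1 : ℕ) : ℝ) = N - 1 := by
      rw [Nat.cast_sub (by omega)]; simp
    rw [this]; ring
  · apply Measurable.aemeasurable
    apply Measurable.mul (by fun_prop)
    exact hf.comp continuous_polar.measurable

/-- As an identity of measures, the change of variables passes to Bochner integrals without any
integrability check. -/
theorem map_polar (hN : 3 ≤ N) :
    ((cylMeasure N).withDensity
      (fun p => (Real.toNNReal (Real.exp (-(N * p.1))) : ENNReal))).map polar = volume := by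
  refine Measure.ext_of_lintegral _ fun f hf => ?_
  rw [lintegral_map hf continuous_polar.measurable,
    lintegral_withDensity_eq_lintegral_mul (g := fun p => f (polar p)) _ (by fun_prop)
      (hf.comp continuous_polar.measurable), lintegral_polar hN hf]
  rfl

theorem integral_polar (hN : 3 ≤ N) {f : Eu N → ℝ} (hf : AEStronglyMeasurable f volume) :
    ∫ x, f x = ∫ p, Real.exp (-(N * p.1)) * f (polar p) ∂(cylMeasure N) := by
  rw [← map_polar hN] at hf
  conv_lhs => rw [← map_polar hN]
  rw [integral_map continuous_polar.measurable.aemeasurable hf,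
    integral_withDensity_eq_integral_smul (by fun_prop)]
  refine integral_congr_ae (.of_forall fun p => ?_)
  simp [NNReal.smul_def, (Real.exp_pos _).le]

theorem exists_polar_eq {x : Eu N} (hx : x ≠ 0) : ∃ p : Cyl N, polar p = x := by
  have hx' : ‖x‖ ≠ 0 := norm_ne_zero_iff.2 hx
  refine ⟨(-Real.log ‖x‖, ⟨‖x‖⁻¹ • x, by simp [norm_smul, hx']⟩), ?_⟩
  simp [polar, Real.exp_log (norm_pos_iff.2 hx), smul_smul, hx']

theorem polar_ne_zero (p : Cyl N) : polar p ≠ 0 := by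
  rw [← norm_pos_iff, norm_polar]; exact Real.exp_pos _

theorem norm_inv_smul_polar (p : Cyl N) : ‖polar p‖⁻¹ • polar p = (p.2 : Eu N) := by
  rw [norm_polar, polar, smul_smul, inv_mul_cancel₀ (Real.exp_pos _).ne', one_smul]

/-! ### The Emden-Fowler transform and its gradient -/

/-- The function `v` on `ℝ^N` with `v(e^{-t} σ) = e^{at} F(t, σ)`. -/
def emden (a : ℝ) (F : ℝ × Eu N → ℝ) (x : Eu N) : ℝ :=
  open scoped Classical in
  if x = 0 then 0 else ‖x‖ ^ (-a) * F (-Real.log ‖x‖, ‖x‖⁻¹ • x)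

theorem emden_polar (a : ℝ) (F : ℝ × Eu N → ℝ) (p : Cyl N) :
    emden a F (polar p) = Real.exp (a * p.1) * F (p.1, (p.2 : Eu N)) := by
  rw [emden, if_neg (polar_ne_zero p), norm_inv_smul_polar, norm_polar, Real.log_exp,
    ← Real.exp_mul, neg_neg, neg_mul_neg, mul_comm p.1]

theorem IsCylTest.exists_bound {F : ℝ × Eu N → ℝ} (hF : IsCylTest N F) :
    ∃ T : ℝ, 0 < T ∧ ∀ p : Cyl N, T < |p.1| → F (p.1, (p.2 : Eu N)) = 0 := by
  obtain ⟨T, hT⟩ := ((hF.2.isCompact.image continuous_fst).isBounded).exists_norm_le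
  refine ⟨max T 1, by positivity, fun p hp => ?_⟩
  by_contra h
  have := hT p.1 ⟨p, subset_tsupport _ h, rfl⟩
  rw [Real.norm_eq_abs] at this
  exact absurd (le_max_left T 1) (by linarith)

theorem emden_eq_zero {F : ℝ × Eu N → ℝ} {T : ℝ}
    (hT : ∀ p : Cyl N, T < |p.1| → F (p.1, (p.2 : Eu N)) = 0) (a : ℝ) {x : Eu N}
    (hx : ‖x‖ < Real.exp (-T) ∨ Real.exp T < ‖x‖) : emden a F x = 0 := by
  by_cases h0 : x = 0
  · simp [emden, h0]
  obtain ⟨p, rfl⟩ := exists_polar_eq h0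
  rw [emden_polar, hT, mul_zero]
  rw [norm_polar] at hx
  rcases hx with hx | hx
  · exact lt_abs.2 (Or.inl (by simpa using hx))
  · exact lt_abs.2 (Or.inr (by simpa using hx))

theorem IsCylTest.hasCompactSupport_emden {F : ℝ × Eu N → ℝ} (hF : IsCylTest N F) (a : ℝ) :
    HasCompactSupport (emden a F) := by
  obtain ⟨T, -, hT⟩ := hF.exists_bound
  refine HasCompactSupport.of_support_subset_isCompact (isCompact_closedBall (0 : Eu N) (Real.exp T))
    fun x hx => ?_
  by_contra h
  exact hx (emden_eq_zero hT a (Or.inr (by simpa using h)))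

theorem emden_eventuallyEq (a : ℝ) (F : ℝ × Eu N → ℝ) {x : Eu N} (hx : x ≠ 0) :
    emden a F =ᶠ[𝓝 x] fun x => ‖x‖ ^ (-a) * F (-Real.log ‖x‖, ‖x‖⁻¹ • x) := by
  filter_upwards [isOpen_ne.mem_nhds hx] with y hy
  rw [emden, if_neg hy]

/-- Compact support in `t` makes the transform vanish near the origin, the only place where the norm
is not smooth. -/
theorem IsCylTest.contDiff_emden {F : ℝ × Eu N → ℝ} (hF : IsCylTest N F) (a : ℝ) :
    ContDiff ℝ (⊤ : ℕ∞) (emden a F) := by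
  obtain ⟨T, -, hT⟩ := hF.exists_bound
  rw [contDiff_iff_contDiffAt]
  intro x
  by_cases hx : x = 0
  · have : emden a F =ᶠ[𝓝 x] fun _ => 0 := by
      filter_upwards [Metric.ball_mem_nhds x (Real.exp_pos (-T))] with y hy
      exact emden_eq_zero hT a (Or.inl (by simpa [hx] using hy))
    exact contDiffAt_const.congr_of_eventuallyEq this
  · refine ContDiffAt.congr_of_eventuallyEq ?_ (emden_eventuallyEq a F hx)
    have hn : ContDiffAt ℝ (⊤ : ℕ∞) (fun x : Eu N => ‖x‖) x := contDiffAt_norm ℝ hx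
    have hx' : ‖x‖ ≠ 0 := norm_ne_zero_iff.2 hx
    refine (hn.rpow_const_of_ne hx').mul (hF.1.contDiffAt.comp x ?_)
    exact ((hn.log hx').neg).prodMk ((hn.inv hx').smul contDiffAt_id)

/-- The tangential part of the gradient in the second variable. -/
def sphGrad (F : ℝ × Eu N → ℝ) (p : Cyl N) : Eu N :=
  gradient (fun x => F (p.1, x)) (p.2 : Eu N) -
    (inner ℝ (p.2 : Eu N) (gradient (fun x => F (p.1, x)) (p.2 : Eu N))) • (p.2 : Eu N)

/-- The derivative in the first variable. -/
def timeDeriv (F : ℝ × Eu N → ℝ) (p : Cyl N) : ℝ := deriv (fun t => F (t, (p.2 : Eu N))) p.1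

theorem cylGrad_eq (F : ℝ × Eu N → ℝ) (p : Cyl N) :
    cylGrad N F p = WithLp.toLp 2 (timeDeriv F p, sphGrad F p) := rfl

theorem norm_cylGrad_sq (F : ℝ × Eu N → ℝ) (p : Cyl N) :
    ‖cylGrad N F p‖ ^ 2 = timeDeriv F p ^ 2 + ‖sphGrad F p‖ ^ 2 := by
  rw [cylGrad_eq, WithLp.prod_norm_sq_eq_of_L2]; simp

theorem inner_self_sphere (σ : Metric.sphere (0 : Eu N) 1) :
    inner ℝ (σ : Eu N) (σ : Eu N) = (1 : ℝ) := by
  rw [real_inner_self_eq_norm_sq, norm_eq_of_mem_sphere]; norm_num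

theorem inner_sphGrad (F : ℝ × Eu N → ℝ) (p : Cyl N) :
    inner ℝ (p.2 : Eu N) (sphGrad F p) = 0 := by
  rw [sphGrad, inner_sub_right, inner_smul_right, inner_self_sphere, mul_one, sub_self]

/-- Chain rule for `‖x‖^(-a) F(-log ‖x‖, x/‖x‖)`. The derivative of `x/‖x‖` annihilates radial
directions, so the extension of `F` off the sphere contributes only its tangential gradient. -/
theorem gradient_emden_polar {F : ℝ × Eu N → ℝ} (hF : ContDiff ℝ (⊤ : ℕ∞) F) (a : ℝ) (p : Cyl N) :
    gradient (emden a F) (polar p) = Real.exp ((a + 1) * p.1) •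
      (sphGrad F p - (a * F (p.1, (p.2 : Eu N)) + timeDeriv F p) • (p.2 : Eu N)) := by
  have hx := polar_ne_zero p
  have hr : ‖polar p‖ ≠ 0 := norm_ne_zero_iff.2 hx
  rw [(emden_eventuallyEq a F hx).gradient_eq]
  apply HasGradientAt.gradient
  rw [hasGradientAt_iff_hasFDerivAt]
  have hFd : HasFDerivAt F (fderiv ℝ F (p.1, (p.2 : Eu N))) (p.1, (p.2 : Eu N)) :=
    (hF.differentiable (by simp)).differentiableAt.hasFDerivAt
  have ht : timeDeriv F p = fderiv ℝ F (p.1, (p.2 : Eu N)) (1, 0) :=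
    (hFd.comp_hasDerivAt p.1 ((hasDerivAt_id p.1).prodMk (hasDerivAt_const p.1 (p.2 : Eu N)))).deriv
  have hg : ∀ h : Eu N, inner ℝ (gradient (fun x => F (p.1, x)) (p.2 : Eu N)) h =
      fderiv ℝ F (p.1, (p.2 : Eu N)) (0, h) := by
    intro h
    have h1 := hFd.comp (p.2 : Eu N)
      ((hasFDerivAt_const p.1 (p.2 : Eu N)).prodMk (hasFDerivAt_id (p.2 : Eu N)))
    rw [gradient, InnerProductSpace.toDual_symm_apply,
      show fderiv ℝ (fun x => F (p.1, x)) (p.2 : Eu N) = _ from h1.fderiv]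
    simp
  have hn : HasFDerivAt (fun x : Eu N => ‖x‖) (innerSL ℝ (p.2 : Eu N)) (polar p) := by
    have h1 : HasFDerivAt (fun x : Eu N => ‖x‖ ^ 2) (2 • innerSL ℝ (polar p)) (polar p) :=
      (hasStrictFDerivAt_norm_sq (polar p)).hasFDerivAt
    have h2 := h1.sqrt (pow_ne_zero 2 hr)
    simp only [Real.sqrt_sq (norm_nonneg _)] at h2
    refine h2.congr_fderiv (ContinuousLinearMap.ext fun h => ?_)
    rw [← norm_inv_smul_polar p]
    simp
    field_simp
  have hrp := hn.rpow_const (p := -a) (Or.inl hr)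
  have hlog : HasFDerivAt (fun x : Eu N => -Real.log ‖x‖)
    (-(‖polar p‖⁻¹ • innerSL ℝ (p.2 : Eu N))) (polar p) := (hn.log hr).neg
  have hinv : HasFDerivAt (fun x : Eu N => ‖x‖⁻¹ • x) (‖polar p‖⁻¹ • ContinuousLinearMap.id ℝ (Eu N) +
      (-(‖polar p‖ ^ 2)⁻¹ • innerSL ℝ (p.2 : Eu N)).smulRight (polar p)) (polar p) :=
    ((hasDerivAt_inv hr).comp_hasFDerivAt (polar p) hn).smul (hasFDerivAt_id (polar p))
  have hpt : (-Real.log ‖polar p‖, ‖polar p‖⁻¹ • polar p) = (p.1, (p.2 : Eu N)) := by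
    rw [norm_inv_smul_polar, norm_polar, Real.log_exp, neg_neg]
  have hFd' := hFd
  rw [← hpt] at hFd'
  have hm := hrp.mul (hFd'.comp (polar p) (hlog.prodMk hinv))
  refine hm.congr_fderiv (ContinuousLinearMap.ext fun h => ?_)
  -- The derivative of `(-log ‖x‖, x/‖x‖)` in direction `h`, decomposed along `(1,0)`, `(0,h)` and
  -- `(0,σ)` so that `fderiv F` can be applied term by term.
  have hdir : ((-(‖polar p‖⁻¹ • innerSL ℝ (p.2 : Eu N))).prod
      (‖polar p‖⁻¹ • ContinuousLinearMap.id ℝ (Eu N) +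
        (-(‖polar p‖ ^ 2)⁻¹ • innerSL ℝ (p.2 : Eu N)).smulRight (polar p))) h =
      (-(‖polar p‖⁻¹ * inner ℝ (p.2 : Eu N) h)) • ((1, 0) : ℝ × Eu N) +
      ‖polar p‖⁻¹ • ((0, h) : ℝ × Eu N) -
      (‖polar p‖⁻¹ * inner ℝ (p.2 : Eu N) h) • ((0, (p.2 : Eu N)) : ℝ × Eu N) := by
    have hs : (‖polar p‖ ^ 2)⁻¹ • polar p = ‖polar p‖⁻¹ • (p.2 : Eu N) := by
      rw [pow_two, mul_inv, mul_smul, norm_inv_smul_polar]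
    ext1
    · simp
    · have : (‖polar p‖⁻¹ * inner ℝ (p.2 : Eu N) h) • (p.2 : Eu N) =
          ((‖polar p‖ ^ 2)⁻¹ * inner ℝ (p.2 : Eu N) h) • polar p := by
        rw [mul_comm, mul_smul, ← hs, ← mul_smul, mul_comm]
      simp [this, sub_eq_add_neg]
  simp only [hpt, Function.comp_apply, add_apply, smul_apply,
    ContinuousLinearMap.comp_apply]
  rw [hdir]
  simp only [map_add, map_sub, map_smul, ← hg, ← ht, sphGrad, innerSL_apply_apply, smul_eq_mul]
  have e1 : ‖polar p‖ ^ (-a) = Real.exp (a * p.1) := by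
    rw [norm_polar, ← Real.exp_mul]; ring_nf
  have e2 : ‖polar p‖ ^ (-a - 1) = Real.exp (a * p.1) * Real.exp p.1 := by
    rw [norm_polar, ← Real.exp_mul, ← Real.exp_add]; ring_nf
  have e3 : ‖polar p‖⁻¹ = Real.exp p.1 := by rw [norm_polar, Real.exp_neg, inv_inv]
  have e4 : Real.exp ((a + 1) * p.1) = Real.exp (a * p.1) * Real.exp p.1 := by
    rw [← Real.exp_add]; ring_nf
  rw [e1, e2, e3, e4]
  simp only [smul_apply, sub_apply, smul_eq_mul, InnerProductSpace.toDual_apply_apply,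
    real_inner_comm (gradient (fun x => F (p.1, x)) (p.2 : Eu N)) (p.2 : Eu N)]
  ring

theorem norm_gradient_emden_polar_sq {F : ℝ × Eu N → ℝ} (hF : ContDiff ℝ (⊤ : ℕ∞) F) (a : ℝ)
    (p : Cyl N) :
    ‖gradient (emden a F) (polar p)‖ ^ 2 = Real.exp ((2 * a + 2) * p.1) *
      ((a * F (p.1, (p.2 : Eu N)) + timeDeriv F p) ^ 2 + ‖sphGrad F p‖ ^ 2) := by
  have h0 : inner ℝ (sphGrad F p) (p.2 : Eu N) = 0 := by rw [real_inner_comm, inner_sphGrad]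
  rw [gradient_emden_polar hF, norm_smul, mul_pow, Real.norm_eq_abs, sq_abs, ← Real.exp_nat_mul,
    norm_sub_sq_real, inner_smul_right, h0, norm_smul, norm_eq_of_mem_sphere, mul_one,
    Real.norm_eq_abs, sq_abs]
  push_cast
  ring_nf

/-! ### Regularity and integrability of test functions on the cylinder -/

instance : SFinite (cylMeasure N) := by unfold cylMeasure; infer_instance
instance : IsFiniteMeasureOnCompacts (cylMeasure N) := by unfold cylMeasure; infer_instance

theorem continuous_gradient {f : Eu N → ℝ} (hf : ContDiff ℝ (⊤ : ℕ∞) f) : Continuous (gradient f) :=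
  (InnerProductSpace.toDual ℝ (Eu N)).symm.continuous.comp (hf.continuous_fderiv (by simp))

theorem gradient_emden_zero_polar {F : ℝ × Eu N → ℝ} (hF : ContDiff ℝ (⊤ : ℕ∞) F) (p : Cyl N) :
    Real.exp (-p.1) • gradient (emden 0 F) (polar p) =
      sphGrad F p - timeDeriv F p • (p.2 : Eu N) := by
  rw [gradient_emden_polar hF, smul_smul, ← Real.exp_add]
  simp

/-- In polar coordinates the radial component of the continuous field `∇(emden 0 F)` is, up to sign
and an exponential factor, the time derivative. -/
theorem IsCylTest.continuous_timeDeriv {F : ℝ × Eu N → ℝ} (hF : IsCylTest N F) :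
    Continuous (timeDeriv F) := by
  have h : timeDeriv F = fun p : Cyl N =>
      - inner ℝ (p.2 : Eu N) (Real.exp (-p.1) • gradient (emden 0 F) (polar p)) := by
    ext p
    rw [gradient_emden_zero_polar hF.1, inner_sub_right, inner_sphGrad, inner_smul_right,
      inner_self_sphere]
    simp
  rw [h]
  have := (continuous_gradient (hF.contDiff_emden 0)).comp continuous_polar
  simp only [Function.comp_def] at this
  fun_prop

theorem IsCylTest.continuous_sphGrad {F : ℝ × Eu N → ℝ} (hF : IsCylTest N F) :
    Continuous (sphGrad F) := by
  have h : sphGrad F = fun p : Cyl N => Real.exp (-p.1) • gradient (emden 0 F) (polar p) +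
      timeDeriv F p • (p.2 : Eu N) := by
    ext1 p
    rw [gradient_emden_zero_polar hF.1, sub_add_cancel]
  rw [h]
  have := (continuous_gradient (hF.contDiff_emden 0)).comp continuous_polar
  have h2 := hF.continuous_timeDeriv
  simp only [Function.comp_def] at this
  fun_prop

theorem IsCylTest.continuous_cylGrad {F : ℝ × Eu N → ℝ} (hF : IsCylTest N F) :
    Continuous (cylGrad N F) :=
  (WithLp.prod_continuous_toLp 2 ℝ (Eu N)).comp
    (hF.continuous_timeDeriv.prodMk hF.continuous_sphGrad)

theorem IsCylTest.continuous_restrict {F : ℝ × Eu N → ℝ} (hF : IsCylTest N F) :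
    Continuous fun p : Cyl N => F (p.1, (p.2 : Eu N)) :=
  hF.1.continuous.comp (by fun_prop)

/-- `F` is only known to vanish on the cylinder, not nearby in `ℝ × ℝ^N`. Since `emden 0 F` sees
only the restriction to the cylinder, it vanishes on an open set, and its gradient controls
`cylGrad`. -/
theorem cylGrad_eq_zero {F : ℝ × Eu N → ℝ} (hF : ContDiff ℝ (⊤ : ℕ∞) F) {T : ℝ}
    (hT : ∀ p : Cyl N, T < |p.1| → F (p.1, (p.2 : Eu N)) = 0) {p : Cyl N} (hp : T < |p.1|) :
    cylGrad N F p = 0 := by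
  have h : emden 0 F =ᶠ[𝓝 (polar p)] fun _ => 0 := by
    have ho : ∀ᶠ x in 𝓝 (polar p), x ≠ 0 ∧ T < |Real.log ‖x‖| := by
      refine (isOpen_ne.eventually_mem (polar_ne_zero p)).and ?_
      have : ContinuousAt (fun x : Eu N => |Real.log ‖x‖|) (polar p) :=
        ((continuous_norm.continuousAt).log (norm_ne_zero_iff.2 (polar_ne_zero p))).abs
      refine this.eventually_const_lt ?_
      change T < |Real.log ‖polar p‖|
      rwa [norm_polar, Real.log_exp, abs_neg]
    filter_upwards [ho] with x hx
    obtain ⟨y, rfl⟩ := exists_polar_eq hx.1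
    rw [norm_polar, Real.log_exp, abs_neg] at hx
    rw [emden_polar, hT y hx.2, mul_zero]
  have h2 := norm_gradient_emden_polar_sq hF 0 p
  have h3 : gradient (emden 0 F) (polar p) = 0 := by
    rw [h.gradient_eq]; simp [gradient]
  rw [h3, zero_mul, zero_add, ← norm_cylGrad_sq] at h2
  simpa [(Real.exp_pos _).ne'] using h2.symm

theorem hasCompactSupport_cyl {E : Type*} [Zero E] {f : Cyl N → E} {T : ℝ}
    (hT : ∀ p : Cyl N, T < |p.1| → f p = 0) : HasCompactSupport f := by
  refine HasCompactSupport.intro ((isCompact_Icc (a := -T) (b := T)).prod isCompact_univ)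
    fun p hp => hT p ?_
  by_contra h
  exact hp ⟨abs_le.1 (not_lt.1 h), Set.mem_univ _⟩

theorem IsCylTest.hasCompactSupport_cylGrad {F : ℝ × Eu N → ℝ} (hF : IsCylTest N F) :
    HasCompactSupport (cylGrad N F) := by
  obtain ⟨T, -, hT⟩ := hF.exists_bound
  exact hasCompactSupport_cyl fun p hp => cylGrad_eq_zero hF.1 hT hp

theorem IsCylTest.memLp {F : ℝ × Eu N → ℝ} (hF : IsCylTest N F) (q : ENNReal) :
    MemLp (fun p : Cyl N => F (p.1, (p.2 : Eu N))) q (cylMeasure N) :=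
  hF.continuous_restrict.memLp_of_hasCompactSupport hF.2

theorem IsCylTest.memLp_cylGrad {F : ℝ × Eu N → ℝ} (hF : IsCylTest N F) (q : ENNReal) :
    MemLp (cylGrad N F) q (cylMeasure N) :=
  hF.continuous_cylGrad.memLp_of_hasCompactSupport hF.hasCompactSupport_cylGrad

/-! ### Norms and energies under the Emden-Fowler transform -/

theorem critExp_pos (hN : 3 ≤ N) : 0 < 2 * (N : ℝ) / (N - 2) := by
  have : (3 : ℝ) ≤ N := by exact_mod_cast hN
  exact div_pos (by linarith) (by linarith)

theorem critExp_ne_zero (hN : 3 ≤ N) : critExp N ≠ 0 := by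
  simpa [critExp] using critExp_pos hN

theorem critExp_ne_top : critExp N ≠ ⊤ := ENNReal.ofReal_ne_top

theorem critExp_toReal (hN : 3 ≤ N) : (critExp N).toReal = 2 * (N : ℝ) / (N - 2) :=
  ENNReal.toReal_ofReal (critExp_pos hN).le

theorem two_lt_critExp (hN : 3 ≤ N) : 2 < 2 * (N : ℝ) / (N - 2) := by
  have : (3 : ℝ) ≤ N := by exact_mod_cast hN
  rw [lt_div_iff₀ (by linarith)]; linarith

theorem one_le_critExp (hN : 3 ≤ N) : 1 ≤ critExp N := by
  rw [critExp, ← ENNReal.ofReal_one]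
  exact ENNReal.ofReal_le_ofReal (by linarith [two_lt_critExp hN])

/-- The weight `e^{-Nt}` cancels against `e^{(N-2)t/2}` raised to the power `2N/(N-2)`. -/
theorem eLpNorm_emden (hN : 3 ≤ N) {F : ℝ × Eu N → ℝ} (hF : IsCylTest N F) :
    eLpNorm (emden (((N : ℝ) - 2) / 2) F) (critExp N) volume =
      eLpNorm (fun p : Cyl N => F (p.1, (p.2 : Eu N))) (critExp N) (cylMeasure N) := by
  have h3 : (3 : ℝ) ≤ N := by exact_mod_cast hN
  rw [eLpNorm_eq_lintegral_rpow_enorm_toReal (critExp_ne_zero hN) critExp_ne_top,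
    eLpNorm_eq_lintegral_rpow_enorm_toReal (critExp_ne_zero hN) critExp_ne_top,
    critExp_toReal hN]
  congr 1
  have hc := (hF.contDiff_emden (((N : ℝ) - 2) / 2)).continuous
  rw [lintegral_polar hN (by fun_prop)]
  refine lintegral_congr fun p => ?_
  rw [emden_polar, enorm_mul, ENNReal.mul_rpow_of_nonneg _ _ (critExp_pos hN).le, ← mul_assoc,
    Real.enorm_of_nonneg (Real.exp_pos _).le, ENNReal.ofReal_rpow_of_pos (Real.exp_pos _),
    ← ENNReal.ofReal_mul (Real.exp_pos _).le, ← Real.exp_mul, ← Real.exp_add]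
  have : -(N * p.1) + (((N : ℝ) - 2) / 2) * p.1 * (2 * N / (N - 2)) = 0 := by
    have : (N : ℝ) - 2 ≠ 0 := by linarith
    field_simp; ring
  rw [this]; simp

theorem memLp_emden {F : ℝ × Eu N → ℝ} (hF : IsCylTest N F) (a : ℝ) (q : ENNReal) :
    MemLp (emden a F) q volume :=
  (hF.contDiff_emden a).continuous.memLp_of_hasCompactSupport (hF.hasCompactSupport_emden a)

theorem lpNorm_emden (hN : 3 ≤ N) {F : ℝ × Eu N → ℝ} (hF : IsCylTest N F) :
    lpNorm (emden (((N : ℝ) - 2) / 2) F) (critExp N) volume =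
      lpNorm (fun p : Cyl N => F (p.1, (p.2 : Eu N))) (critExp N) (cylMeasure N) := by
  rw [← toReal_eLpNorm (memLp_emden hF _ (critExp N)).1, ← toReal_eLpNorm (hF.memLp (critExp N)).1,
    eLpNorm_emden hN hF]

/-- The integrand is `∂_t(F²/2)`. This removes the cross term when `(aF + ∂_t F)²` is expanded in
the energy. -/
theorem IsCylTest.integral_mul_timeDeriv {F : ℝ × Eu N → ℝ} (hF : IsCylTest N F) :
    ∫ p, F (p.1, (p.2 : Eu N)) * timeDeriv F p ∂(cylMeasure N) = 0 := by
  obtain ⟨T, -, hT⟩ := hF.exists_bound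
  have hFc := hF.continuous_restrict
  have htc := hF.continuous_timeDeriv
  have hcs : HasCompactSupport fun p : Cyl N => F (p.1, (p.2 : Eu N)) * timeDeriv F p :=
    hasCompactSupport_cyl (T := T) fun p hp => by rw [hT p hp, zero_mul]
  have hint : Integrable (fun p : Cyl N => F (p.1, (p.2 : Eu N)) * timeDeriv F p) (cylMeasure N) :=
    (hFc.mul htc).integrable_of_hasCompactSupport hcs
  rw [cylMeasure] at hint ⊢
  rw [integral_prod_symm _ hint]
  refine integral_eq_zero_of_ae ?_
  refine .of_forall fun σ => ?_
  have hd : ∀ t, HasDerivAt (fun t => F (t, (σ : Eu N)) ^ 2 / 2)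
      (F (t, (σ : Eu N)) * timeDeriv F (t, σ)) t := by
    intro t
    have h1 : HasDerivAt (fun t => F (t, (σ : Eu N))) (timeDeriv F (t, σ)) t := by
      refine DifferentiableAt.hasDerivAt ?_
      have : Differentiable ℝ F := hF.1.differentiable (by simp)
      fun_prop
    exact ((h1.fun_pow 2).div_const 2).congr_deriv (by push_cast; ring)
  refine integral_eq_zero_of_hasDerivAt_of_integrable hd ?_ ?_
  · have hc : Continuous fun t : ℝ => ((t, σ) : Cyl N) := by fun_prop
    refine ((hFc.comp hc).mul (htc.comp hc)).integrable_of_hasCompactSupport ?_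
    refine HasCompactSupport.intro (isCompact_Icc (a := -T) (b := T)) fun t ht => ?_
    have : T < |t| := by
      by_contra h
      exact ht (abs_le.1 (not_lt.1 h))
    simp [hT (t, σ) this]
  · have hc : Continuous fun t : ℝ => ((t, σ) : Cyl N) := by fun_prop
    refine (((hFc.comp hc).pow 2).div_const 2).integrable_of_hasCompactSupport ?_
    refine HasCompactSupport.intro (isCompact_Icc (a := -T) (b := T)) fun t ht => ?_
    have : T < |t| := by
      by_contra h
      exact ht (abs_le.1 (not_lt.1 h))
    simp [hT (t, σ) this]

theorem integral_norm_gradient_emden (hN : 3 ≤ N) {F : ℝ × Eu N → ℝ} (hF : IsCylTest N F) :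
    ∫ x, ‖gradient (emden (((N : ℝ) - 2) / 2) F) x‖ ^ 2 =
      ∫ p, ‖cylGrad N F p‖ ^ 2 ∂(cylMeasure N) +
        (((N : ℝ) - 2) / 2) ^ 2 * ∫ p, F (p.1, (p.2 : Eu N)) ^ 2 ∂(cylMeasure N) := by
  have hc := continuous_gradient (hF.contDiff_emden (((N : ℝ) - 2) / 2))
  have h1 : Integrable (fun p => ‖cylGrad N F p‖ ^ 2) (cylMeasure N) :=
    (hF.memLp_cylGrad 2).integrable_norm_pow (by simp)
  have h2 : Integrable (fun p : Cyl N => F (p.1, (p.2 : Eu N)) ^ 2) (cylMeasure N) :=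
    (hF.memLp 2).integrable_sq
  obtain ⟨T, -, hT⟩ := hF.exists_bound
  have h3 : Integrable (fun p : Cyl N => F (p.1, (p.2 : Eu N)) * timeDeriv F p) (cylMeasure N) :=
    (hF.continuous_restrict.mul hF.continuous_timeDeriv).integrable_of_hasCompactSupport
      (hasCompactSupport_cyl (T := T) fun p hp => by simp [hT p hp])
  have h12 : Integrable (fun p : Cyl N => ‖cylGrad N F p‖ ^ 2 +
      (((N : ℝ) - 2) / 2) ^ 2 * F (p.1, (p.2 : Eu N)) ^ 2) (cylMeasure N) := h1.add (h2.const_mul _)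
  rw [integral_polar hN (by fun_prop), ← integral_const_mul, ← integral_add h1 (h2.const_mul _)]
  have h4 := hF.integral_mul_timeDeriv
  -- The cross term, which has zero integral, is inserted with its coefficient `2a = N - 2`, so that
  -- the integrands agree pointwise.
  rw [← add_zero (∫ _, _ + _ ∂_), ← mul_zero ((N : ℝ) - 2), ← h4, ← integral_const_mul,
    ← integral_add h12 (h3.const_mul _)]
  refine integral_congr_ae (.of_forall fun p => ?_)
  simp only
  rw [norm_gradient_emden_polar_sq hF.1, ← mul_assoc, ← Real.exp_add, norm_cylGrad_sq]
  have : -(N * p.1) + (2 * (((N : ℝ) - 2) / 2) + 2) * p.1 = 0 := by ring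
  rw [this, Real.exp_zero]
  ring

theorem integral_emden_sq_div (hN : 3 ≤ N) {F : ℝ × Eu N → ℝ} (hF : IsCylTest N F) :
    ∫ x, emden (((N : ℝ) - 2) / 2) F x ^ 2 / ‖x‖ ^ 2 =
      ∫ p, F (p.1, (p.2 : Eu N)) ^ 2 ∂(cylMeasure N) := by
  have hc := (hF.contDiff_emden (((N : ℝ) - 2) / 2)).continuous
  rw [integral_polar hN]
  · refine integral_congr_ae (.of_forall fun p => ?_)
    simp only
    rw [emden_polar, norm_polar, mul_pow, ← Real.exp_nat_mul, ← Real.exp_nat_mul, div_eq_mul_inv,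
      ← Real.exp_neg, mul_right_comm, ← Real.exp_add, ← mul_assoc, ← Real.exp_add]
    have : -(N * p.1) + (((2 : ℕ) : ℝ) * ((((N : ℝ) - 2) / 2) * p.1) + -(((2 : ℕ) : ℝ) * -p.1)) = 0 := by
      push_cast; ring
    rw [this]; simp
  · have : Measurable (emden (((N : ℝ) - 2) / 2) F) := hc.measurable
    exact Measurable.aestronglyMeasurable (by fun_prop)

theorem sq_lpNorm_two {α E : Type*} [MeasurableSpace α] {μ : Measure α} [NormedAddCommGroup E]
    {f : α → E} (hf : AEStronglyMeasurable f μ) : lpNorm f 2 μ ^ 2 = ∫ x, ‖f x‖ ^ 2 ∂μ := by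
  rw [lpNorm_eq_integral_norm_rpow_toReal (by simp) (by simp) hf]
  have h0 : 0 ≤ ∫ x, ‖f x‖ ^ 2 ∂μ := integral_nonneg fun x => by positivity
  simp only [ENNReal.toReal_ofNat, Real.rpow_ofNat]
  rw [← Real.rpow_natCast, ← Real.rpow_mul h0]
  norm_num

theorem tendsto_lpNorm {α E : Type*} [MeasurableSpace α] {μ : Measure α} [NormedAddCommGroup E]
    {p : ENNReal} (hp : 1 ≤ p) {f : ℕ → α → E} {g : α → E} (hf : ∀ k, MemLp (f k) p μ)
    (hg : MemLp g p μ) (h : Tendsto (fun k => eLpNorm (fun x => f k x - g x) p μ) atTop (𝓝 0)) :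
    Tendsto (fun k => lpNorm (f k) p μ) atTop (𝓝 (lpNorm g p μ)) := by
  have h1 : Tendsto (fun k => lpNorm (f k - g) p μ) atTop (𝓝 0) := by
    have := (ENNReal.tendsto_toReal ENNReal.zero_ne_top).comp h
    refine this.congr fun k => ?_
    rw [← toReal_eLpNorm ((hf k).sub hg).1]; rfl
  rw [tendsto_iff_dist_tendsto_zero]
  refine squeeze_zero (fun _ => dist_nonneg) (fun k => ?_) h1
  rw [Real.dist_eq, abs_le]
  have h2 := lpNorm_le_lpNorm_add_lpNorm_sub' hg hp (f := f k)
  have h3 := lpNorm_le_lpNorm_add_lpNorm_sub (hf k) hp (f := g)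
  constructor <;> linarith

/-! ### The Sobolev inequality for test functions -/

theorem norm_gradient (f : Eu N → ℝ) (x : Eu N) : ‖gradient f x‖ = ‖fderiv ℝ f x‖ := by
  rw [gradient, LinearIsometryEquiv.norm_map]

theorem hasCompactSupport_gradient {f : Eu N → ℝ} (hc : HasCompactSupport f) :
    HasCompactSupport (gradient f) :=
  (hc.fderiv ℝ).comp_left (g := (InnerProductSpace.toDual ℝ (Eu N)).symm) (by simp)

theorem memLp_gradient {f : Eu N → ℝ} (hf : ContDiff ℝ (⊤ : ℕ∞) f) (hc : HasCompactSupport f)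
    (p : ENNReal) : MemLp (gradient f) p volume :=
  (continuous_gradient hf).memLp_of_hasCompactSupport (hasCompactSupport_gradient hc)

theorem isH1_of_contDiff {f : Eu N → ℝ} (hf : ContDiff ℝ (⊤ : ℕ∞) f) (hc : HasCompactSupport f) :
    IsH1 N f (gradient f) :=
  ⟨hf.continuous.memLp_of_hasCompactSupport hc, memLp_gradient hf hc 2, fun _ => f,
    fun _ => ⟨hf, hc⟩, by simp, by simp⟩

theorem exists_sobolev (hN : 3 ≤ N) : ∃ K : ℝ, 0 < K ∧ ∀ f : Eu N → ℝ, ContDiff ℝ (⊤ : ℕ∞) f →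
    HasCompactSupport f → K * lpNorm f (critExp N) volume ^ 2 ≤ lpNorm (gradient f) 2 volume ^ 2 := by
  have h3 : (3 : ℝ) ≤ N := by exact_mod_cast hN
  -- Adding `1` makes the constant positive, so it can be inverted.
  set C : NNReal := eLpNormLESNormFDerivOfEqInnerConst (volume : Measure (Eu N)) 2 + 1 with hC
  have hCpos : (0 : ℝ) < C := by rw [hC]; positivity
  refine ⟨((C : ℝ) ^ 2)⁻¹, by positivity, fun f hf hc => ?_⟩
  have h := eLpNorm_le_eLpNorm_fderiv_of_eq_inner (volume : Measure (Eu N)) (u := f)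
    (hf.of_le (by simp)) hc (p := 2) (p' := Real.toNNReal (2 * N / (N - 2))) (by norm_num)
    (by simp; omega) (by
      rw [Real.coe_toNNReal _ (critExp_pos hN).le, finrank_euclideanSpace, Fintype.card_fin]
      have : (N : ℝ) - 2 ≠ 0 := by linarith
      have : (N : ℝ) ≠ 0 := by linarith
      push_cast
      field_simp)
  have hm := hf.continuous.memLp_of_hasCompactSupport hc (μ := volume) (p := critExp N)
  have hg := memLp_gradient hf hc 2
  have h1 : eLpNorm f (critExp N) volume ≤ C * eLpNorm (gradient f) 2 volume := by
    have e : eLpNorm (fderiv ℝ f) 2 volume = eLpNorm (gradient f) 2 volume :=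
      eLpNorm_congr_norm_ae (.of_forall fun x => (norm_gradient f x).symm)
    rw [← e]
    refine h.trans ?_
    gcongr
    · simp [hC]
    · simp
  have h2 : lpNorm f (critExp N) volume ≤ C * lpNorm (gradient f) 2 volume := by
    rw [← toReal_eLpNorm hm.1, ← toReal_eLpNorm hg.1]
    have := ENNReal.toReal_mono (ENNReal.mul_ne_top ENNReal.coe_ne_top hg.2.ne) h1
    simpa using this
  rw [inv_mul_le_iff₀ (by positivity), ← mul_pow]
  exact pow_le_pow_left₀ lpNorm_nonneg h2 2

theorem exists_isH1_lpNorm_pos (hN : 3 ≤ N) :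
    ∃ (u : Eu N → ℝ) (G : Eu N → Eu N), IsH1 N u G ∧ 0 < lpNorm u (critExp N) volume := by
  let b : ContDiffBump (0 : Eu N) := default
  have hb : IsH1 N b (gradient b) := isH1_of_contDiff b.contDiff b.hasCompactSupport
  refine ⟨b, _, hb, lpNorm_nonneg.lt_of_ne' fun h => ?_⟩
  rw [lpNorm_eq_zero hb.1 (critExp_ne_zero hN)] at h
  have h2 : (b : Eu N → ℝ) = 0 := (b.continuous.ae_eq_iff_eq volume continuous_zero).1 h
  have h3 : b 0 = 1 := b.one_of_mem_closedBall (by simp [b.rIn_pos.le])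
  rw [h2] at h3
  simp at h3

theorem IsH1.sobolev {K : ℝ} (hN : 3 ≤ N) (hK : ∀ f : Eu N → ℝ, ContDiff ℝ (⊤ : ℕ∞) f →
    HasCompactSupport f → K * lpNorm f (critExp N) volume ^ 2 ≤ lpNorm (gradient f) 2 volume ^ 2)
    {u : Eu N → ℝ} {G : Eu N → Eu N} (h : IsH1 N u G) :
    K * lpNorm u (critExp N) volume ^ 2 ≤ ∫ x, ‖G x‖ ^ 2 := by
  obtain ⟨hu, hG, f, hf, h1, h2⟩ := h
  rw [← sq_lpNorm_two hG.1]
  have t1 := tendsto_lpNorm (one_le_critExp hN)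
    (fun k => (hf k).1.continuous.memLp_of_hasCompactSupport (hf k).2) hu h1
  have t2 := tendsto_lpNorm (by simp) (fun k => memLp_gradient (hf k).1 (hf k).2 2) hG h2
  exact le_of_tendsto_of_tendsto' ((t1.pow 2).const_mul K) (t2.pow 2)
    fun k => hK _ (hf k).1 (hf k).2

/-! ### The Hardy inequality -/

/-- Expand `∫ r^m (r g' + (m+1)/2 · g)² ≥ 0` and integrate the cross term by parts; the boundary
terms vanish at `0` because of the factor `r^(m+1)`. -/
theorem hardy_one_dim (m : ℕ) {g g' : ℝ → ℝ} (hg : ∀ r, HasDerivAt g (g' r) r)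
    (hg' : Continuous g') (hc : HasCompactSupport g) (hc' : HasCompactSupport g') :
    ENNReal.ofReal (((m + 1 : ℝ) / 2) ^ 2) * ∫⁻ r in Set.Ioi (0 : ℝ), ENNReal.ofReal (r ^ m * g r ^ 2) ≤
      ∫⁻ r in Set.Ioi (0 : ℝ), ENNReal.ofReal (r ^ (m + 2) * g' r ^ 2) := by
  have hgc : Continuous g := continuous_iff_continuousAt.2 fun r => (hg r).continuousAt
  have i1 : Integrable fun r : ℝ => r ^ m * g r ^ 2 :=
    Continuous.integrable_of_hasCompactSupport (by fun_prop)
      ((hc.comp_left (g := fun x => x ^ 2) (by simp)).mul_left)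
  have i2 : Integrable fun r : ℝ => r ^ (m + 1) * (g r * g' r) :=
    Continuous.integrable_of_hasCompactSupport (by fun_prop) (hc.mul_right.mul_left)
  have i3 : Integrable fun r : ℝ => r ^ (m + 2) * g' r ^ 2 :=
    Continuous.integrable_of_hasCompactSupport (by fun_prop)
      ((hc'.comp_left (g := fun x => x ^ 2) (by simp)).mul_left)
  have hd : ∀ r, HasDerivAt (fun r : ℝ => r ^ (m + 1) * g r ^ 2)
      ((m + 1 : ℝ) * (r ^ m * g r ^ 2) + 2 * (r ^ (m + 1) * (g r * g' r))) r := by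
    intro r
    refine ((hasDerivAt_pow (m + 1) r).fun_mul ((hg r).fun_pow 2)).congr_deriv ?_
    push_cast
    simp
    ring
  have hcs : HasCompactSupport fun r : ℝ => r ^ (m + 1) * g r ^ 2 :=
    (hc.comp_left (g := fun x => x ^ 2) (by simp)).mul_left
  have h0 := integral_Ioi_of_hasDerivAt_of_tendsto' (a := 0) (fun r _ => hd r)
    (((i1.const_mul _).add (i2.const_mul _)).integrableOn)
    (hcs.is_zero_at_infty.mono_left atTop_le_cocompact)
  rw [integral_add (i1.const_mul _).integrableOn (i2.const_mul _).integrableOn,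
    integral_const_mul, integral_const_mul] at h0
  simp only [ne_eq, Nat.add_eq_zero_iff, one_ne_zero, and_false, not_false_eq_true, zero_pow, zero_mul,
    sub_zero] at h0
  have h1 : 0 ≤ ∫ r in Set.Ioi (0 : ℝ), (r ^ (m + 2) * g' r ^ 2 +
      (m + 1 : ℝ) * (r ^ (m + 1) * (g r * g' r)) + ((m + 1 : ℝ) / 2) ^ 2 * (r ^ m * g r ^ 2)) := by
    refine setIntegral_nonneg measurableSet_Ioi fun r hr => ?_
    have : r ^ (m + 2) * g' r ^ 2 +
      (m + 1 : ℝ) * (r ^ (m + 1) * (g r * g' r)) + ((m + 1 : ℝ) / 2) ^ 2 * (r ^ m * g r ^ 2) =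
      r ^ m * (r * g' r + (m + 1) / 2 * g r) ^ 2 := by ring
    rw [this]
    have : 0 ≤ r ^ m := pow_nonneg (le_of_lt hr) m
    positivity
  have i4 : Integrable fun r : ℝ => r ^ (m + 2) * g' r ^ 2 +
      (m + 1 : ℝ) * (r ^ (m + 1) * (g r * g' r)) := i3.add (i2.const_mul _)
  rw [integral_add i4.integrableOn (i1.const_mul _).integrableOn,
    integral_add i3.integrableOn (i2.const_mul _).integrableOn, integral_const_mul,
    integral_const_mul] at h1
  rw [← ofReal_integral_eq_lintegral_ofReal i1.integrableOn, ← ofReal_integral_eq_lintegral_ofReal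
    i3.integrableOn, ← ENNReal.ofReal_mul (by positivity)]
  · refine ENNReal.ofReal_le_ofReal ?_
    nlinarith
  · filter_upwards [ae_restrict_mem measurableSet_Ioi] with r hr
    have : 0 ≤ r ^ (m + 2) := pow_nonneg (le_of_lt hr) _
    simp only [Pi.zero_apply]; positivity
  · filter_upwards [ae_restrict_mem measurableSet_Ioi] with r hr
    have : 0 ≤ r ^ m := pow_nonneg (le_of_lt hr) _
    simp only [Pi.zero_apply]; positivity

/-- Apply the one-dimensional inequality with `m = N - 3` on each ray and bound the radial
derivative by the full gradient. -/
theorem lintegral_hardy (hN : 3 ≤ N) {f : Eu N → ℝ} (hf : ContDiff ℝ (⊤ : ℕ∞) f)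
    (hc : HasCompactSupport f) :
    ENNReal.ofReal ((((N : ℝ) - 2) / 2) ^ 2) * ∫⁻ x, ENNReal.ofReal ((‖x‖⁻¹ * f x) ^ 2) ≤
      ∫⁻ x, ENNReal.ofReal (‖gradient f x‖ ^ 2) := by
  have hfc := hf.continuous
  have hgc := continuous_gradient hf
  rw [lintegral_polar_Ioi hN (by fun_prop), lintegral_polar_Ioi hN (by fun_prop),
    ← lintegral_const_mul']
  swap; · simp
  refine lintegral_mono fun σ => ?_
  obtain ⟨m, rfl⟩ : ∃ m, N = m + 3 := ⟨N - 3, by omega⟩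
  have hd : ∀ r : ℝ, HasDerivAt (fun r : ℝ => f (r • (σ : Eu (m + 3))))
      (inner ℝ (gradient f (r • (σ : Eu (m + 3)))) (σ : Eu (m + 3))) r := by
    intro r
    have h1 := ((hf.differentiable (by simp)) (r • (σ : Eu (m + 3)))).hasGradientAt.hasFDerivAt
    have h2 : HasDerivAt (fun r : ℝ => r • (σ : Eu (m + 3))) (σ : Eu (m + 3)) r := by
      simpa using (hasDerivAt_id r).smul_const (σ : Eu (m + 3))
    exact (h1.comp_hasDerivAt r h2).congr_deriv (by simp)
  have hemb : Topology.IsClosedEmbedding fun r : ℝ => r • (σ : Eu (m + 3)) :=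
    isClosedEmbedding_smul_left (ne_zero_of_mem_unit_sphere σ)
  have key := hardy_one_dim m hd (by fun_prop) (hc.comp_isClosedEmbedding hemb) (by
    exact ((hasCompactSupport_gradient hc).comp_isClosedEmbedding hemb).comp_left
      (g := fun v => inner ℝ v (σ : Eu (m + 3))) (by simp))
  have e : (((m + 3 : ℕ) : ℝ) - 2) / 2 = (m + 1) / 2 := by push_cast; ring
  rw [e]
  refine le_trans (le_of_eq ?_) (key.trans ?_)
  · congr 1
    refine setLIntegral_congr_fun measurableSet_Ioi fun r hr => ?_
    have hr' : (r : ℝ) ≠ 0 := ne_of_gt hr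
    have : 0 ≤ r ^ (m + 2) := pow_nonneg (le_of_lt hr) _
    simp only [Nat.add_succ_sub_one]
    rw [← ENNReal.ofReal_mul this, norm_smul, norm_eq_of_mem_sphere, mul_one, Real.norm_eq_abs,
      mul_pow, inv_pow, sq_abs]
    congr 1
    field_simp
    ring
  · refine setLIntegral_mono' measurableSet_Ioi fun r hr => ?_
    have : 0 ≤ r ^ (m + 2) := pow_nonneg (le_of_lt hr) _
    simp only [Nat.add_succ_sub_one]
    rw [← ENNReal.ofReal_mul this]
    refine ENNReal.ofReal_le_ofReal (mul_le_mul_of_nonneg_left ?_ this)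
    rw [← sq_abs]
    have := abs_real_inner_le_norm (gradient f (r • (σ : Eu (m + 3)))) (σ : Eu (m + 3))
    rw [norm_eq_of_mem_sphere, mul_one] at this
    exact pow_le_pow_left₀ (abs_nonneg _) this 2

theorem eLpNorm_hardy (hN : 3 ≤ N) {f : Eu N → ℝ} (hf : ContDiff ℝ (⊤ : ℕ∞) f)
    (hc : HasCompactSupport f) :
    eLpNorm (fun x => (((N : ℝ) - 2) / 2) * (‖x‖⁻¹ * f x)) 2 volume ≤
      eLpNorm (gradient f) 2 volume := by
  have h := lintegral_hardy hN hf hc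
  rw [eLpNorm_eq_lintegral_rpow_enorm_toReal (by simp) (by simp),
    eLpNorm_eq_lintegral_rpow_enorm_toReal (by simp) (by simp)]
  refine ENNReal.rpow_le_rpow ?_ (by simp)
  rw [← lintegral_const_mul' _ _ (by simp)] at h
  convert h using 2
  · ext1 x
    rw [← ENNReal.ofReal_mul (by positivity), ← mul_pow, ← ofReal_norm, ENNReal.ofReal_rpow_of_nonneg
      (norm_nonneg _) (by simp)]
    rw [ENNReal.toReal_ofNat, Real.rpow_ofNat, Real.norm_eq_abs, sq_abs]
  · ext1 x
    rw [← ofReal_norm, ENNReal.ofReal_rpow_of_nonneg (norm_nonneg _) (by simp)]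
    simp

theorem IsH1.exists_seq_ae {u : Eu N → ℝ} {G : Eu N → Eu N} (hN : 3 ≤ N) (h : IsH1 N u G) :
    ∃ f : ℕ → Eu N → ℝ, (∀ k, ContDiff ℝ (⊤ : ℕ∞) (f k) ∧ HasCompactSupport (f k)) ∧
      (∀ᵐ x, Tendsto (fun k => f k x) atTop (𝓝 (u x))) ∧
      Tendsto (fun k => eLpNorm (gradient (f k)) 2 volume) atTop (𝓝 (eLpNorm G 2 volume)) := by
  obtain ⟨hu, hG, f, hf, h1, h2⟩ := h
  have hm := tendstoInMeasure_of_tendsto_eLpNorm (critExp_ne_zero hN)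
    (fun k => (hf k).1.continuous.aestronglyMeasurable) hu.1 h1
  obtain ⟨ns, hns, hae⟩ := hm.exists_seq_tendsto_ae
  refine ⟨fun k => f (ns k), fun k => hf _, hae, ?_⟩
  have t2 := tendsto_lpNorm (by simp) (fun k => memLp_gradient (hf k).1 (hf k).2 2) hG h2
  have := (ENNReal.tendsto_ofReal t2).comp hns.tendsto_atTop
  rw [ofReal_lpNorm hG] at this
  exact this.congr fun k => ofReal_lpNorm (memLp_gradient (hf _).1 (hf _).2 2)

/-- Fatou along an almost everywhere convergent subsequence of test functions; no convergence in the
weighted norm is needed. -/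
theorem IsH1.eLpNorm_hardy {u : Eu N → ℝ} {G : Eu N → Eu N} (hN : 3 ≤ N) (h : IsH1 N u G) :
    eLpNorm (fun x => (((N : ℝ) - 2) / 2) * (‖x‖⁻¹ * u x)) 2 volume ≤ eLpNorm G 2 volume := by
  obtain ⟨f, hf, hae, hlim⟩ := h.exists_seq_ae hN
  refine (Lp.eLpNorm_lim_le_liminf_eLpNorm
    (f := fun k x => (((N : ℝ) - 2) / 2) * (‖x‖⁻¹ * f k x)) (fun k => ?_) _ ?_).trans ?_
  · have := (hf k).1.continuous.measurable
    exact Measurable.aestronglyMeasurable (by fun_prop)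
  · filter_upwards [hae] with x hx
    exact (hx.const_mul _).const_mul _
  · rw [← hlim.liminf_eq]
    exact liminf_le_liminf (.of_forall fun k => HardySobolev.eLpNorm_hardy hN (hf k).1 (hf k).2)

/-- Hardy puts `u/‖x‖` in `L²`, so the integral defining the energy really converges and may be
split. -/
theorem IsH1.energy_eq {u : Eu N → ℝ} {G : Eu N → Eu N} (hN : 3 ≤ N) (h : IsH1 N u G) (γ : ℝ) :
    energy N γ u G = (∫ x, ‖G x‖ ^ 2) - γ * ∫ x, (‖x‖⁻¹ * u x) ^ 2 ∧
      (((N : ℝ) - 2) / 2) ^ 2 * ∫ x, (‖x‖⁻¹ * u x) ^ 2 ≤ ∫ x, ‖G x‖ ^ 2 := by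
  have h3 : (3 : ℝ) ≤ N := by exact_mod_cast hN
  have hle := h.eLpNorm_hardy hN
  have hm1 : AEStronglyMeasurable (fun x => (((N : ℝ) - 2) / 2) * (‖x‖⁻¹ * u x)) volume :=
    ((Measurable.aestronglyMeasurable (by fun_prop)).mul h.1.1).const_mul _
  have hm : MemLp (fun x => (((N : ℝ) - 2) / 2) * (‖x‖⁻¹ * u x)) 2 volume :=
    ⟨hm1, hle.trans_lt h.2.1.2⟩
  have hm' : MemLp (fun x => ‖x‖⁻¹ * u x) 2 volume := by
    have := hm.const_mul (((N : ℝ) - 2) / 2)⁻¹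
    refine this.ae_eq (.of_forall fun x => ?_)
    have : (N : ℝ) - 2 ≠ 0 := by linarith
    simp only
    field_simp
  constructor
  · rw [energy, ← integral_const_mul, ← integral_sub (h.2.1.integrable_norm_pow (by simp))
      (hm'.integrable_sq.const_mul γ)]
    refine integral_congr_ae (.of_forall fun x => ?_)
    simp only
    rw [mul_pow, inv_pow]; ring
  · have := ENNReal.toReal_mono h.2.1.2.ne hle
    rw [toReal_eLpNorm hm.1, toReal_eLpNorm h.2.1.1] at this
    have := pow_le_pow_left₀ lpNorm_nonneg this 2
    rw [sq_lpNorm_two hm.1, sq_lpNorm_two h.2.1.1] at this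
    simpa only [norm_mul, mul_pow, Real.norm_eq_abs, sq_abs, integral_const_mul] using this

theorem IsH1.energy_nonneg {u : Eu N → ℝ} {G : Eu N → Eu N} (hN : 3 ≤ N) (h : IsH1 N u G) {γ : ℝ}
    (hγ : γ ≤ ((N : ℝ) - 2) ^ 2 / 4) : 0 ≤ energy N γ u G := by
  obtain ⟨h1, h2⟩ := h.energy_eq hN γ
  have h0 : 0 ≤ ∫ x, (‖x‖⁻¹ * u x) ^ 2 := integral_nonneg fun x => by positivity
  rw [h1]
  nlinarith [mul_le_mul_of_nonneg_right hγ h0]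

/-! ### The best constants -/

theorem sSup_const_spec {ι : Type*} {P : ι → Prop} {b c : ι → ℝ} (hb : ∀ i, 0 ≤ b i)
    (hc : ∀ i, P i → 0 ≤ c i) :
    0 ≤ sSup {C : ℝ | ∀ i, P i → C * b i ≤ c i} ∧
      ∀ i, P i → sSup {C : ℝ | ∀ i, P i → C * b i ≤ c i} * b i ≤ c i := by
  set A := {C : ℝ | ∀ i, P i → C * b i ≤ c i}
  have h0 : (0 : ℝ) ∈ A := fun i hi => by simpa using hc i hi
  by_cases hA : BddAbove A
  · refine ⟨le_csSup hA h0, fun i hi => ?_⟩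
    rcases (hb i).eq_or_lt with h | h
    · rw [← h, mul_zero]; exact hc i hi
    · rw [← le_div_iff₀ h]
      exact csSup_le ⟨0, h0⟩ fun C hC => (le_div_iff₀ h).2 (hC i hi)
  -- The supremum of an unbounded set is `0` by convention, and `0` is an admissible constant.
  · rw [Real.sSup_of_not_bddAbove hA]
    exact ⟨le_rfl, fun i hi => by simpa using hc i hi⟩

/-- A positive constant is admissible, and one nonzero function bounds the admissible set above, so
the supremum is a genuine one. -/
theorem sobolevConst_pos (hN : 3 ≤ N) : 0 < sobolevConst N := by
  obtain ⟨K, hK, h⟩ := exists_sobolev hN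
  refine hK.trans_le (le_csSup ?_ fun u G hu => hu.sobolev hN h)
  obtain ⟨u, G, hu, hpos⟩ := exists_isH1_lpNorm_pos hN
  refine ⟨(∫ x, ‖G x‖ ^ 2) / lpNorm u (critExp N) volume ^ 2, fun C hC => ?_⟩
  rw [le_div_iff₀ (by positivity)]
  exact hC u G hu

theorem sobolevConst_mul_le {u : Eu N → ℝ} {G : Eu N → Eu N} (h : IsH1 N u G) :
    sobolevConst N * lpNorm u (critExp N) volume ^ 2 ≤ ∫ x, ‖G x‖ ^ 2 := by
  have := (sSup_const_spec (P := fun i : (Eu N → ℝ) × (Eu N → Eu N) => IsH1 N i.1 i.2)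
    (b := fun i => lpNorm i.1 (critExp N) volume ^ 2) (c := fun i => ∫ x, ‖i.2 x‖ ^ 2)
    (fun i => by positivity) (fun i _ => integral_nonneg fun x => by positivity)).2 (u, G) h
  simp only [Prod.forall] at this
  exact this

theorem hardySobolevConst_spec (hN : 3 ≤ N) {γ : ℝ} (hγ : γ ≤ ((N : ℝ) - 2) ^ 2 / 4) :
    0 ≤ hardySobolevConst N γ ∧ ∀ (u : Eu N → ℝ) (G : Eu N → Eu N), IsH1 N u G →
      hardySobolevConst N γ * lpNorm u (critExp N) volume ^ 2 ≤ energy N γ u G := by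
  have := sSup_const_spec (P := fun i : (Eu N → ℝ) × (Eu N → Eu N) => IsH1 N i.1 i.2)
    (b := fun i => lpNorm i.1 (critExp N) volume ^ 2) (c := fun i => energy N γ i.1 i.2)
    (fun i => by positivity) (fun i hi => hi.energy_nonneg hN hγ)
  simp only [Prod.forall] at this
  exact this

/-! ### The inequalities for test functions on the cylinder -/

theorem sobolevConst_mul_le_cyl (hN : 3 ≤ N) {F : ℝ × Eu N → ℝ} (hF : IsCylTest N F) :
    sobolevConst N * lpNorm (fun p : Cyl N => F (p.1, (p.2 : Eu N))) (critExp N) (cylMeasure N) ^ 2 ≤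
      ∫ p, ‖cylGrad N F p‖ ^ 2 ∂(cylMeasure N) +
        (((N : ℝ) - 2) / 2) ^ 2 * ∫ p, F (p.1, (p.2 : Eu N)) ^ 2 ∂(cylMeasure N) := by
  rw [← integral_norm_gradient_emden hN hF, ← lpNorm_emden hN hF]
  exact sobolevConst_mul_le (isH1_of_contDiff (hF.contDiff_emden _) (hF.hasCompactSupport_emden _))

theorem eps_sq {γ : ℝ} (hγ : γ ≤ ((N : ℝ) - 2) ^ 2 / 4) :
    eps N γ ^ 2 = (((N : ℝ) - 2) / 2) ^ 2 - γ := by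
  rw [eps, Real.sq_sqrt (by linarith)]; ring

theorem hardySobolevConst_mul_le_cyl (hN : 3 ≤ N) {γ : ℝ} (hγ : γ ≤ ((N : ℝ) - 2) ^ 2 / 4)
    {F : ℝ × Eu N → ℝ} (hF : IsCylTest N F) :
    hardySobolevConst N γ *
        lpNorm (fun p : Cyl N => F (p.1, (p.2 : Eu N))) (critExp N) (cylMeasure N) ^ 2 ≤
      ∫ p, ‖cylGrad N F p‖ ^ 2 ∂(cylMeasure N) +
        eps N γ ^ 2 * ∫ p, F (p.1, (p.2 : Eu N)) ^ 2 ∂(cylMeasure N) := by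
  have hH := isH1_of_contDiff (hF.contDiff_emden (((N : ℝ) - 2) / 2)) (hF.hasCompactSupport_emden _)
  have h := (hardySobolevConst_spec hN hγ).2 _ _ hH
  rw [(hH.energy_eq hN γ).1, integral_norm_gradient_emden hN hF, lpNorm_emden hN hF] at h
  have e : ∫ x, (‖x‖⁻¹ * emden (((N : ℝ) - 2) / 2) F x) ^ 2 =
      ∫ p, F (p.1, (p.2 : Eu N)) ^ 2 ∂(cylMeasure N) := by
    rw [← integral_emden_sq_div hN hF]
    refine integral_congr_ae (.of_forall fun x => ?_)
    simp only
    rw [mul_pow, inv_pow]; ring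
  rw [e] at h
  rw [eps_sq hγ]
  linarith

/-! ### Density of test functions in `H¹(ℝ × S^{N-1})` -/

theorem IsCylTest.differentiable {F : ℝ × Eu N → ℝ} (hF : IsCylTest N F) : Differentiable ℝ F :=
  hF.1.differentiable (by simp)

theorem cylGrad_add {F G : ℝ × Eu N → ℝ} (hF : IsCylTest N F) (hG : IsCylTest N G) (p : Cyl N) :
    cylGrad N (F + G) p = cylGrad N F p + cylGrad N G p := by
  have dF := hF.differentiable
  have dG := hG.differentiable
  have h1 : timeDeriv (F + G) p = timeDeriv F p + timeDeriv G p :=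
    deriv_fun_add (f := fun t => F (t, (p.2 : Eu N))) (g := fun t => G (t, (p.2 : Eu N)))
      (by fun_prop) (by fun_prop)
  have h2 : gradient (fun x => (F + G) (p.1, x)) (p.2 : Eu N) =
      gradient (fun x => F (p.1, x)) (p.2 : Eu N) + gradient (fun x => G (p.1, x)) (p.2 : Eu N) := by
    simp only [gradient, Pi.add_apply]
    rw [fderiv_fun_add (by fun_prop) (by fun_prop), map_add]
  have h3 : sphGrad (F + G) p = sphGrad F p + sphGrad G p := by
    simp only [sphGrad]
    rw [h2, inner_add_right, add_smul]
    abel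
  rw [cylGrad_eq, cylGrad_eq, cylGrad_eq, h1, h3]
  rfl

theorem cylGrad_const_smul (c : ℝ) {F : ℝ × Eu N → ℝ} (hF : IsCylTest N F) (p : Cyl N) :
    cylGrad N (c • F) p = c • cylGrad N F p := by
  have dF := hF.differentiable
  have h1 : timeDeriv (c • F) p = c • timeDeriv F p :=
    deriv_fun_const_smul (f := fun t => F (t, (p.2 : Eu N))) c (by fun_prop)
  have h2 : gradient (fun x => (c • F) (p.1, x)) (p.2 : Eu N) =
      c • gradient (fun x => F (p.1, x)) (p.2 : Eu N) := by
    simp only [gradient, Pi.smul_apply]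
    rw [fderiv_fun_const_smul (by fun_prop), map_smulₛₗ]
    simp
  have h3 : sphGrad (c • F) p = c • sphGrad F p := by
    simp only [sphGrad]
    rw [h2, inner_smul_right, smul_sub, mul_smul]
  rw [cylGrad_eq, cylGrad_eq, h1, h3]
  rfl

theorem IsCylTest.add {F G : ℝ × Eu N → ℝ} (hF : IsCylTest N F) (hG : IsCylTest N G) :
    IsCylTest N (F + G) := ⟨hF.1.add hG.1, hF.2.add hG.2⟩

theorem IsCylTest.const_smul {F : ℝ × Eu N → ℝ} (hF : IsCylTest N F) (c : ℝ) :
    IsCylTest N (c • F) := ⟨hF.1.const_smul c, hF.2.comp_left (g := fun x => c • x) (by simp)⟩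

theorem isCylTest_zero : IsCylTest N 0 := ⟨contDiff_const, HasCompactSupport.zero⟩

/-- Linearity of `cylGrad` on test functions: elements of `H1Cyl` are then limits of actual test
functions rather than of formal combinations. -/
theorem span_testGraph_subset : (Submodule.span ℝ (testGraph N) : Set (CylPair N)) ⊆ testGraph N := by
  intro w hw
  induction hw using Submodule.span_induction with
  | mem x h => exact h
  | zero =>
    refine ⟨0, isCylTest_zero, ?_, ?_⟩
    · exact Lp.coeFn_zero ..
    · filter_upwards [Lp.coeFn_zero (CylVec N) 2 (cylMeasure N)] with p hp
      have := cylGrad_const_smul (N := N) 0 isCylTest_zero p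
      rw [zero_smul, zero_smul] at this
      rw [this]
      exact hp
  | add x y _ _ hx hy =>
    obtain ⟨F, hF, h1, h2⟩ := hx
    obtain ⟨G, hG, h3, h4⟩ := hy
    refine ⟨F + G, hF.add hG, ?_, ?_⟩
    · filter_upwards [h1, h3, Lp.coeFn_add x.fst y.fst] with p e1 e2 e3
      exact e3.trans (by rw [Pi.add_apply, e1, e2]; rfl)
    · filter_upwards [h2, h4, Lp.coeFn_add x.snd y.snd] with p e1 e2 e3
      exact e3.trans (by rw [Pi.add_apply, e1, e2, cylGrad_add hF hG])
  | smul c x _ hx =>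
    obtain ⟨F, hF, h1, h2⟩ := hx
    refine ⟨c • F, hF.const_smul c, ?_, ?_⟩
    · filter_upwards [h1, Lp.coeFn_smul c x.fst] with p e1 e3
      exact e3.trans (by rw [Pi.smul_apply, e1]; rfl)
    · filter_upwards [h2, Lp.coeFn_smul c x.snd] with p e1 e3
      exact e3.trans (by rw [Pi.smul_apply, e1, cylGrad_const_smul c hF])

/-- The element `w` of `H¹(ℝ × S^{N-1})` is represented by the test function `F`. -/
def IsTestRep (F : ℝ × Eu N → ℝ) (w : H1Cyl N) : Prop :=
  IsCylTest N F ∧ h1Fn w =ᵐ[cylMeasure N] (fun p => F (p.1, (p.2 : Eu N))) ∧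
    h1Grad w =ᵐ[cylMeasure N] cylGrad N F

theorem dense_isTestRep : Dense {w : H1Cyl N | ∃ F, IsTestRep F w} := by
  intro φ
  rw [closure_subtype]
  refine closure_mono ?_ φ.2
  intro w hw
  obtain ⟨F, h⟩ := span_testGraph_subset hw
  exact ⟨⟨w, subset_closure hw⟩, ⟨F, h⟩, rfl⟩

theorem exists_test_seq (φ : H1Cyl N) : ∃ (F : ℕ → ℝ × Eu N → ℝ) (w : ℕ → H1Cyl N),
    (∀ k, IsTestRep (F k) (w k)) ∧ Tendsto w atTop (𝓝 φ) := by
  obtain ⟨w, hw, hlim⟩ := mem_closure_iff_seq_limit.1 (dense_isTestRep φ)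
  choose F hF using hw
  exact ⟨F, w, hF, hlim⟩

/-! ### Norms -/

theorem sq_norm_Lp {E : Type*} [NormedAddCommGroup E] (f : Lp E 2 (cylMeasure N)) :
    ‖f‖ ^ 2 = ∫ p, ‖f p‖ ^ 2 ∂(cylMeasure N) := by
  rw [Lp.norm_def, toReal_eLpNorm (Lp.aestronglyMeasurable f),
    sq_lpNorm_two (Lp.aestronglyMeasurable f)]

/-- The squared `L²` norm of the function. -/
def massSq (φ : H1Cyl N) : ℝ := ‖φ.1.fst‖ ^ 2

/-- The squared `L²` norm of the gradient. -/
def gradSq (φ : H1Cyl N) : ℝ := ‖φ.1.snd‖ ^ 2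

theorem massSq_eq (φ : H1Cyl N) : massSq φ = ∫ p, h1Fn φ p ^ 2 ∂(cylMeasure N) := by
  rw [massSq, sq_norm_Lp]; simp [h1Fn]

theorem gradSq_eq (φ : H1Cyl N) : gradSq φ = ∫ p, ‖h1Grad φ p‖ ^ 2 ∂(cylMeasure N) :=
  sq_norm_Lp _

theorem massSq_nonneg (φ : H1Cyl N) : 0 ≤ massSq φ := sq_nonneg _

theorem gradSq_nonneg (φ : H1Cyl N) : 0 ≤ gradSq φ := sq_nonneg _

theorem norm_sq_eq (φ : H1Cyl N) : ‖φ‖ ^ 2 = massSq φ + gradSq φ :=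
  WithLp.prod_norm_sq_eq_of_L2 φ.1

theorem continuous_massSq : Continuous (massSq (N := N)) :=
  ((WithLp.prod_continuous_ofLp 2 _ _).fst.comp continuous_subtype_val).norm.pow 2

theorem continuous_gradSq : Continuous (gradSq (N := N)) :=
  ((WithLp.prod_continuous_ofLp 2 _ _).snd.comp continuous_subtype_val).norm.pow 2

theorem memLp_h1Fn (φ : H1Cyl N) : MemLp (h1Fn φ) 2 (cylMeasure N) := Lp.memLp _

theorem memLp_h1Grad (φ : H1Cyl N) : MemLp (h1Grad φ) 2 (cylMeasure N) := Lp.memLp _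

theorem cylEnergy_eq (γ : ℝ) (φ : H1Cyl N) :
    cylEnergy N γ (h1Fn φ) (h1Grad φ) = gradSq φ + eps N γ ^ 2 * massSq φ := by
  rw [massSq_eq, gradSq_eq, cylEnergy, ← integral_const_mul, ← integral_add
    ((memLp_h1Grad φ).integrable_norm_pow (by simp)) ((memLp_h1Fn φ).integrable_sq.const_mul _)]

theorem IsTestRep.massSq_eq {F : ℝ × Eu N → ℝ} {w : H1Cyl N} (h : IsTestRep F w) :
    massSq w = ∫ p, F (p.1, (p.2 : Eu N)) ^ 2 ∂(cylMeasure N) := by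
  rw [HardySobolev.massSq_eq]
  exact integral_congr_ae (by filter_upwards [h.2.1] with p hp; rw [hp])

theorem IsTestRep.gradSq_eq {F : ℝ × Eu N → ℝ} {w : H1Cyl N} (h : IsTestRep F w) :
    gradSq w = ∫ p, ‖cylGrad N F p‖ ^ 2 ∂(cylMeasure N) := by
  rw [HardySobolev.gradSq_eq]
  exact integral_congr_ae (by filter_upwards [h.2.2] with p hp; rw [hp])

theorem IsTestRep.lpNorm_eq {F : ℝ × Eu N → ℝ} {w : H1Cyl N} (h : IsTestRep F w) :
    lpNorm (h1Fn w) (critExp N) (cylMeasure N) =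
      lpNorm (fun p : Cyl N => F (p.1, (p.2 : Eu N))) (critExp N) (cylMeasure N) := by
  rw [← toReal_eLpNorm (memLp_h1Fn w).1, ← toReal_eLpNorm (h.1.memLp (critExp N)).1,
    eLpNorm_congr_ae h.2.1]

/-! ### The Sobolev embedding -/

theorem h1Fn_sub (φ ψ : H1Cyl N) : h1Fn (φ - ψ) =ᵐ[cylMeasure N] h1Fn φ - h1Fn ψ :=
  Lp.coeFn_sub φ.1.fst ψ.1.fst

theorem exists_seq_ae {w : ℕ → H1Cyl N} {φ : H1Cyl N} (hlim : Tendsto w atTop (𝓝 φ)) :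
    ∃ ns : ℕ → ℕ, StrictMono ns ∧
      ∀ᵐ p ∂(cylMeasure N), Tendsto (fun k => h1Fn (w (ns k)) p) atTop (𝓝 (h1Fn φ p)) := by
  have h1 : Tendsto (fun k => (w k).1.fst) atTop (𝓝 φ.1.fst) :=
    (((WithLp.prod_continuous_ofLp 2 _ _).fst.comp continuous_subtype_val).tendsto φ).comp hlim
  exact (tendstoInMeasure_of_tendsto_Lp h1).exists_seq_tendsto_ae

/-- Sobolev for test functions, then Fatou along an almost everywhere convergent subsequence, which
also yields membership in `L^{2⋆}`. -/
theorem exists_embedding (hN : 3 ≤ N) : ∃ C : ℝ, 0 < C ∧ ∀ φ : H1Cyl N,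
    MemLp (h1Fn φ) (critExp N) (cylMeasure N) ∧
      lpNorm (h1Fn φ) (critExp N) (cylMeasure N) ≤ C * ‖φ‖ := by
  have hS := sobolevConst_pos hN
  -- With `a = (N-2)/2`, the cylinder energy is at most `(1 + a²)` times the unweighted squared
  -- norm.
  set D : ℝ := (1 + (((N : ℝ) - 2) / 2) ^ 2) / sobolevConst N with hD
  have hDpos : 0 < D := by positivity
  have htest : ∀ (F : ℝ × Eu N → ℝ) (w : H1Cyl N), IsTestRep F w →
      eLpNorm (h1Fn w) (critExp N) (cylMeasure N) ≤ ENNReal.ofReal (Real.sqrt D * ‖w‖) := by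
    intro F w h
    have hm : MemLp (h1Fn w) (critExp N) (cylMeasure N) := (h.1.memLp (critExp N)).ae_eq h.2.1.symm
    rw [← ofReal_lpNorm hm]
    refine ENNReal.ofReal_le_ofReal (abs_le_of_sq_le_sq' ?_ (by positivity)).2
    have h1 := sobolevConst_mul_le_cyl hN h.1
    rw [← h.massSq_eq, ← h.gradSq_eq, ← h.lpNorm_eq] at h1
    rw [mul_pow, Real.sq_sqrt hDpos.le, norm_sq_eq, hD, div_mul_eq_mul_div, le_div_iff₀ hS]
    nlinarith [massSq_nonneg w, gradSq_nonneg w, mul_nonneg (sq_nonneg (((N : ℝ) - 2) / 2))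
      (gradSq_nonneg w)]
  refine ⟨Real.sqrt D, Real.sqrt_pos.2 hDpos, fun φ => ?_⟩
  obtain ⟨F, w, hw, hlim⟩ := exists_test_seq φ
  obtain ⟨ns, hns, hae⟩ := exists_seq_ae hlim
  have hle : eLpNorm (h1Fn φ) (critExp N) (cylMeasure N) ≤ ENNReal.ofReal (Real.sqrt D * ‖φ‖) := by
    refine (Lp.eLpNorm_lim_le_liminf_eLpNorm (fun k => (memLp_h1Fn (w (ns k))).1) _ hae).trans ?_
    have ht : Tendsto (fun k => ENNReal.ofReal (Real.sqrt D * ‖w (ns k)‖)) atTop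
        (𝓝 (ENNReal.ofReal (Real.sqrt D * ‖φ‖))) :=
      ENNReal.tendsto_ofReal ((hlim.norm.comp hns.tendsto_atTop).const_mul _)
    rw [← ht.liminf_eq]
    exact liminf_le_liminf (.of_forall fun k => htest _ _ (hw _))
  have hm : MemLp (h1Fn φ) (critExp N) (cylMeasure N) :=
    ⟨(memLp_h1Fn φ).1, hle.trans_lt ENNReal.ofReal_lt_top⟩
  refine ⟨hm, ?_⟩
  rw [← ofReal_lpNorm hm] at hle
  exact (ENNReal.ofReal_le_ofReal_iff (by positivity)).1 hle

theorem continuous_lpNorm_h1Fn (hN : 3 ≤ N) :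
    Continuous fun φ : H1Cyl N => lpNorm (h1Fn φ) (critExp N) (cylMeasure N) := by
  obtain ⟨C, hC, h⟩ := exists_embedding hN
  have hsub : ∀ φ ψ : H1Cyl N, lpNorm (h1Fn φ) (critExp N) (cylMeasure N) ≤
      lpNorm (h1Fn ψ) (critExp N) (cylMeasure N) + C * dist φ ψ := by
    intro φ ψ
    refine (lpNorm_le_lpNorm_add_lpNorm_sub' (h ψ).1 (one_le_critExp hN)).trans ?_
    rw [dist_eq_norm]
    have e : lpNorm (h1Fn φ - h1Fn ψ) (critExp N) (cylMeasure N) =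
        lpNorm (h1Fn (φ - ψ)) (critExp N) (cylMeasure N) := by
      rw [← toReal_eLpNorm ((h φ).1.sub (h ψ).1).1, ← toReal_eLpNorm (h (φ - ψ)).1.1,
        eLpNorm_congr_ae (h1Fn_sub φ ψ)]
    rw [e]
    gcongr
    exact (h _).2
  refine (LipschitzWith.of_le_add_mul (Real.toNNReal C) fun φ ψ => ?_).continuous
  rw [Real.coe_toNNReal _ hC.le]
  exact hsub φ ψ

theorem hardySobolevConst_mul_le_h1 (hN : 3 ≤ N) {γ : ℝ} (hγ : γ ≤ ((N : ℝ) - 2) ^ 2 / 4)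
    (φ : H1Cyl N) :
    hardySobolevConst N γ * lpNorm (h1Fn φ) (critExp N) (cylMeasure N) ^ 2 ≤
      gradSq φ + eps N γ ^ 2 * massSq φ := by
  have hcl := isClosed_le (((continuous_lpNorm_h1Fn hN).pow 2).const_mul (hardySobolevConst N γ))
    (continuous_gradSq.add (continuous_massSq.const_mul (eps N γ ^ 2)))
  refine isClosed_property dense_isTestRep.denseRange_val hcl ?_ φ
  rintro ⟨w, F, h⟩
  have := hardySobolevConst_mul_le_cyl hN hγ h.1
  rwa [← h.massSq_eq, ← h.gradSq_eq, ← h.lpNorm_eq] at this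

/-! ### Local averages -/

/-- Cauchy-Schwarz applied to `√k` and `√k · f`. -/
theorem sq_lintegral_mul_le {α : Type*} [MeasurableSpace α] {μ : Measure α} {k f : α → ENNReal}
    (hk : AEMeasurable k μ) (hf : AEMeasurable f μ) :
    (∫⁻ x, k x * f x ∂μ) ^ 2 ≤ (∫⁻ x, k x ∂μ) * ∫⁻ x, k x * f x ^ 2 ∂μ := by
  have h := ENNReal.lintegral_mul_le_Lp_mul_Lq μ Real.HolderConjugate.two_two
    (hk.pow_const (1 / 2 : ℝ)) ((hk.pow_const (1 / 2 : ℝ)).mul hf)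
  have e0 : ∀ x, k x ^ (1 / 2 : ℝ) * k x ^ (1 / 2 : ℝ) = k x := fun x => by
    rw [← ENNReal.rpow_add_of_nonneg _ _ (by norm_num) (by norm_num)]; norm_num
  have e1 : ∀ x, (k x ^ (1 / 2 : ℝ)) ^ (2 : ℝ) = k x := fun x => by
    rw [← ENNReal.rpow_mul]; norm_num
  have e2 : ∀ x, (k x ^ (1 / 2 : ℝ) * f x) ^ (2 : ℝ) = k x * f x ^ 2 := fun x => by
    rw [ENNReal.mul_rpow_of_nonneg _ _ (by norm_num), e1, ENNReal.rpow_ofNat]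
  simp only [Pi.mul_apply, ← mul_assoc, e0, e1, e2] at h
  calc (∫⁻ x, k x * f x ∂μ) ^ 2 ≤ _ := pow_le_pow_left' h 2
    _ = _ := by
      rw [mul_pow, ← ENNReal.rpow_natCast, ← ENNReal.rpow_natCast, ← ENNReal.rpow_mul,
        ← ENNReal.rpow_mul]
      norm_num

/-- The tent function of width `δ`. -/
def tent (δ : ℝ) (z : Eu N) : ℝ := max 0 (1 - ‖z‖ / δ)

theorem continuous_tent (δ : ℝ) : Continuous (tent (N := N) δ) := by unfold tent; fun_prop

theorem tent_nonneg (δ : ℝ) (z : Eu N) : 0 ≤ tent δ z := le_max_left _ _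

theorem tent_le_one {δ : ℝ} (hδ : 0 < δ) (z : Eu N) : tent δ z ≤ 1 :=
  max_le zero_le_one (by linarith [div_nonneg (norm_nonneg z) hδ.le])

theorem tent_eq_zero {δ : ℝ} (hδ : 0 < δ) {z : Eu N} (hz : δ ≤ ‖z‖) : tent δ z = 0 :=
  max_eq_left (by linarith [(one_le_div hδ).2 hz])

theorem half_le_tent {δ : ℝ} (hδ : 0 < δ) {z : Eu N} (hz : ‖z‖ ≤ δ / 2) : 1 / 2 ≤ tent δ z := by
  refine le_max_of_le_right ?_
  have : ‖z‖ / δ ≤ 1 / 2 := by rw [div_le_iff₀ hδ]; linarith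
  linarith

theorem abs_tent_sub_le {δ : ℝ} (hδ : 0 < δ) (y z : Eu N) : |tent δ y - tent δ z| ≤ ‖y - z‖ / δ := by
  refine (abs_max_sub_max_le_max _ _ _ _).trans ?_
  rw [sub_self, abs_zero, sub_sub_sub_cancel_left, ← sub_div, abs_div, abs_of_pos hδ]
  refine max_le (by positivity) ?_
  gcongr
  rw [norm_sub_rev]
  exact abs_norm_sub_norm_le z y

theorem hasCompactSupport_tent_smul {δ : ℝ} (hδ : 0 < δ) {c : ℝ} (hc : 0 < c) :
    HasCompactSupport fun h : Eu N => tent δ (c • h) := by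
  refine HasCompactSupport.intro (isCompact_closedBall (0 : Eu N) (δ / c)) fun h hh => ?_
  refine tent_eq_zero hδ ?_
  rw [mem_closedBall_zero_iff, not_le, div_lt_iff₀ hc] at hh
  rw [norm_smul, Real.norm_of_nonneg hc.le]
  linarith

/-- The average of `v` near `x`, at scale `δ ‖x‖`. -/
def localAvg (δ : ℝ) (v : Eu N → ℝ) (x : Eu N) : ℝ :=
  (∫ h : Eu N, tent δ (‖x‖⁻¹ • h))⁻¹ * ∫ h : Eu N, tent δ (‖x‖⁻¹ • h) * v (x + h)

theorem lintegral_tent_ge {δ : ℝ} (hδ : 0 < δ) {c : ℝ} (hc : 0 < c) :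
    ENNReal.ofReal (1 / 2 * (δ / (2 * c)) ^ N) * volume (Metric.ball (0 : Eu N) 1) ≤
      ∫⁻ h : Eu N, ENNReal.ofReal (tent δ (c • h)) := by
  have h1 : volume (Metric.ball (0 : Eu N) (δ / (2 * c))) =
      ENNReal.ofReal ((δ / (2 * c)) ^ N) * volume (Metric.ball (0 : Eu N) 1) := by
    rw [Measure.addHaar_ball_of_pos _ _ (by positivity), finrank_euclideanSpace, Fintype.card_fin]
  rw [ENNReal.ofReal_mul (by norm_num), mul_assoc, ← h1, ← setLIntegral_const]
  refine (setLIntegral_mono' Metric.isOpen_ball.measurableSet fun h hh => ?_).trans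
    (setLIntegral_le_lintegral _ _)
  refine ENNReal.ofReal_le_ofReal (half_le_tent hδ ?_)
  rw [mem_ball_zero_iff, lt_div_iff₀ (by positivity)] at hh
  rw [norm_smul, Real.norm_of_nonneg hc.le]
  linarith

/-- Jensen's inequality for the normalized tent weight. -/
theorem enorm_sub_localAvg_sq_le {δ : ℝ} (hδ : 0 < δ) {v : Eu N → ℝ} (hv : Continuous v) {x : Eu N}
    (hx : x ≠ 0) :
    ‖v x - localAvg δ v x‖ₑ ^ 2 ≤ (∫⁻ h : Eu N, ENNReal.ofReal (tent δ (‖x‖⁻¹ • h)))⁻¹ *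
      ∫⁻ h, ENNReal.ofReal (tent δ (‖x‖⁻¹ • h)) * ‖v (x + h) - v x‖ₑ ^ 2 := by
  have hc : 0 < ‖x‖⁻¹ := inv_pos.2 (norm_pos_iff.2 hx)
  have hkc : Continuous fun h : Eu N => tent δ (‖x‖⁻¹ • h) :=
    (continuous_tent δ).comp (by fun_prop)
  have hks := hasCompactSupport_tent_smul (N := N) hδ hc
  have hki := hkc.integrable_of_hasCompactSupport (μ := volume) hks
  have hkv : Integrable fun h : Eu N => tent δ (‖x‖⁻¹ • h) * v (x + h) :=
    (hkc.mul (by fun_prop)).integrable_of_hasCompactSupport hks.mul_right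
  set I := ∫⁻ h : Eu N, ENNReal.ofReal (tent δ (‖x‖⁻¹ • h)) with hI
  have hIr : ENNReal.ofReal (∫ h : Eu N, tent δ (‖x‖⁻¹ • h)) = I :=
    ofReal_integral_eq_lintegral_ofReal hki (.of_forall fun h => tent_nonneg _ _)
  have hItop : I ≠ ⊤ := by rw [← hIr]; exact ENNReal.ofReal_ne_top
  have hI0 : I ≠ 0 := by
    refine (lt_of_lt_of_le ?_ (lintegral_tent_ge hδ hc)).ne'
    refine ENNReal.mul_pos ?_ (Metric.measure_ball_pos _ _ one_pos).ne'
    simp only [ne_eq, ENNReal.ofReal_eq_zero, not_le]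
    positivity
  have hpos : 0 < ∫ h : Eu N, tent δ (‖x‖⁻¹ • h) := by
    by_contra hn
    rw [ENNReal.ofReal_of_nonpos (not_lt.1 hn)] at hIr
    exact hI0 hIr.symm
  have e1 : v x - localAvg δ v x = (∫ h : Eu N, tent δ (‖x‖⁻¹ • h))⁻¹ *
      ∫ h, tent δ (‖x‖⁻¹ • h) * (v x - v (x + h)) := by
    simp_rw [mul_sub]
    rw [integral_sub (hki.mul_const _) hkv, integral_mul_const, mul_sub, localAvg, ← mul_assoc,
      inv_mul_cancel₀ hpos.ne', one_mul]
  have e2 : ‖v x - localAvg δ v x‖ₑ ≤ I⁻¹ *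
      ∫⁻ h, ENNReal.ofReal (tent δ (‖x‖⁻¹ • h)) * ‖v (x + h) - v x‖ₑ := by
    rw [e1, enorm_mul, Real.enorm_of_nonneg (inv_pos.2 hpos).le, ENNReal.ofReal_inv_of_pos hpos, hIr]
    gcongr
    refine (enorm_integral_le_lintegral_enorm _).trans (lintegral_mono fun h => ?_)
    rw [enorm_mul, Real.enorm_of_nonneg (tent_nonneg _ _), ← enorm_neg, neg_sub]
  calc ‖v x - localAvg δ v x‖ₑ ^ 2 ≤ _ := pow_le_pow_left' e2 2
    _ ≤ I⁻¹ ^ 2 * (I * ∫⁻ h, ENNReal.ofReal (tent δ (‖x‖⁻¹ • h)) * ‖v (x + h) - v x‖ₑ ^ 2) := by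
      rw [mul_pow]
      gcongr
      exact sq_lintegral_mul_le hkc.measurable.ennreal_ofReal.aemeasurable (by fun_prop)
    _ = _ := by
      rw [pow_two, ← mul_assoc, mul_assoc I⁻¹, ENNReal.inv_mul_cancel hI0 hItop, mul_one]

/-- Fundamental theorem of calculus on the segment, then Cauchy-Schwarz on the unit interval. -/
theorem enorm_sub_sq_le_lintegral {v : Eu N → ℝ} (hv : ContDiff ℝ (⊤ : ℕ∞) v) (x h : Eu N) :
    ‖v (x + h) - v x‖ₑ ^ 2 ≤
      ∫⁻ s in Set.Ioc (0 : ℝ) 1, ENNReal.ofReal (‖h‖ ^ 2 * ‖gradient v (x + s • h)‖ ^ 2) := by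
  have hgc := continuous_gradient hv
  have hd : ∀ s : ℝ, HasDerivAt (fun s : ℝ => v (x + s • h))
      (inner ℝ (gradient v (x + s • h)) h) s := by
    intro s
    have h1 := ((hv.differentiable (by simp)) (x + s • h)).hasGradientAt.hasFDerivAt
    have h2 : HasDerivAt (fun s : ℝ => x + s • h) h s := by
      simpa using ((hasDerivAt_id s).smul_const h).const_add x
    exact (h1.comp_hasDerivAt s h2).congr_deriv (by simp)
  have hc : Continuous fun s : ℝ => inner ℝ (gradient v (x + s • h)) h := by fun_prop
  have h1 := intervalIntegral.integral_eq_sub_of_hasDerivAt (a := 0) (b := 1) (fun s _ => hd s)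
    (hc.intervalIntegrable 0 1)
  simp only [one_smul, zero_smul, add_zero] at h1
  rw [← h1, intervalIntegral.integral_of_le zero_le_one]
  have h2 := sq_lintegral_mul_le (μ := volume.restrict (Set.Ioc (0 : ℝ) 1)) (k := fun _ => 1)
    (f := fun s => ‖inner ℝ (gradient v (x + s • h)) h‖ₑ) (by fun_prop) (by fun_prop)
  simp only [one_mul, lintegral_const, Measure.restrict_apply MeasurableSet.univ, Set.univ_inter,
    Real.volume_Ioc, sub_zero, ENNReal.ofReal_one, mul_one] at h2
  refine (pow_le_pow_left' (enorm_integral_le_lintegral_enorm _) 2).trans (h2.trans ?_)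
  refine lintegral_mono fun s => ?_
  rw [← ofReal_norm, ← ENNReal.ofReal_pow (norm_nonneg _)]
  refine ENNReal.ofReal_le_ofReal ?_
  rw [← mul_pow, mul_comm]
  exact pow_le_pow_left₀ (norm_nonneg _) (norm_inner_le_norm _ _) 2

/-- A majorant for the local oscillation of `v`: on pairs `(z, h)` with `‖h‖ < 2δ‖z‖` it is, up to
a constant, `‖z‖^(2-2N) ‖∇v(z)‖²`. -/
def oscMajorant (δ : ℝ) (v : Eu N → ℝ) : Eu N × Eu N → ENNReal :=
  Set.indicator {q | ‖q.2‖ < 2 * δ * ‖q.1‖} fun q =>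
    (volume (Metric.ball (0 : Eu N) 1))⁻¹ * ENNReal.ofReal (2 * (2 / δ) ^ N * ((3 / 2) ^ (2 * N) *
      (‖q.1‖ ^ (2 * N))⁻¹ * (2 * δ * ‖q.1‖) ^ 2 * ‖gradient v q.1‖ ^ 2))

theorem measurable_oscMajorant (δ : ℝ) {v : Eu N → ℝ} (hv : ContDiff ℝ (⊤ : ℕ∞) v) :
    Measurable (oscMajorant δ v) := by
  have hg := (continuous_gradient hv).measurable
  refine Measurable.indicator (by fun_prop) ?_
  exact measurableSet_lt (by fun_prop) (by fun_prop)

/-- For `‖h‖ < δ‖x‖` with `δ ≤ 1/2`, the points `z = x + s h` satisfy `‖x‖/2 ≤ ‖z‖ ≤ 3‖x‖/2`. All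
weights can thus be expressed through `z`, which prepares the translation `x ↦ z`. -/
theorem weight_mul_sub_localAvg_le {δ : ℝ} (hδ : 0 < δ) (hδ' : δ ≤ 1 / 2) {v : Eu N → ℝ}
    (hv : ContDiff ℝ (⊤ : ℕ∞) v) {x : Eu N} (hx : x ≠ 0) :
    ENNReal.ofReal ((‖x‖ ^ N)⁻¹) * ‖v x - localAvg δ v x‖ₑ ^ 2 ≤
      ∫⁻ h, ∫⁻ s in Set.Ioc (0 : ℝ) 1, oscMajorant δ v (x + s • h, h) := by
  have hr : 0 < ‖x‖ := norm_pos_iff.2 hx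
  have hc : 0 < ‖x‖⁻¹ := inv_pos.2 hr
  set ω := volume (Metric.ball (0 : Eu N) 1) with hω
  have hω0 : ω ≠ 0 := (Metric.measure_ball_pos _ _ one_pos).ne'
  have hω1 : ω ≠ ⊤ := measure_ball_lt_top.ne
  have hJ : 0 < 1 / 2 * (δ / (2 * ‖x‖⁻¹)) ^ N := by positivity
  have h1 : (∫⁻ h : Eu N, ENNReal.ofReal (tent δ (‖x‖⁻¹ • h)))⁻¹ ≤
      ENNReal.ofReal ((1 / 2 * (δ / (2 * ‖x‖⁻¹)) ^ N)⁻¹) * ω⁻¹ := by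
    rw [ENNReal.ofReal_inv_of_pos hJ, ← ENNReal.mul_inv (Or.inr hω1) (Or.inr hω0)]
    exact ENNReal.inv_le_inv.2 (lintegral_tent_ge hδ hc)
  set c := ENNReal.ofReal ((‖x‖ ^ N)⁻¹) * (ENNReal.ofReal ((1 / 2 * (δ / (2 * ‖x‖⁻¹)) ^ N)⁻¹) * ω⁻¹)
    with hcdef
  have hctop : c ≠ ⊤ := ENNReal.mul_ne_top ENNReal.ofReal_ne_top
    (ENNReal.mul_ne_top ENNReal.ofReal_ne_top (ENNReal.inv_ne_top.2 hω0))
  calc _ ≤ c * ∫⁻ h, ENNReal.ofReal (tent δ (‖x‖⁻¹ • h)) * ‖v (x + h) - v x‖ₑ ^ 2 := by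
        rw [hcdef, mul_assoc (ENNReal.ofReal ((‖x‖ ^ N)⁻¹))]
        gcongr
        refine (enorm_sub_localAvg_sq_le hδ hv.continuous hx).trans ?_
        gcongr
    _ = ∫⁻ h, c * (ENNReal.ofReal (tent δ (‖x‖⁻¹ • h)) * ‖v (x + h) - v x‖ₑ ^ 2) :=
        (lintegral_const_mul' _ _ hctop).symm
    _ ≤ _ := by
        refine lintegral_mono fun h => ?_
        rcases le_or_gt (δ * ‖x‖) ‖h‖ with hh | hh
        · have : tent δ (‖x‖⁻¹ • h) = 0 := by
            refine tent_eq_zero hδ ?_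
            rw [norm_smul, Real.norm_of_nonneg hc.le, ← div_eq_inv_mul, le_div_iff₀ hr]
            exact hh
          simp [this]
        calc _ ≤ c * ∫⁻ s in Set.Ioc (0 : ℝ) 1,
                ENNReal.ofReal (‖h‖ ^ 2 * ‖gradient v (x + s • h)‖ ^ 2) := by
              gcongr
              refine le_trans ?_ (enorm_sub_sq_le_lintegral hv x h)
              refine mul_le_of_le_one_left zero_le ?_
              rw [← ENNReal.ofReal_one]
              exact ENNReal.ofReal_le_ofReal (tent_le_one hδ _)
          _ = ∫⁻ s in Set.Ioc (0 : ℝ) 1,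
                c * ENNReal.ofReal (‖h‖ ^ 2 * ‖gradient v (x + s • h)‖ ^ 2) :=
              (lintegral_const_mul' _ _ hctop).symm
          _ ≤ _ := by
              refine setLIntegral_mono' measurableSet_Ioc fun s hs => ?_
              have hsh : ‖s • h‖ ≤ ‖h‖ := by
                rw [norm_smul, Real.norm_of_nonneg hs.1.le]
                exact mul_le_of_le_one_left (norm_nonneg _) hs.2
              have hz1 : ‖x + s • h‖ ≤ 3 / 2 * ‖x‖ := by
                have := norm_add_le x (s • h)
                nlinarith
              have hz2 : ‖x‖ ≤ 2 * ‖x + s • h‖ := by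
                have := norm_sub_le (x + s • h) (s • h)
                rw [add_sub_cancel_right] at this
                nlinarith
              have hmem : (x + s • h, h) ∈ {q : Eu N × Eu N | ‖q.2‖ < 2 * δ * ‖q.1‖} := by
                simp only [Set.mem_ofPred_eq]
                nlinarith
              have hζ : 0 < ‖x + s • h‖ := by linarith
              rw [oscMajorant, Set.indicator_of_mem hmem, hcdef, ← hω, ← mul_assoc, mul_comm _ ω⁻¹,
                mul_assoc ω⁻¹]
              gcongr
              rw [← ENNReal.ofReal_mul (by positivity), ← ENNReal.ofReal_mul (by positivity)]
              refine ENNReal.ofReal_le_ofReal ?_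
              have e1 : (‖x‖ ^ N)⁻¹ * (1 / 2 * (δ / (2 * ‖x‖⁻¹)) ^ N)⁻¹ =
                  2 * (2 / δ) ^ N * (‖x‖ ^ (2 * N))⁻¹ := by
                rw [pow_mul', sq, div_pow, mul_pow, inv_pow, div_pow]
                field_simp
              have e2 : (‖x‖ ^ (2 * N))⁻¹ ≤ (3 / 2) ^ (2 * N) * (‖x + s • h‖ ^ (2 * N))⁻¹ := by
                rw [← div_eq_mul_inv, le_div_iff₀ (by positivity), inv_mul_le_iff₀ (by positivity),
                  ← mul_pow]
                refine pow_le_pow_left₀ (norm_nonneg _) ?_ _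
                linarith
              have e3 : ‖h‖ ^ 2 ≤ (2 * δ * ‖x + s • h‖) ^ 2 :=
                pow_le_pow_left₀ (norm_nonneg _) hmem.le 2
              rw [e1, mul_assoc]
              refine mul_le_mul_of_nonneg_left ?_ (by positivity)
              rw [← mul_assoc]
              gcongr

/-- A scale-invariant Poincaré inequality. By Tonelli, translate in `x` for fixed `h` and `s`, then
integrate the majorant over the ball `‖h‖ < 2δ‖z‖`. The constant is `2 (2/δ)^N (9/4)^N (2δ)² (2δ)^N
= 8 · 9^N δ²`. -/
theorem lintegral_sub_localAvg_le (hN : 3 ≤ N) {δ : ℝ} (hδ : 0 < δ) (hδ' : δ ≤ 1 / 2)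
    {v : Eu N → ℝ} (hv : ContDiff ℝ (⊤ : ℕ∞) v) :
    ∫⁻ x, ENNReal.ofReal ((‖x‖ ^ N)⁻¹) * ‖v x - localAvg δ v x‖ₑ ^ 2 ≤
      ENNReal.ofReal (8 * 9 ^ N * δ ^ 2) *
        ∫⁻ x, ENNReal.ofReal ((‖x‖ ^ N)⁻¹ * (‖x‖ ^ 2 * ‖gradient v x‖ ^ 2)) := by
  have : Nonempty (Fin N) := ⟨⟨0, by omega⟩⟩
  have hm := measurable_oscMajorant δ hv
  have hae : ∀ᵐ x : Eu N, x ≠ 0 := by simp [ae_iff]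
  calc _ ≤ ∫⁻ x, ∫⁻ h, ∫⁻ s in Set.Ioc (0 : ℝ) 1, oscMajorant δ v (x + s • h, h) := by
        refine lintegral_mono_ae ?_
        filter_upwards [hae] with x hx
        exact weight_mul_sub_localAvg_le hδ hδ' hv hx
    _ = ∫⁻ h, ∫⁻ x, ∫⁻ s in Set.Ioc (0 : ℝ) 1, oscMajorant δ v (x + s • h, h) := by
        refine lintegral_lintegral_swap ?_
        refine (Measurable.lintegral_prod_right' (f := fun q : (Eu N × Eu N) × ℝ =>
          oscMajorant δ v (q.1.1 + q.2 • q.1.2, q.1.2)) ?_).aemeasurable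
        exact hm.comp (by fun_prop)
    _ = ∫⁻ h, ∫⁻ s in Set.Ioc (0 : ℝ) 1, ∫⁻ x, oscMajorant δ v (x + s • h, h) := by
        refine lintegral_congr fun h => lintegral_lintegral_swap ?_
        exact (hm.comp (by fun_prop : Measurable fun q : Eu N × ℝ => (q.1 + q.2 • h, h))).aemeasurable
    _ = ∫⁻ h, ∫⁻ z, oscMajorant δ v (z, h) := by
        refine lintegral_congr fun h => ?_
        simp_rw [lintegral_add_right_eq_self (fun z => oscMajorant δ v (z, h))]
        simp
    _ = ∫⁻ z, ∫⁻ h, oscMajorant δ v (z, h) :=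
        lintegral_lintegral_swap (hm.comp measurable_swap).aemeasurable
    _ = _ := by
        rw [← lintegral_const_mul' _ _ ENNReal.ofReal_ne_top]
        refine lintegral_congr_ae ?_
        filter_upwards [hae] with z hz
        have hζ : 0 < ‖z‖ := norm_pos_iff.2 hz
        have e : ∀ h, oscMajorant δ v (z, h) = (Metric.ball (0 : Eu N) (2 * δ * ‖z‖)).indicator
            (fun _ => (volume (Metric.ball (0 : Eu N) 1))⁻¹ *
              ENNReal.ofReal (2 * (2 / δ) ^ N * ((3 / 2) ^ (2 * N) *
      (‖z‖ ^ (2 * N))⁻¹ * (2 * δ * ‖z‖) ^ 2 * ‖gradient v z‖ ^ 2))) h := by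
          intro h
          simp [oscMajorant, Set.indicator]
        simp_rw [e]
        rw [lintegral_indicator_const Metric.isOpen_ball.measurableSet,
          Measure.addHaar_ball_of_pos _ _ (by positivity : 0 < 2 * δ * ‖z‖), finrank_euclideanSpace, Fintype.card_fin]
        have hω0 : volume (Metric.ball (0 : Eu N) 1) ≠ 0 :=
          (Metric.measure_ball_pos _ _ one_pos).ne'
        have hω1 : volume (Metric.ball (0 : Eu N) 1) ≠ ⊤ := measure_ball_lt_top.ne
        rw [mul_comm (ENNReal.ofReal ((2 * δ * ‖z‖) ^ N)), mul_comm (_⁻¹), mul_assoc,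
          ← mul_assoc (_⁻¹), ENNReal.inv_mul_cancel hω0 hω1, one_mul,
          ← ENNReal.ofReal_mul (by positivity), ← ENNReal.ofReal_mul (by positivity)]
        congr 1
        rw [pow_mul, pow_mul', sq (‖z‖ ^ N), mul_pow _ ‖z‖ N, mul_pow 2 δ N, div_pow]
        have e9 : (9 : ℝ) ^ N = 2 ^ N * 2 ^ N * ((3 / 2) ^ 2) ^ N := by
          rw [← mul_pow, ← mul_pow]; norm_num
        rw [e9]
        field_simp
        ring

theorem lintegral_cyl_eq (hN : 3 ≤ N) {g : Eu N → ENNReal} (hg : Measurable g) :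
    ∫⁻ p, g (polar p) ∂(cylMeasure N) = ∫⁻ x, ENNReal.ofReal ((‖x‖ ^ N)⁻¹) * g x := by
  rw [lintegral_polar hN (by fun_prop)]
  refine lintegral_congr fun p => ?_
  rw [← mul_assoc, ← ENNReal.ofReal_mul (Real.exp_pos _).le, norm_polar, ← Real.exp_nat_mul,
    ← Real.exp_neg, ← Real.exp_add]
  simp

/-! ### The averaging functionals on the cylinder -/

/-- The kernel of the local average at the point `(0, σ)` of the cylinder. -/
def avgKernel (δ : ℝ) (σ : Eu N) (q : Cyl N) : ℝ :=
  (∫ h : Eu N, tent δ h)⁻¹ * (Real.exp (-(N * q.1)) * tent δ (polar q - σ))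

theorem continuous_avgKernel (δ : ℝ) (σ : Eu N) : Continuous (avgKernel δ σ) := by
  have h1 := continuous_tent (N := N) δ
  have h2 := continuous_polar (N := N)
  unfold avgKernel
  fun_prop

/-- Averaging at a scale proportional to `‖x‖` commutes with dilations, which are the translations
in `t`; hence a single kernel for each `σ` suffices. -/
theorem localAvg_polar (hN : 3 ≤ N) (δ : ℝ) {F : ℝ × Eu N → ℝ} (hF : IsCylTest N F) (p : Cyl N) :
    localAvg δ (emden 0 F) (polar p) =
      ∫ q, avgKernel δ (p.2 : Eu N) q * F (q.1 + p.1, (q.2 : Eu N)) ∂(cylMeasure N) := by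
  have htc := continuous_tent (N := N) δ
  have hvc := (hF.contDiff_emden 0).continuous
  have hnp : ‖polar p‖⁻¹ = Real.exp p.1 := by rw [norm_polar, Real.exp_neg, inv_inv]
  have h1 : ∫ h : Eu N, tent δ (‖polar p‖⁻¹ • h) =
      Real.exp (-(N * p.1)) * ∫ h : Eu N, tent δ h := by
    rw [Measure.integral_comp_smul volume (fun h => tent δ h), finrank_euclideanSpace,
      Fintype.card_fin, hnp, ← Real.exp_nat_mul, ← Real.exp_neg, abs_of_pos (Real.exp_pos _),
      smul_eq_mul]
  have h2 : ∫ h : Eu N, tent δ (‖polar p‖⁻¹ • h) * emden 0 F (polar p + h) =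
      ∫ y : Eu N, tent δ (‖polar p‖⁻¹ • (y - polar p)) * emden 0 F y := by
    rw [← integral_add_left_eq_self
      (fun y : Eu N => tent δ (‖polar p‖⁻¹ • (y - polar p)) * emden 0 F y) (polar p)]
    simp
  have h3 := (measurePreserving_shift N (-p.1)).integral_comp
    ((Homeomorph.subRight (-p.1)).prodCongr (Homeomorph.refl _)).measurableEmbedding
    fun q : Cyl N => Real.exp (-(N * q.1)) * (tent δ (‖polar p‖⁻¹ • (polar q - polar p)) *
      emden 0 F (polar q))
  have h4 := integral_polar hN
    (f := fun y : Eu N => tent δ (‖polar p‖⁻¹ • (y - polar p)) * emden 0 F y)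
    (Continuous.aestronglyMeasurable (by fun_prop))
  rw [localAvg, h1, h2, h4, ← h3, ← integral_const_mul]
  refine integral_congr_ae (.of_forall fun q => ?_)
  simp only [emden_polar, sub_neg_eq_add, zero_mul, Real.exp_zero, one_mul]
  have e1 : ‖polar p‖⁻¹ • (polar ((q.1 + p.1, q.2) : Cyl N) - polar p) = polar q - (p.2 : Eu N) := by
    rw [hnp, smul_sub, polar, polar, polar, smul_smul, smul_smul, ← Real.exp_add, ← Real.exp_add]
    simp
  rw [e1, avgKernel, mul_inv, ← Real.exp_neg, mul_add, neg_add, Real.exp_add]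
  have e2 : Real.exp (- -(N * p.1)) * Real.exp (-(N * p.1)) = 1 := by
    rw [← Real.exp_add]; simp
  linear_combination ((∫ h : Eu N, tent δ h)⁻¹ * Real.exp (-(N * q.1)) *
    tent δ (polar q - (p.2 : Eu N)) * F (q.1 + p.1, (q.2 : Eu N))) * e2

/-- If `|t| > 1` then `e^{-t}` is at most `1/2` or at least `2`, hence at distance at least `1/2`
from the unit sphere. -/
theorem tent_polar_eq_zero {δ : ℝ} (hδ : 0 < δ) (hδ' : δ ≤ 1 / 2) (σ : Metric.sphere (0 : Eu N) 1)
    {q : Cyl N} (hq : 1 < |q.1|) : tent δ (polar q - (σ : Eu N)) = 0 := by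
  refine tent_eq_zero hδ (hδ'.trans ?_)
  have h1 := abs_norm_sub_norm_le (polar q) (σ : Eu N)
  rw [norm_polar, norm_eq_of_mem_sphere] at h1
  refine le_trans ?_ h1
  have he := Real.add_one_le_exp (1 : ℝ)
  rcases lt_abs.1 hq with h | h
  · have h2 : Real.exp (-q.1) ≤ 1 / 2 := by
      rw [Real.exp_neg, one_div]
      refine inv_anti₀ (by norm_num) ?_
      linarith [Real.exp_le_exp.2 h.le]
    exact le_abs.2 (Or.inr (by linarith))
  · refine le_abs.2 (Or.inl ?_)
    linarith [Real.exp_le_exp.2 h.le]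

theorem abs_avgKernel_le {δ : ℝ} (hδ : 0 < δ) (hδ' : δ ≤ 1 / 2) (σ : Metric.sphere (0 : Eu N) 1)
    (q : Cyl N) : |avgKernel δ (σ : Eu N) q| ≤
      (Set.Icc (-1 : ℝ) 1 ×ˢ Set.univ : Set (Cyl N)).indicator
        (fun _ => |(∫ h : Eu N, tent δ h)⁻¹| * Real.exp N) q := by
  by_cases hq : 1 < |q.1|
  · rw [avgKernel, tent_polar_eq_zero hδ hδ' σ hq, mul_zero, mul_zero, abs_zero]
    exact Set.indicator_nonneg (fun _ _ => by positivity) q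
  · have hm : q ∈ (Set.Icc (-1 : ℝ) 1 ×ˢ Set.univ : Set (Cyl N)) :=
      ⟨abs_le.1 (not_lt.1 hq), Set.mem_univ _⟩
    rw [Set.indicator_of_mem hm, avgKernel, abs_mul, abs_mul,
      abs_of_nonneg (tent_nonneg _ _), Real.abs_exp]
    gcongr
    refine (mul_le_of_le_one_right (Real.exp_pos _).le (tent_le_one hδ _)).trans ?_
    rw [Real.exp_le_exp]
    have := (abs_le.1 (not_lt.1 hq)).1
    nlinarith [Nat.cast_nonneg (α := ℝ) N]

theorem abs_avgKernel_sub_le {δ : ℝ} (hδ : 0 < δ) (hδ' : δ ≤ 1 / 2)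
    (σ σ' : Metric.sphere (0 : Eu N) 1) (q : Cyl N) :
    |avgKernel δ (σ : Eu N) q - avgKernel δ (σ' : Eu N) q| ≤
      (Set.Icc (-1 : ℝ) 1 ×ˢ Set.univ : Set (Cyl N)).indicator
        (fun _ => |(∫ h : Eu N, tent δ h)⁻¹| * Real.exp N / δ * dist σ σ') q := by
  by_cases hq : 1 < |q.1|
  · rw [avgKernel, avgKernel, tent_polar_eq_zero hδ hδ' σ hq, tent_polar_eq_zero hδ hδ' σ' hq,
      sub_self, abs_zero]
    exact Set.indicator_nonneg (fun _ _ => by positivity) q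
  · have hm : q ∈ (Set.Icc (-1 : ℝ) 1 ×ˢ Set.univ : Set (Cyl N)) :=
      ⟨abs_le.1 (not_lt.1 hq), Set.mem_univ _⟩
    rw [Set.indicator_of_mem hm, avgKernel, avgKernel,
      ← mul_sub, ← mul_sub, abs_mul, abs_mul, Real.abs_exp, mul_div_assoc, mul_assoc,
      div_mul_eq_mul_div, mul_div_assoc]
    have h1 := abs_tent_sub_le hδ (polar q - (σ : Eu N)) (polar q - (σ' : Eu N))
    rw [sub_sub_sub_cancel_left, norm_sub_rev, ← dist_eq_norm, ← Subtype.dist_eq] at h1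
    have h2 : Real.exp (-(N * q.1)) ≤ Real.exp N := by
      rw [Real.exp_le_exp]
      have := (abs_le.1 (not_lt.1 hq)).1
      nlinarith [Nat.cast_nonneg (α := ℝ) N]
    gcongr

theorem memLp_avgKernel {δ : ℝ} (hδ : 0 < δ) (hδ' : δ ≤ 1 / 2) (σ : Metric.sphere (0 : Eu N) 1) :
    MemLp (avgKernel δ (σ : Eu N)) 2 (cylMeasure N) := by
  refine (continuous_avgKernel δ _).memLp_of_hasCompactSupport (hasCompactSupport_cyl (T := 1) ?_)
  intro p hp
  rw [avgKernel, tent_polar_eq_zero hδ hδ' σ hp, mul_zero, mul_zero]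

theorem norm_Lp_le_of_indicator {f : Lp ℝ 2 (cylMeasure N)} {g : Cyl N → ℝ} (hf : f =ᵐ[cylMeasure N] g)
    {C : ℝ} (hC : 0 ≤ C) (hg : ∀ q, |g q| ≤
      (Set.Icc (-1 : ℝ) 1 ×ˢ Set.univ : Set (Cyl N)).indicator (fun _ => C) q) :
    ‖f‖ ≤ C * Real.sqrt ((cylMeasure N).real (Set.Icc (-1 : ℝ) 1 ×ˢ Set.univ)) := by
  refine (abs_le_of_sq_le_sq' ?_ (by positivity)).2
  have hms : MeasurableSet (Set.Icc (-1 : ℝ) 1 ×ˢ Set.univ : Set (Cyl N)) :=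
    measurableSet_Icc.prod MeasurableSet.univ
  have hfin : cylMeasure N (Set.Icc (-1 : ℝ) 1 ×ˢ Set.univ) ≠ ⊤ :=
    ((isCompact_Icc.prod isCompact_univ).measure_lt_top).ne
  rw [mul_pow, Real.sq_sqrt measureReal_nonneg, sq_norm_Lp]
  calc _ ≤ ∫ q, (Set.Icc (-1 : ℝ) 1 ×ˢ Set.univ : Set (Cyl N)).indicator (fun _ => C ^ 2) q
        ∂(cylMeasure N) := by
        refine integral_mono_ae ((Lp.memLp f).integrable_norm_pow (by simp))
          ((integrable_indicator_iff hms).2 (integrableOn_const hfin)) ?_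
        filter_upwards [hf] with q hq
        have := hg q
        rw [hq, Real.norm_eq_abs]
        by_cases hm : q ∈ (Set.Icc (-1 : ℝ) 1 ×ˢ Set.univ : Set (Cyl N))
        · rw [Set.indicator_of_mem hm] at this ⊢
          exact pow_le_pow_left₀ (abs_nonneg _) this 2
        · rw [Set.indicator_of_notMem hm] at this ⊢
          rw [le_antisymm this (abs_nonneg _)]; simp
    _ = _ := by
        rw [integral_indicator_const _ hms, smul_eq_mul, mul_comm]

/-- The averaging functional at `(0, σ)`, for functions in `L²` of the cylinder. -/
def cylAvg (δ : ℝ) (σ : Metric.sphere (0 : Eu N) 1) (φ : H1Cyl N) : ℝ :=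
  ∫ q, avgKernel δ (σ : Eu N) q * h1Fn φ q ∂(cylMeasure N)

theorem cylAvg_eq_inner {δ : ℝ} (hδ : 0 < δ) (hδ' : δ ≤ 1 / 2) (σ : Metric.sphere (0 : Eu N) 1)
    (φ : H1Cyl N) : cylAvg δ σ φ = inner ℝ ((memLp_avgKernel hδ hδ' σ).toLp _) φ.1.fst := by
  rw [L2.inner_def, cylAvg]
  refine integral_congr_ae ?_
  filter_upwards [(memLp_avgKernel hδ hδ' σ).coeFn_toLp] with q hq
  rw [hq]
  simp [h1Fn, mul_comm]

/-- The uniform bound absorbs approximation errors, and the Lipschitz bound lets `σ` vary along the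
sequence when passing to the weak limit. -/
theorem exists_norm_avgKernel_le {δ : ℝ} (hδ : 0 < δ) (hδ' : δ ≤ 1 / 2) : ∃ C : ℝ, 0 ≤ C ∧
    (∀ σ : Metric.sphere (0 : Eu N) 1, ‖(memLp_avgKernel hδ hδ' σ).toLp _‖ ≤ C) ∧
    ∀ σ σ' : Metric.sphere (0 : Eu N) 1,
      ‖(memLp_avgKernel hδ hδ' σ).toLp _ - (memLp_avgKernel hδ hδ' σ').toLp _‖ ≤ C * dist σ σ' := by
  set D := |(∫ h : Eu N, tent δ h)⁻¹| * Real.exp N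
  set V := Real.sqrt ((cylMeasure N).real (Set.Icc (-1 : ℝ) 1 ×ˢ Set.univ))
  have hD : 0 ≤ D := by positivity
  have hV : 0 ≤ V := Real.sqrt_nonneg _
  refine ⟨max (D * V) (D / δ * V), by positivity, fun σ => ?_, fun σ σ' => ?_⟩
  · exact (norm_Lp_le_of_indicator (memLp_avgKernel hδ hδ' σ).coeFn_toLp hD
      (abs_avgKernel_le hδ hδ' σ)).trans (le_max_left _ _)
  · rw [← MemLp.toLp_sub]
    refine (norm_Lp_le_of_indicator (MemLp.coeFn_toLp _) (by positivity)
      (abs_avgKernel_sub_le hδ hδ' σ σ')).trans ?_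
    rw [mul_right_comm]
    gcongr
    exact le_max_right _ _

theorem h1Fn_tau (s : ℝ) (φ : H1Cyl N) :
    h1Fn (tau s φ) =ᵐ[cylMeasure N] fun p => h1Fn φ (p.1 - s, p.2) := pairTranslate_fst s φ.1

theorem norm_tau (s : ℝ) (φ : H1Cyl N) : ‖tau s φ‖ = ‖φ‖ := (pairTranslate N s).norm_map φ.1

theorem tau_sub (s : ℝ) (φ ψ : H1Cyl N) : tau s (φ - ψ) = tau s φ - tau s ψ :=
  Subtype.ext (map_sub (pairTranslate N s) φ.1 ψ.1)

theorem norm_fst_le (φ : H1Cyl N) : ‖φ.1.fst‖ ≤ ‖φ‖ := by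
  have := norm_sq_eq φ
  exact (abs_le_of_sq_le_sq' (by rw [this]; exact le_add_of_nonneg_right (gradSq_nonneg φ))
    (norm_nonneg φ)).2

theorem IsTestRep.localAvg_eq (hN : 3 ≤ N) {F : ℝ × Eu N → ℝ} {w : H1Cyl N} (h : IsTestRep F w)
    (δ : ℝ) (p : Cyl N) : localAvg δ (emden 0 F) (polar p) = cylAvg δ p.2 (tau (-p.1) w) := by
  rw [localAvg_polar hN δ h.1, cylAvg]
  refine integral_congr_ae ?_
  filter_upwards [h1Fn_tau (-p.1) w,
    (measurePreserving_shift N (-p.1)).quasiMeasurePreserving.ae h.2.1] with q h1 h2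
  rw [h1, h2, sub_neg_eq_add]

theorem cylAvg_sub {δ : ℝ} (hδ : 0 < δ) (hδ' : δ ≤ 1 / 2) (σ : Metric.sphere (0 : Eu N) 1)
    (φ ψ : H1Cyl N) : cylAvg δ σ (φ - ψ) = cylAvg δ σ φ - cylAvg δ σ ψ := by
  simp only [cylAvg_eq_inner hδ hδ', ← inner_sub_right]
  rfl

/-! ### A smooth truncation -/

/-- A smooth function that is small near the origin and stays at bounded distance from the
identity. -/
def softTrunc (s : ℝ) : ℝ := s - Real.arctan s

theorem hasDerivAt_softTrunc (s : ℝ) : HasDerivAt softTrunc (1 - 1 / (1 + s ^ 2)) s :=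
  (hasDerivAt_id s).sub (Real.hasDerivAt_arctan s)

theorem deriv_softTrunc_nonneg (s : ℝ) : 0 ≤ 1 - 1 / (1 + s ^ 2) := by
  rw [sub_nonneg, div_le_one (by positivity)]; nlinarith [sq_nonneg s]

theorem deriv_softTrunc_le_one (s : ℝ) : 1 - 1 / (1 + s ^ 2) ≤ 1 := by
  have : 0 ≤ 1 / (1 + s ^ 2) := by positivity
  linarith

theorem deriv_softTrunc_le_sq (s : ℝ) : 1 - 1 / (1 + s ^ 2) ≤ s ^ 2 := by
  rw [sub_le_iff_le_add, ← sub_le_iff_le_add', le_div_iff₀ (by positivity)]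
  nlinarith [sq_nonneg (s ^ 2)]

theorem contDiff_softTrunc : ContDiff ℝ (⊤ : ℕ∞) softTrunc := contDiff_id.sub Real.contDiff_arctan

theorem softTrunc_zero : softTrunc 0 = 0 := by simp [softTrunc]

theorem abs_le_of_deriv_le {f f' : ℝ → ℝ} (hf : ∀ s, HasDerivAt f (f' s) s) (h0 : f 0 = 0) {s C : ℝ}
    (hC : ∀ x, |x| ≤ |s| → |f' x| ≤ C) : |f s| ≤ C * |s| := by
  have := (convex_Icc (-|s|) |s|).norm_image_sub_le_of_norm_hasDerivWithin_le
    (f := f) (f' := f') (C := C) (x := 0) (y := s) (fun x _ => (hf x).hasDerivWithinAt)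
    (fun x hx => hC x (abs_le.2 ⟨hx.1, hx.2⟩))
    (Set.mem_Icc.2 ⟨neg_nonpos.2 (abs_nonneg s), abs_nonneg s⟩) (Set.mem_Icc.2 (abs_le.1 le_rfl))
  simpa [h0] using this

theorem abs_softTrunc_le (s : ℝ) : |softTrunc s| ≤ |s| := by
  have := abs_le_of_deriv_le (C := 1) hasDerivAt_softTrunc softTrunc_zero (s := s) fun x _ => by
    rw [abs_of_nonneg (deriv_softTrunc_nonneg x)]; exact deriv_softTrunc_le_one x
  linarith

theorem abs_softTrunc_le_cube (s : ℝ) : |softTrunc s| ≤ s ^ 2 * |s| := by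
  refine abs_le_of_deriv_le hasDerivAt_softTrunc softTrunc_zero fun x hx => ?_
  rw [abs_of_nonneg (deriv_softTrunc_nonneg x)]
  exact (deriv_softTrunc_le_sq x).trans (sq_le_sq.2 hx)

theorem abs_arctan_le (s : ℝ) : |Real.arctan s| ≤ |s| := by
  have := abs_le_of_deriv_le (C := 1) Real.hasDerivAt_arctan Real.arctan_zero (s := s) fun x _ => by
    rw [abs_of_nonneg (by positivity), div_le_one (by positivity)]; nlinarith [sq_nonneg x]
  linarith

theorem abs_arctan_le_two (s : ℝ) : |Real.arctan s| ≤ 2 := by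
  rw [abs_le]
  constructor <;> linarith [Real.arctan_lt_pi_div_two s, Real.neg_pi_div_two_lt_arctan s,
    Real.pi_lt_four]

theorem IsCylTest.comp {F : ℝ × Eu N → ℝ} (hF : IsCylTest N F) {g : ℝ → ℝ}
    (hg : ContDiff ℝ (⊤ : ℕ∞) g) (h0 : g 0 = 0) : IsCylTest N fun z => g (F z) :=
  ⟨hg.comp hF.1, hF.2.comp_left (g := g) h0⟩

theorem cylGrad_comp {F : ℝ × Eu N → ℝ} (hF : IsCylTest N F) {g g' : ℝ → ℝ}
    (hg : ∀ s, HasDerivAt g (g' s) s) (p : Cyl N) :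
    cylGrad N (fun z => g (F z)) p = g' (F (p.1, (p.2 : Eu N))) • cylGrad N F p := by
  have dF := hF.differentiable
  have h1 : timeDeriv (fun z => g (F z)) p = g' (F (p.1, (p.2 : Eu N))) • timeDeriv F p := by
    have : DifferentiableAt ℝ (fun t => F (t, (p.2 : Eu N))) p.1 := by fun_prop
    exact ((hg _).comp p.1 this.hasDerivAt).deriv
  have h2 : gradient (fun x => g (F (p.1, x))) (p.2 : Eu N) =
      g' (F (p.1, (p.2 : Eu N))) • gradient (fun x => F (p.1, x)) (p.2 : Eu N) := by
    have : DifferentiableAt ℝ (fun x => F (p.1, x)) (p.2 : Eu N) := by fun_prop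
    have h := ((hg (F (p.1, (p.2 : Eu N)))).comp_hasFDerivAt (p.2 : Eu N) this.hasFDerivAt).fderiv
    simp only [gradient]
    rw [show fderiv ℝ (fun x => g (F (p.1, x))) (p.2 : Eu N) = _ from h, map_smulₛₗ]
    simp
  have h3 : sphGrad (fun z => g (F z)) p = g' (F (p.1, (p.2 : Eu N))) • sphGrad F p := by
    simp only [sphGrad]
    rw [h2, inner_smul_right, smul_sub, mul_smul]
  rw [cylGrad_eq, cylGrad_eq, h1, h3]
  rfl

/-- The derivative of `softTrunc` lies in `[0, 1]`. -/
theorem integral_cylGrad_softTrunc_le {F : ℝ × Eu N → ℝ} (hF : IsCylTest N F) :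
    ∫ p, ‖cylGrad N (fun z => softTrunc (F z)) p‖ ^ 2 ∂(cylMeasure N) ≤
      ∫ p, ‖cylGrad N F p‖ ^ 2 ∂(cylMeasure N) := by
  refine integral_mono (((hF.comp contDiff_softTrunc softTrunc_zero).memLp_cylGrad 2).integrable_norm_pow
    (by simp)) ((hF.memLp_cylGrad 2).integrable_norm_pow (by simp)) fun p => ?_
  simp only
  rw [cylGrad_comp hF hasDerivAt_softTrunc, norm_smul,
    Real.norm_of_nonneg (deriv_softTrunc_nonneg _)]
  exact pow_le_pow_left₀ (mul_nonneg (deriv_softTrunc_nonneg _) (norm_nonneg _))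
    (mul_le_of_le_one_left (norm_nonneg _) (deriv_softTrunc_le_one _)) 2

/-! ### Functions with small local averages -/

theorem measurable_localAvg (δ : ℝ) {v : Eu N → ℝ} (hv : Continuous v) :
    Measurable (localAvg δ v) := by
  have ht := (continuous_tent (N := N) δ).measurable
  have hm : Measurable fun q : Eu N × Eu N => tent δ (‖q.1‖⁻¹ • q.2) := ht.comp (by fun_prop)
  have hv' := hv.measurable
  exact (hm.stronglyMeasurable.integral_prod_right').measurable.inv.mul
    ((hm.mul (hv'.comp (by fun_prop : Measurable fun q : Eu N × Eu N =>
      q.1 + q.2))).stronglyMeasurable.integral_prod_right').measurable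

theorem lintegral_sub_localAvg_cyl_le (hN : 3 ≤ N) {δ : ℝ} (hδ : 0 < δ) (hδ' : δ ≤ 1 / 2)
    {F : ℝ × Eu N → ℝ} (hF : IsCylTest N F) :
    ∫⁻ p, ‖F (p.1, (p.2 : Eu N)) - localAvg δ (emden 0 F) (polar p)‖ₑ ^ 2 ∂(cylMeasure N) ≤
      ENNReal.ofReal (8 * 9 ^ N * δ ^ 2) *
        ∫⁻ p, ENNReal.ofReal (‖cylGrad N F p‖ ^ 2) ∂(cylMeasure N) := by
  have hv := hF.contDiff_emden 0
  have h := lintegral_sub_localAvg_le hN hδ hδ' hv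
  have hm := measurable_localAvg δ hv.continuous
  have hvm := hv.continuous.measurable
  have hgm := (continuous_gradient hv).measurable
  have e1 := lintegral_cyl_eq hN (g := fun x => ‖emden 0 F x - localAvg δ (emden 0 F) x‖ₑ ^ 2)
    (by fun_prop)
  have e2 := lintegral_cyl_eq hN (g := fun x => ENNReal.ofReal (‖x‖ ^ 2 * ‖gradient (emden 0 F) x‖ ^ 2))
    (by fun_prop)
  rw [← e1] at h
  simp_rw [ENNReal.ofReal_mul (inv_nonneg.2 (pow_nonneg (norm_nonneg _) N))] at h
  rw [← e2] at h
  convert h using 4 with p p p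
  · simp [emden_polar]
  · rw [norm_gradient_emden_polar_sq hF.1, norm_polar, ← Real.exp_nat_mul, ← mul_assoc,
      ← Real.exp_add, norm_cylGrad_sq]
    simp

/-- Where `|F| ≥ 2δ` and the average is at most `δ`, the oscillation is at least `|F|/2`; the
Poincaré inequality then costs a factor `4`. -/
theorem integral_large_le (hN : 3 ≤ N) {δ : ℝ} (hδ : 0 < δ) (hδ' : δ ≤ 1 / 2)
    {F : ℝ × Eu N → ℝ} (hF : IsCylTest N F)
    (hsmall : ∀ p : Cyl N, |localAvg δ (emden 0 F) (polar p)| ≤ δ) :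
    ∫ p, {p : Cyl N | 2 * δ ≤ |F (p.1, (p.2 : Eu N))|}.indicator
        (fun p => F (p.1, (p.2 : Eu N)) ^ 2) p ∂(cylMeasure N) ≤
      32 * 9 ^ N * δ ^ 2 * ∫ p, ‖cylGrad N F p‖ ^ 2 ∂(cylMeasure N) := by
  have hFc := hF.continuous_restrict
  have hms : MeasurableSet {p : Cyl N | 2 * δ ≤ |F (p.1, (p.2 : Eu N))|} :=
    (isClosed_le continuous_const hFc.abs).measurableSet
  have hint := ((hF.memLp 2).integrable_sq).indicator hms
  have hint2 : Integrable (fun p => ‖cylGrad N F p‖ ^ 2) (cylMeasure N) :=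
    (hF.memLp_cylGrad 2).integrable_norm_pow (by simp)
  rw [← ENNReal.ofReal_le_ofReal_iff (mul_nonneg (by positivity)
    (integral_nonneg fun p => by positivity)), ENNReal.ofReal_mul (by positivity),
    ofReal_integral_eq_lintegral_ofReal hint (.of_forall fun p => Set.indicator_nonneg
      (fun _ _ => sq_nonneg _) p),
    ofReal_integral_eq_lintegral_ofReal hint2 (.of_forall fun p => by simp)]
  have e : ENNReal.ofReal (32 * 9 ^ N * δ ^ 2) = 4 * ENNReal.ofReal (8 * 9 ^ N * δ ^ 2) := by
    rw [← ENNReal.ofReal_ofNat 4, ← ENNReal.ofReal_mul (by norm_num)]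
    congr 1; ring
  rw [e, mul_assoc]
  refine le_trans ?_ (mul_le_mul_right (lintegral_sub_localAvg_cyl_le hN hδ hδ' hF) 4)
  rw [← lintegral_const_mul' _ _ (by simp)]
  refine lintegral_mono fun p => ?_
  by_cases hp : p ∈ {p : Cyl N | 2 * δ ≤ |F (p.1, (p.2 : Eu N))|}
  · simp only [Set.indicator_of_mem hp]
    rw [← ofReal_norm, ← ENNReal.ofReal_pow (norm_nonneg _), ← ENNReal.ofReal_ofNat 4,
      ← ENNReal.ofReal_mul (by norm_num)]
    refine ENNReal.ofReal_le_ofReal ?_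
    have h1 : 2 * δ ≤ |F (p.1, (p.2 : Eu N))| := hp
    have h2 := hsmall p
    have h3 := abs_sub_abs_le_abs_sub (F (p.1, (p.2 : Eu N))) (localAvg δ (emden 0 F) (polar p))
    rw [Real.norm_eq_abs, ← sq_abs (F (p.1, (p.2 : Eu N)))]
    nlinarith [abs_nonneg (F (p.1, (p.2 : Eu N)))]
  · simp [Set.indicator_of_notMem hp]

/-- The cubic bound on `softTrunc` is used where `|F| ≤ 2δ`, the linear one elsewhere. -/
theorem integral_softTrunc_sq_le {δ : ℝ} (hδ : 0 < δ) {F : ℝ × Eu N → ℝ} (hF : IsCylTest N F) :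
    ∫ p : Cyl N, softTrunc (F (p.1, (p.2 : Eu N))) ^ 2 ∂(cylMeasure N) ≤
      (2 * δ) ^ 4 * ∫ p : Cyl N, F (p.1, (p.2 : Eu N)) ^ 2 ∂(cylMeasure N) +
      ∫ p, {p : Cyl N | 2 * δ ≤ |F (p.1, (p.2 : Eu N))|}.indicator
        (fun p => F (p.1, (p.2 : Eu N)) ^ 2) p ∂(cylMeasure N) := by
  have hFc := hF.continuous_restrict
  have hms : MeasurableSet {p : Cyl N | 2 * δ ≤ |F (p.1, (p.2 : Eu N))|} :=
    (isClosed_le continuous_const hFc.abs).measurableSet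
  have h2 := (hF.memLp 2).integrable_sq
  rw [← integral_const_mul, ← integral_add (h2.const_mul _) (h2.indicator hms)]
  refine integral_mono ((hF.comp contDiff_softTrunc softTrunc_zero).memLp 2).integrable_sq
    ((h2.const_mul _).add (h2.indicator hms)) fun p => ?_
  simp only
  by_cases hp : p ∈ {p : Cyl N | 2 * δ ≤ |F (p.1, (p.2 : Eu N))|}
  · rw [Set.indicator_of_mem hp]
    have := sq_le_sq.2 (abs_softTrunc_le (F (p.1, (p.2 : Eu N))))
    have : 0 ≤ (2 * δ) ^ 4 * F (p.1, (p.2 : Eu N)) ^ 2 := by positivity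
    linarith
  · rw [Set.indicator_of_notMem hp, add_zero]
    have hp' : |F (p.1, (p.2 : Eu N))| ≤ 2 * δ := (not_le.1 hp).le
    have h3 : |softTrunc (F (p.1, (p.2 : Eu N)))| ≤ (2 * δ) ^ 2 * |F (p.1, (p.2 : Eu N))| := by
      refine (abs_softTrunc_le_cube _).trans ?_
      exact mul_le_mul_of_nonneg_right (sq_le_sq' (abs_le.1 hp').1 (abs_le.1 hp').2) (abs_nonneg _)
    calc _ = |softTrunc (F (p.1, (p.2 : Eu N)))| ^ 2 := (sq_abs _).symm
      _ ≤ _ := pow_le_pow_left₀ (abs_nonneg _) h3 2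
      _ = _ := by rw [mul_pow, sq_abs]; ring

/-- Since `q > 2`, two powers of `arctan F` are spent on `F²`; the others are at most `2δ` where
`|F| ≤ 2δ` and at most `2` elsewhere. -/
theorem integral_arctan_rpow_le {δ q : ℝ} (hδ : 0 < δ) (hq : 2 < q) {F : ℝ × Eu N → ℝ}
    (hF : IsCylTest N F) :
    ∫ p : Cyl N, ‖Real.arctan (F (p.1, (p.2 : Eu N)))‖ ^ q ∂(cylMeasure N) ≤
      (2 * δ) ^ (q - 2) * ∫ p : Cyl N, F (p.1, (p.2 : Eu N)) ^ 2 ∂(cylMeasure N) +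
      2 ^ (q - 2) * ∫ p, {p : Cyl N | 2 * δ ≤ |F (p.1, (p.2 : Eu N))|}.indicator
        (fun p => F (p.1, (p.2 : Eu N)) ^ 2) p ∂(cylMeasure N) := by
  have hFc := hF.continuous_restrict
  have hms : MeasurableSet {p : Cyl N | 2 * δ ≤ |F (p.1, (p.2 : Eu N))|} :=
    (isClosed_le continuous_const hFc.abs).measurableSet
  have h2 := (hF.memLp 2).integrable_sq
  rw [← integral_const_mul, ← integral_const_mul,
    ← integral_add (h2.const_mul _) ((h2.indicator hms).const_mul _)]
  have hint : Integrable (fun p : Cyl N => ‖Real.arctan (F (p.1, (p.2 : Eu N)))‖ ^ q)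
      (cylMeasure N) := by
    refine Continuous.integrable_of_hasCompactSupport ?_ ?_
    · exact ((Real.continuous_arctan.comp hFc).norm).rpow_const fun _ => Or.inr (by linarith)
    · refine hF.2.comp_left (g := fun s => ‖Real.arctan s‖ ^ q) ?_
      simp [Real.zero_rpow (by linarith : q ≠ 0)]
  refine integral_mono hint ((h2.const_mul _).add ((h2.indicator hms).const_mul _)) fun p => ?_
  simp only [Real.norm_eq_abs]
  have hsplit : |Real.arctan (F (p.1, (p.2 : Eu N)))| ^ q ≤
      |Real.arctan (F (p.1, (p.2 : Eu N)))| ^ (q - 2) * F (p.1, (p.2 : Eu N)) ^ 2 := by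
    rw [← sub_add_cancel q 2, Real.rpow_add_of_nonneg (abs_nonneg _) (by linarith) (by norm_num),
      sub_add_cancel, Real.rpow_two, sq_abs]
    exact mul_le_mul_of_nonneg_left (sq_le_sq.2 (abs_arctan_le _)) (by positivity)
  refine hsplit.trans ?_
  have hF2 := sq_nonneg (F (p.1, (p.2 : Eu N)))
  by_cases hp : p ∈ {p : Cyl N | 2 * δ ≤ |F (p.1, (p.2 : Eu N))|}
  · rw [Set.indicator_of_mem hp]
    refine le_add_of_nonneg_of_le (by positivity) ?_
    gcongr
    exact abs_arctan_le_two _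
  · rw [Set.indicator_of_notMem hp, mul_zero, add_zero]
    have hp' : |F (p.1, (p.2 : Eu N))| ≤ 2 * δ := (not_le.1 hp).le
    gcongr
    exact (abs_arctan_le _).trans hp'

/-! ### Lower bounds for the local averages -/

/-- Both left-hand sides are continuous in `δ` and vanish at `δ = 0`, because `q > 2`. -/
theorem exists_scale (M a θ q : ℝ) (hθ : 0 < θ) (hq : 2 < q) (n : ℕ) : ∃ δ : ℝ, 0 < δ ∧ δ ≤ 1 / 2 ∧
    a ^ 2 * ((2 * δ) ^ 4 * M + 32 * 9 ^ n * δ ^ 2 * M) ≤ θ ∧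
    (2 * δ) ^ (q - 2) * M + 2 ^ (q - 2) * (32 * 9 ^ n * δ ^ 2 * M) ≤ θ ^ q := by
  have c1 : Tendsto (fun δ : ℝ => a ^ 2 * ((2 * δ) ^ 4 * M + 32 * 9 ^ n * δ ^ 2 * M)) (𝓝 0) (𝓝 0) := by
    have : Continuous fun δ : ℝ => a ^ 2 * ((2 * δ) ^ 4 * M + 32 * 9 ^ n * δ ^ 2 * M) := by fun_prop
    simpa using this.tendsto 0
  have c2 : Tendsto (fun δ : ℝ => (2 * δ) ^ (q - 2) * M + 2 ^ (q - 2) * (32 * 9 ^ n * δ ^ 2 * M))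
      (𝓝 0) (𝓝 0) := by
    have h1 : Continuous fun δ : ℝ => (2 * δ) ^ (q - 2) :=
      (continuous_const.mul continuous_id).rpow_const fun _ => Or.inr (by linarith)
    have : Continuous fun δ : ℝ =>
      (2 * δ) ^ (q - 2) * M + 2 ^ (q - 2) * (32 * 9 ^ n * δ ^ 2 * M) := by fun_prop
    simpa [Real.zero_rpow (by linarith : q - 2 ≠ 0)] using this.tendsto 0
  have e := ((c1.eventually_le_const hθ).and (c2.eventually_le_const (Real.rpow_pos_of_pos hθ q))).filter_mono
    (nhdsWithin_le_nhds (s := Set.Ioi 0))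
  have e2 : ∀ᶠ δ : ℝ in 𝓝[>] 0, 0 < δ ∧ δ ≤ 1 / 2 := by
    filter_upwards [Ioc_mem_nhdsGT (by norm_num : (0 : ℝ) < 1 / 2)] with δ h using h
  obtain ⟨δ, ⟨h1, h2⟩, h3, h4⟩ := (e.and e2).exists
  exact ⟨δ, h3, h4, h1, h2⟩

/-- `L` is the `L^{2⋆}` norm of `softTrunc ∘ F`. The remainder `arctan ∘ F` costs `θ` in that norm,
and the zero-order term of the Sobolev inequality costs `θ` in the energy. -/
theorem exists_scale_lpNorm_le (hN : 3 ≤ N) (M : ℝ) {θ : ℝ} (hθ : 0 < θ) : ∃ δ : ℝ, 0 < δ ∧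
    δ ≤ 1 / 2 ∧ ∀ (F : ℝ × Eu N → ℝ) (w : H1Cyl N), IsTestRep F w → massSq w ≤ M → gradSq w ≤ M →
      (∀ p : Cyl N, |localAvg δ (emden 0 F) (polar p)| ≤ δ) →
      ∃ L : ℝ, 0 ≤ L ∧ lpNorm (h1Fn w) (critExp N) (cylMeasure N) ≤ L + θ ∧
        sobolevConst N * L ^ 2 ≤ gradSq w + θ := by
  obtain ⟨δ, h1, h2, h3, h4⟩ := exists_scale M (((N : ℝ) - 2) / 2) θ (2 * N / (N - 2)) hθ
    (two_lt_critExp hN) N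
  refine ⟨δ, h1, h2, fun F w h hM hG hsmall => ?_⟩
  have hq := two_lt_critExp hN
  have hlarge := integral_large_le hN h1 h2 h.1 hsmall
  rw [← h.gradSq_eq] at hlarge
  have hlarge' := hlarge.trans (mul_le_mul_of_nonneg_left hG (by positivity))
  have hT := integral_softTrunc_sq_le h1 h.1
  have hA := integral_arctan_rpow_le h1 hq h.1
  rw [← h.massSq_eq] at hT hA
  have hφ : IsCylTest N fun z => softTrunc (F z) := h.1.comp contDiff_softTrunc softTrunc_zero
  have hψ : IsCylTest N fun z => Real.arctan (F z) := h.1.comp Real.contDiff_arctan Real.arctan_zero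
  refine ⟨_, lpNorm_nonneg (f := fun p : Cyl N => softTrunc (F (p.1, (p.2 : Eu N)))) (p := critExp N)
    (μ := cylMeasure N), ?_, ?_⟩
  · rw [h.lpNorm_eq]
    have e : (fun p : Cyl N => F (p.1, (p.2 : Eu N))) =
        (fun p : Cyl N => softTrunc (F (p.1, (p.2 : Eu N)))) +
          fun p : Cyl N => Real.arctan (F (p.1, (p.2 : Eu N))) := by
      ext p; simp [softTrunc]
    rw [e]
    refine (lpNorm_add_le (hφ.memLp _) (one_le_critExp hN)).trans (add_le_add le_rfl ?_)
    rw [lpNorm_eq_integral_norm_rpow_toReal (critExp_ne_zero hN) critExp_ne_top (hψ.memLp 2).1,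
      critExp_toReal hN, Real.rpow_inv_le_iff_of_pos
        (integral_nonneg fun _ => Real.rpow_nonneg (norm_nonneg _) _) hθ.le (critExp_pos hN)]
    refine hA.trans (le_trans ?_ h4)
    gcongr
  · refine (sobolevConst_mul_le_cyl hN hφ).trans (add_le_add ?_ ?_)
    · rw [h.gradSq_eq]; exact integral_cylGrad_softTrunc_le h.1
    · refine le_trans ?_ h3
      refine mul_le_mul_of_nonneg_left ?_ (sq_nonneg _)
      refine hT.trans ?_
      gcongr

theorem exists_cylAvg_lower_bound (hN : 3 ≤ N) {e B : ℝ} (he : 0 < e) (hB : B < sobolevConst N) :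
    ∃ (δ : ℝ) (_ : 0 < δ) (_ : δ ≤ 1 / 2), ∀ φ : H1Cyl N,
      lpNorm (h1Fn φ) (critExp N) (cylMeasure N) = 1 → gradSq φ + e * massSq φ ≤ B →
        ∃ (s : ℝ) (σ : Metric.sphere (0 : Eu N) 1), δ / 2 ≤ |cylAvg δ σ (tau s φ)| := by
  have hS := sobolevConst_pos hN
  -- The gap `B < S` leaves room for two errors `θ`, one from approximation by a test function and
  -- one from truncation, in both the norm and the energy.
  obtain ⟨θ, hθ, hθ1, hθ2⟩ : ∃ θ : ℝ, 0 < θ ∧ θ < 1 / 2 ∧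
      B + 2 * θ < sobolevConst N * (1 - 2 * θ) ^ 2 := by
    have c : Continuous fun θ : ℝ => sobolevConst N * (1 - 2 * θ) ^ 2 - (B + 2 * θ) := by fun_prop
    have h0 := (c.tendsto 0).eventually_const_lt (u := 0) (by simpa using hB)
    have h1 := (h0.filter_mono (nhdsWithin_le_nhds (s := Set.Ioi 0))).and
      (Ioo_mem_nhdsGT (by norm_num : (0 : ℝ) < 1 / 2))
    obtain ⟨θ, h2, h3, h4⟩ := h1.exists
    exact ⟨θ, h3, h4, by linarith⟩
  -- This bounds the mass and the gradient of any function of energy below `B + θ`, so `δ` is chosen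
  -- before `φ`.
  obtain ⟨δ, hδ, hδ', hkey⟩ := exists_scale_lpNorm_le hN (max ((|B| + 1) / e) (|B| + 1)) hθ
  refine ⟨δ, hδ, hδ', fun φ hφ1 hφ2 => ?_⟩
  by_contra! hcon
  obtain ⟨C, hC, hC1, -⟩ := exists_norm_avgKernel_le (N := N) hδ hδ'
  obtain ⟨F, w, hw, hlim⟩ := exists_test_seq φ
  have ev1 : ∀ᶠ k in atTop, 1 - θ < lpNorm (h1Fn (w k)) (critExp N) (cylMeasure N) :=
    (((continuous_lpNorm_h1Fn hN).tendsto φ).comp hlim).eventually_const_lt (by rw [hφ1]; linarith)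
  have ev2 : ∀ᶠ k in atTop, gradSq (w k) + e * massSq (w k) < B + θ :=
    ((((continuous_gradSq (N := N)).tendsto φ).add
      (((continuous_massSq (N := N)).tendsto φ).const_mul e)).comp hlim).eventually_lt_const
      (by linarith)
  -- The averages of `φ` stay below `δ/2`, those of the error below another `δ/2`; together they
  -- give the threshold `δ` for the test function.
  have ev3 : ∀ᶠ k in atTop, C * ‖w k - φ‖ < δ / 2 := by
    have : Tendsto (fun k => C * ‖w k - φ‖) atTop (𝓝 0) := by
      simpa using (tendsto_iff_norm_sub_tendsto_zero.1 hlim).const_mul C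
    exact this.eventually_lt_const (by linarith)
  obtain ⟨k, h1, h2, h3⟩ := (ev1.and (ev2.and ev3)).exists
  have hB1 := le_abs_self B
  have hm := massSq_nonneg (w k)
  have hg := gradSq_nonneg (w k)
  have hem := mul_nonneg he.le hm
  obtain ⟨L, hL, hL1, hL2⟩ := hkey (F k) (w k) (hw k)
    (le_max_of_le_left (by rw [le_div_iff₀ he]; linarith)) (le_max_of_le_right (by linarith)) (by
      intro p
      rw [(hw k).localAvg_eq hN]
      have e1 : cylAvg δ p.2 (tau (-p.1) (w k)) =
          cylAvg δ p.2 (tau (-p.1) φ) + cylAvg δ p.2 (tau (-p.1) (w k - φ)) := by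
        rw [tau_sub, cylAvg_sub hδ hδ']; ring
      have e2 : |cylAvg δ p.2 (tau (-p.1) (w k - φ))| ≤ C * ‖w k - φ‖ := by
        rw [cylAvg_eq_inner hδ hδ']
        refine (abs_real_inner_le_norm _ _).trans ?_
        refine mul_le_mul (hC1 _) ((norm_fst_le _).trans (norm_tau _ _).le) (norm_nonneg _) hC
      rw [e1]
      have := hcon (-p.1) p.2
      linarith [abs_add_le (cylAvg δ p.2 (tau (-p.1) φ)) (cylAvg δ p.2 (tau (-p.1) (w k - φ)))])
  have h5 : 1 - 2 * θ ≤ L := by linarith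
  have h6 : (1 - 2 * θ) ^ 2 ≤ L ^ 2 := pow_le_pow_left₀ (by linarith) h5 2
  have h7 := mul_le_mul_of_nonneg_left h6 hS.le
  linarith

/-! ### Weak compactness -/

/-- Sequential Banach-Alaoglu in the dual of a separable space, transported by the Riesz isometry.
-/
theorem exists_weaklyConverges {ψ : ℕ → H1Cyl N} {R : ℝ} (hψ : ∀ n, ‖ψ n‖ ≤ R) :
    ∃ (k : ℕ → ℕ) (φ₀ : H1Cyl N), StrictMono k ∧
      ∀ x : H1Cyl N, Tendsto (fun j => inner ℝ (ψ (k j)) x) atTop (𝓝 (inner ℝ φ₀ x)) := by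
  have : CompleteSpace (H1Cyl N) := (Submodule.isClosed_topologicalClosure _).completeSpace_coe
  have : Fact ((2 : ENNReal) ≠ ⊤) := ⟨by simp⟩
  have : SecondCountableTopology (CylPair N) := inferInstance
  have : SecondCountableTopology (H1Cyl N) := TopologicalSpace.Subtype.secondCountableTopology _
  let Ψ : ℕ → WeakDual ℝ (H1Cyl N) := fun n =>
    StrongDual.toWeakDual (InnerProductSpace.toDual ℝ (H1Cyl N) (ψ n))
  obtain ⟨f, -, k, hk, hlim⟩ := WeakDual.isSeqCompact_closedBall ℝ (H1Cyl N) 0 R (x := Ψ) (by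
    intro n
    have h := ((InnerProductSpace.toDual ℝ (H1Cyl N)).norm_map (ψ n)).trans_le (hψ n)
    exact (dist_zero_right (InnerProductSpace.toDual ℝ (H1Cyl N) (ψ n))).trans_le h)
  refine ⟨k, (InnerProductSpace.toDual ℝ (H1Cyl N)).symm (WeakDual.toStrongDual f), hk, fun x => ?_⟩
  rw [InnerProductSpace.toDual_symm_apply]
  have := ((WeakBilin.eval_continuous (topDualPairing ℝ (H1Cyl N)) x).tendsto f).comp hlim
  exact this

theorem weaklyConverges_of_inner {ψ : ℕ → H1Cyl N} {φ : H1Cyl N}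
    (h : ∀ x : H1Cyl N, Tendsto (fun j => inner ℝ (ψ j) x) atTop (𝓝 (inner ℝ φ x))) :
    WeaklyConverges ψ φ := by
  have : CompleteSpace (H1Cyl N) := (Submodule.isClosed_topologicalClosure _).completeSpace_coe
  refine (WeakBilin.tendsto_iff_forall_eval_tendsto (B := (topDualPairing ℝ (H1Cyl N)).flip)
    (fun f g hfg => (SeparatingDual.eq_iff_forall_dual_eq (R := ℝ)).2 fun l => LinearMap.congr_fun hfg l)).2
    fun l => ?_
  have h' := h ((InnerProductSpace.toDual ℝ (H1Cyl N)).symm l)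
  simp only [real_inner_comm ((InnerProductSpace.toDual ℝ (H1Cyl N)).symm l),
    InnerProductSpace.toDual_symm_apply] at h'
  exact h'

/-! ### The bubbles on the cylinder -/

theorem eps_pos {γ : ℝ} (hγ : γ < ((N : ℝ) - 2) ^ 2 / 4) : 0 < eps N γ :=
  Real.sqrt_pos.2 (by linarith)

/-- The exponents of the profile are `1 ± κ` with `κ = 2ε/(N-2)`; factoring out `e^{-t}` cancels the
exponential prefactor and leaves a negative power of `2 cosh(κt)`. -/
theorem cylBubble_eq (hN : 3 ≤ N) (γ t : ℝ) : cylBubble N γ t = bubbleConst N γ *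
    ((Real.exp (eps N γ / (((N : ℝ) - 2) / 2) * t) + Real.exp (-(eps N γ / (((N : ℝ) - 2) / 2) * t))) ^
      (((N : ℝ) - 2) / 2))⁻¹ := by
  have hN' : (3 : ℝ) ≤ N := by exact_mod_cast hN
  have ha : 0 < ((N : ℝ) - 2) / 2 := by linarith
  have h2 : (N : ℝ) - 2 ≠ 0 := by linarith
  set κ := eps N γ / (((N : ℝ) - 2) / 2) with hκ
  have hp : 2 * betaPlus N γ / ((N : ℝ) - 2) = 1 + κ := by
    rw [betaPlus, hκ]; field_simp
  have hm : 2 * betaMinus N γ / ((N : ℝ) - 2) = 1 - κ := by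
    rw [betaMinus, hκ]; field_simp
  have hs : Real.exp (-t) ^ (1 + κ) + Real.exp (-t) ^ (1 - κ) =
      Real.exp (-t) * (Real.exp (κ * t) + Real.exp (-(κ * t))) := by
    rw [← Real.exp_mul, ← Real.exp_mul, mul_add (Real.exp _), ← Real.exp_add, ← Real.exp_add,
      add_comm]
    ring_nf
  rw [cylBubble, bubbleProfile, hp, hm, hs, Real.mul_rpow (Real.exp_pos _).le (by positivity),
    ← Real.exp_mul, mul_inv, ← Real.exp_neg, mul_left_comm, ← mul_assoc (Real.exp _), ← Real.exp_add]
  rw [show -(((N : ℝ) - 2) / 2) * t + -(-t * (((N : ℝ) - 2) / 2)) = 0 by ring, Real.exp_zero, one_mul]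

theorem hasDerivAt_inv_cosh_rpow {a κ : ℝ} (t : ℝ) :
    HasDerivAt (fun t => ((Real.exp (κ * t) + Real.exp (-(κ * t))) ^ a)⁻¹)
      (-(a * κ * ((Real.exp (κ * t) - Real.exp (-(κ * t))) /
        (Real.exp (κ * t) + Real.exp (-(κ * t))))) *
        ((Real.exp (κ * t) + Real.exp (-(κ * t))) ^ a)⁻¹) t := by
  have hpos : 0 < Real.exp (κ * t) + Real.exp (-(κ * t)) := by positivity
  have h1 : HasDerivAt (fun t : ℝ => κ * t) κ t := by simpa using (hasDerivAt_id t).const_mul κ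
  have h2 := (h1.exp.add h1.fun_neg.exp).rpow_const (p := a) (Or.inl hpos.ne')
  refine (h2.fun_inv (Real.rpow_pos_of_pos hpos _).ne').congr_deriv ?_
  simp only [Pi.add_apply]
  rw [Real.rpow_sub_one hpos.ne']
  have := (Real.rpow_pos_of_pos hpos a).ne'
  field_simp
  ring

/-- The multiplier is `-ε tanh(κt)`, so square integrability of the derivative follows from that of
the bubble. -/
theorem hasDerivAt_cylBubble (hN : 3 ≤ N) (γ t : ℝ) : ∃ m : ℝ, |m| ≤ eps N γ ∧
    HasDerivAt (cylBubble N γ) (m * cylBubble N γ t) t := by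
  have hN' : (3 : ℝ) ≤ N := by exact_mod_cast hN
  have ha : 0 < ((N : ℝ) - 2) / 2 := by linarith
  have he : 0 ≤ eps N γ := Real.sqrt_nonneg _
  have h := (hasDerivAt_inv_cosh_rpow (a := ((N : ℝ) - 2) / 2)
    (κ := eps N γ / (((N : ℝ) - 2) / 2)) t).const_mul (bubbleConst N γ)
  simp only [← cylBubble_eq hN] at h
  refine ⟨_, ?_, h.congr_deriv (by rw [mul_left_comm, ← cylBubble_eq hN])⟩
  rw [mul_div_cancel₀ _ ha.ne', abs_neg, abs_mul, abs_of_nonneg he]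
  refine mul_le_of_le_one_right he ?_
  rw [abs_div, div_le_one (by positivity)]
  refine (abs_sub _ _).trans (le_trans (le_of_eq ?_) (le_abs_self _))
  rw [abs_of_pos (Real.exp_pos _), abs_of_pos (Real.exp_pos _)]

theorem continuous_cylBubble (hN : 3 ≤ N) (γ : ℝ) : Continuous (cylBubble N γ) :=
  continuous_iff_continuousAt.2 fun t =>
    (hasDerivAt_cylBubble hN γ t).choose_spec.2.continuousAt

theorem abs_cylBubble_le (hN : 3 ≤ N) (γ t : ℝ) :
    |cylBubble N γ t| ≤ |bubbleConst N γ| * Real.exp (-(eps N γ * |t|)) := by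
  have hN' : (3 : ℝ) ≤ N := by exact_mod_cast hN
  have ha : 0 < ((N : ℝ) - 2) / 2 := by linarith
  have he : 0 ≤ eps N γ := Real.sqrt_nonneg _
  rw [cylBubble_eq hN, abs_mul]
  set κ := eps N γ / (((N : ℝ) - 2) / 2) with hκ
  have hpos : 0 < Real.exp (κ * t) + Real.exp (-(κ * t)) := by positivity
  refine mul_le_mul_of_nonneg_left ?_ (abs_nonneg _)
  rw [abs_inv, abs_of_pos (Real.rpow_pos_of_pos hpos _), Real.exp_neg (_ * |t|)]
  refine inv_anti₀ (Real.exp_pos _) ?_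
  have h1 : Real.exp (κ * |t|) ≤ Real.exp (κ * t) + Real.exp (-(κ * t)) := by
    rcases abs_cases t with ⟨h, -⟩ | ⟨h, -⟩ <;> rw [h]
    · linarith [Real.exp_pos (-(κ * t))]
    · rw [mul_neg]; linarith [Real.exp_pos (κ * t)]
  refine le_trans (le_of_eq ?_) (Real.rpow_le_rpow (Real.exp_pos _).le h1 ha.le)
  rw [← Real.exp_mul, hκ, mul_right_comm, div_mul_cancel₀ _ ha.ne']

theorem integrable_exp_neg_mul_abs {b : ℝ} (hb : 0 < b) :
    Integrable fun t : ℝ => Real.exp (-(b * |t|)) := by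
  rw [← integrableOn_univ, ← Set.Iic_union_Ioi (a := (0 : ℝ))]
  refine IntegrableOn.union ?_ ?_
  · refine (integrableOn_exp_mul_Iic hb 0).congr_fun (fun t ht => ?_) measurableSet_Iic
    simp only [abs_of_nonpos (Set.mem_Iic.1 ht), mul_neg, neg_neg]
  · refine (exp_neg_integrableOn_Ioi 0 hb).congr_fun (fun t ht => ?_) measurableSet_Ioi
    simp only [abs_of_pos (Set.mem_Ioi.1 ht), neg_mul]

theorem tendsto_cylBubble (hN : 3 ≤ N) {γ : ℝ} (hγ : γ < ((N : ℝ) - 2) ^ 2 / 4) :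
    Tendsto (cylBubble N γ) (cocompact ℝ) (𝓝 0) := by
  refine squeeze_zero_norm (fun t => abs_cylBubble_le hN γ t) ?_
  have h1 : Tendsto (fun t : ℝ => eps N γ * |t|) (cocompact ℝ) atTop :=
    (tendsto_norm_cocompact_atTop (E := ℝ)).const_mul_atTop (eps_pos hγ)
  simpa using (Real.tendsto_exp_neg_atTop_nhds_zero.comp h1).const_mul |bubbleConst N γ|

theorem memLp_cylBubble (hN : 3 ≤ N) {γ : ℝ} (hγ : γ < ((N : ℝ) - 2) ^ 2 / 4) (s : ℝ) :
    MemLp (fun p : Cyl N => cylBubble N γ (p.1 + s)) 2 (cylMeasure N) := by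
  have he := eps_pos hγ
  have h1 : MemLp (cylBubble N γ) 2 volume := by
    rw [memLp_two_iff_integrable_sq (continuous_cylBubble hN γ).aestronglyMeasurable]
    refine ((integrable_exp_neg_mul_abs (b := 2 * eps N γ) (by linarith)).const_mul
      (bubbleConst N γ ^ 2)).mono' ((continuous_cylBubble hN γ).pow 2).aestronglyMeasurable
      (.of_forall fun t => ?_)
    rw [Real.norm_of_nonneg (sq_nonneg _), ← sq_abs]
    refine (pow_le_pow_left₀ (abs_nonneg _) (abs_cylBubble_le hN γ t) 2).trans (le_of_eq ?_)
    rw [mul_pow, sq_abs, ← Real.exp_nat_mul]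
    push_cast
    ring_nf
  have h2 : MemLp (fun p : Cyl N => cylBubble N γ p.1) 2 (cylMeasure N) := h1.comp_fst _
  have h3 := h2.comp_measurePreserving (measurePreserving_shift N (-s))
  simpa [Function.comp_def] using h3

theorem cylGrad_cylBubble (γ s : ℝ) (p : Cyl N) :
    cylGrad N (fun z => cylBubble N γ (z.1 + s)) p =
      WithLp.toLp 2 (deriv (cylBubble N γ) (p.1 + s), 0) := by
  simp only [cylGrad, gradient_fun_const, inner_zero_right, zero_smul, sub_zero]
  rw [deriv_comp_add_const]

theorem memLp_cylGrad_cylBubble (hN : 3 ≤ N) {γ : ℝ} (hγ : γ < ((N : ℝ) - 2) ^ 2 / 4) (s : ℝ) :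
    MemLp (cylGrad N fun z => cylBubble N γ (z.1 + s)) 2 (cylMeasure N) := by
  have hm : Measurable (cylGrad N fun z => cylBubble N γ (z.1 + s)) := by
    have h1 : Measurable fun p : Cyl N => (deriv (cylBubble N γ) (p.1 + s), (0 : Eu N)) :=
      ((measurable_deriv _).comp (measurable_fst.add_const s)).prodMk measurable_const
    have h2 := (WithLp.prod_continuous_toLp 2 ℝ (Eu N)).measurable.comp h1
    rw [show cylGrad N (fun z => cylBubble N γ (z.1 + s)) = _ from funext (cylGrad_cylBubble γ s)]
    exact h2
  refine (memLp_cylBubble hN hγ s).of_le_mul (c := eps N γ) hm.aestronglyMeasurable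
    (.of_forall fun p => ?_)
  obtain ⟨m, hm, hd⟩ := hasDerivAt_cylBubble hN γ (p.1 + s)
  rw [cylGrad_cylBubble, hd.deriv, WithLp.prod_norm_eq_of_L2]
  simp only [WithLp.toLp_fst, WithLp.toLp_snd]
  rw [norm_zero, zero_pow two_ne_zero, add_zero, Real.sqrt_sq (norm_nonneg _), norm_mul]
  exact mul_le_mul_of_nonneg_right hm (norm_nonneg _)

/-! ### The distance from the optimizers -/

theorem exists_seq_tendsto_ae_of_integral_sq {α : Type*} [MeasurableSpace α] {μ : Measure α}
    {g : ℕ → α → ℝ} (hg : ∀ j, MemLp (g j) 2 μ)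
    (h : Tendsto (fun j => ∫ x, g j x ^ 2 ∂μ) atTop (𝓝 0)) :
    ∃ ns : ℕ → ℕ, StrictMono ns ∧ ∀ᵐ x ∂μ, Tendsto (fun j => g (ns j) x) atTop (𝓝 0) := by
  have h1 : Tendsto (fun j => eLpNorm ((fun x => g j x ^ 2) - fun _ => 0) 1 μ) atTop (𝓝 0) := by
    have e : ∀ j, eLpNorm ((fun x => g j x ^ 2) - fun _ => 0) 1 μ =
        ENNReal.ofReal (∫ x, g j x ^ 2 ∂μ) := by
      intro j
      rw [eLpNorm_one_eq_lintegral_enorm, ← ofReal_integral_norm_eq_lintegral_enorm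
        (by simpa [Pi.sub_def] using (hg j).integrable_sq)]
      simp
    simp only [e]
    simpa using ENNReal.tendsto_ofReal h
  obtain ⟨ns, hns, hae⟩ := (tendstoInMeasure_of_tendsto_eLpNorm one_ne_zero
    (fun j => ((hg j).1.pow 2)) aestronglyMeasurable_const h1).exists_seq_tendsto_ae
  refine ⟨ns, hns, ?_⟩
  filter_upwards [hae] with x hx
  have := (Real.continuous_sqrt.tendsto 0).comp hx
  simp only [Function.comp_def, Pi.pow_apply, Real.sqrt_sq_eq_abs, Real.sqrt_zero] at this
  exact (tendsto_zero_iff_abs_tendsto_zero _).2 this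

/-- The family of multiples of translates is closed in `L²`: the coefficients stay bounded when `U`
is nonzero, and translates escaping to infinity tend to `0` pointwise, which is the member with `c₀
= 0`. -/
theorem exists_ae_eq_translate {U : ℝ → ℝ} (hU : Continuous U) (hU0 : Tendsto U (cocompact ℝ) (𝓝 0))
    (hU2 : ∀ s, MemLp (fun p : Cyl N => U (p.1 + s)) 2 (cylMeasure N)) {f : Cyl N → ℝ}
    (hf : MemLp f 2 (cylMeasure N)) {c s : ℕ → ℝ}
    (h : Tendsto (fun j => ∫ p, (f p - c j * U (p.1 + s j)) ^ 2 ∂(cylMeasure N)) atTop (𝓝 0)) :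
    ∃ c₀ s₀ : ℝ, f =ᵐ[cylMeasure N] fun p => c₀ * U (p.1 + s₀) := by
  have hg : ∀ j, MemLp (fun p => f p - c j * U (p.1 + s j)) 2 (cylMeasure N) := fun j =>
    hf.sub ((hU2 (s j)).const_mul (c j))
  have hm : ∀ r, ∫ p : Cyl N, U (p.1 + r) ^ 2 ∂(cylMeasure N) =
      ∫ p : Cyl N, U p.1 ^ 2 ∂(cylMeasure N) := by
    intro r
    have hmp := measurePreserving_shift N (-r)
    have hc : Continuous fun p : Cyl N => U p.1 ^ 2 := by fun_prop
    have h := integral_map hmp.measurable.aemeasurable (μ := cylMeasure N) hc.aestronglyMeasurable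
    rw [hmp.map_eq] at h
    simpa using h.symm
  obtain ⟨ns, hns, hae⟩ := exists_seq_tendsto_ae_of_integral_sq hg h
  set m := ∫ p : Cyl N, U p.1 ^ 2 ∂(cylMeasure N) with hmdef
  have hm0 : 0 ≤ m := integral_nonneg fun _ => sq_nonneg _
  obtain ⟨R, hR⟩ : ∃ R, ∀ j, c j ^ 2 * m ≤ R := by
    obtain ⟨R, hR⟩ := h.bddAbove_range
    refine ⟨2 * ∫ p, f p ^ 2 ∂(cylMeasure N) + 2 * R, fun j => ?_⟩
    have h1 := hR (Set.mem_range_self j)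
    rw [← hm (s j), ← integral_const_mul]
    have hi1 : Integrable (fun p => 2 * f p ^ 2) (cylMeasure N) := hf.integrable_sq.const_mul 2
    have hi2 : Integrable (fun p => 2 * (f p - c j * U (p.1 + s j)) ^ 2) (cylMeasure N) :=
      (hg j).integrable_sq.const_mul 2
    refine (integral_mono ((hU2 (s j)).integrable_sq.const_mul (c j ^ 2)) (hi1.add hi2)
      fun p => ?_).trans ?_
    · simp only [Pi.add_apply]
      nlinarith [sq_nonneg (2 * f p - c j * U (p.1 + s j))]
    · rw [integral_add' hi1 hi2, integral_const_mul, integral_const_mul]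
      linarith
  -- If `m = 0`, every translate vanishes almost everywhere and so does `f`; otherwise the bound on
  -- `c j ^ 2 * m` makes `c` bounded.
  rcases hm0.eq_or_lt with hz | hpos
  · have hU0' : ∀ r, (fun p : Cyl N => U (p.1 + r)) =ᵐ[cylMeasure N] 0 := by
      intro r
      have := (integral_eq_zero_iff_of_nonneg (fun p : Cyl N => sq_nonneg (U (p.1 + r)))
        (hU2 r).integrable_sq).1 ((hm r).trans hz.symm)
      filter_upwards [this] with p hp
      simpa using hp
    refine ⟨0, 0, ?_⟩
    filter_upwards [hae, ae_all_iff.2 fun j => hU0' (s (ns j))] with p hp hp'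
    simp only [hp', Pi.zero_apply, mul_zero, sub_zero] at hp
    simpa using tendsto_nhds_unique tendsto_const_nhds hp
  · have hcb : ∀ j, c (ns j) ∈ Metric.closedBall (0 : ℝ) (Real.sqrt (R / m)) := by
      intro j
      rw [mem_closedBall_zero_iff, Real.norm_eq_abs]
      exact Real.abs_le_sqrt ((le_div_iff₀ hpos).2 (hR _))
    obtain ⟨c₀, -, k, hk, hck⟩ := tendsto_subseq_of_bounded Metric.isBounded_closedBall hcb
    by_cases hs : Tendsto (fun j => s (ns (k j))) atTop (cocompact ℝ)
    · refine ⟨0, 0, ?_⟩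
      filter_upwards [hae] with p hp
      have h1 : Tendsto (fun j => p.1 + s (ns (k j))) atTop (cocompact ℝ) :=
        (Homeomorph.addLeft p.1).isClosedEmbedding.tendsto_cocompact.comp hs
      have h2 := (hp.comp hk.tendsto_atTop).add (hck.mul (hU0.comp h1))
      simp only [Function.comp_def, sub_add_cancel, mul_zero, add_zero] at h2
      simpa using tendsto_nhds_unique tendsto_const_nhds h2
    -- The shifts return infinitely often to a compact set, so a further subsequence converges.
    · obtain ⟨t, ht, hfr⟩ := not_tendsto_iff_exists_frequently_notMem.1 hs
      obtain ⟨K, hK, hKt⟩ := mem_cocompact.1 ht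
      obtain ⟨s₀, -, l, hl, hsl⟩ := hK.isSeqCompact.subseq_of_frequently_in
        (hfr.mono fun j hj => by_contra fun hjK => hj (hKt hjK))
      refine ⟨c₀, s₀, ?_⟩
      filter_upwards [hae] with p hp
      have h1 := (hU.tendsto (p.1 + s₀)).comp (hsl.const_add p.1)
      have h2 := (hp.comp (hk.comp hl).tendsto_atTop).add ((hck.comp hl.tendsto_atTop).mul h1)
      simp only [Function.comp_def, sub_add_cancel, zero_add] at h2
      exact tendsto_nhds_unique tendsto_const_nhds h2

theorem cylEnergy_nonneg (γ : ℝ) (u : Cyl N → ℝ) (G : Cyl N → CylVec N) : 0 ≤ cylEnergy N γ u G :=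
  integral_nonneg fun _ => add_nonneg (sq_nonneg _) (mul_nonneg (sq_nonneg _) (sq_nonneg _))

theorem cylDistSq_le (γ : ℝ) (φ : H1Cyl N) :
    cylDistSq γ φ ≤ cylEnergy N γ (h1Fn φ) (h1Grad φ) := by
  have h := ciInf_le (f := fun q : ℝ × ℝ =>
    cylEnergy N γ (fun p => h1Fn φ p - q.1 * cylBubble N γ (p.1 + q.2))
      (fun p => h1Grad φ p - q.1 • cylGrad N (fun z => cylBubble N γ (z.1 + q.2)) p))
    ⟨0, by rintro _ ⟨q, rfl⟩; exact cylEnergy_nonneg _ _ _⟩ (0, 0)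
  refine h.trans (le_of_eq ?_)
  simp only [zero_mul, zero_smul, sub_zero]

/-- At distance zero, near-minimizing parameters approximate `φ` in `L²`, because the energy
dominates `ε²` times the squared `L²` norm; closedness of the family then makes `φ` an optimizer. -/
theorem cylDistSq_pos (hN : 3 ≤ N) {γ : ℝ} (hγ : γ < ((N : ℝ) - 2) ^ 2 / 4) {φ : H1Cyl N}
    (hφ : φ ∉ cylOptimizers N γ) : 0 < cylDistSq γ φ := by
  by_contra! hD
  have he := pow_pos (eps_pos (N := N) hγ) 2
  have hq : ∀ j : ℕ, ∃ q : ℝ × ℝ,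
      cylEnergy N γ (fun p => h1Fn φ p - q.1 * cylBubble N γ (p.1 + q.2))
        (fun p => h1Grad φ p - q.1 • cylGrad N (fun z => cylBubble N γ (z.1 + q.2)) p) <
      1 / ((j : ℝ) + 1) := fun j => exists_lt_of_ciInf_lt (hD.trans_lt Nat.one_div_pos_of_nat)
  choose q hq using hq
  refine hφ (exists_ae_eq_translate (continuous_cylBubble hN γ) (tendsto_cylBubble hN hγ)
    (memLp_cylBubble hN hγ) (memLp_h1Fn φ) (c := fun j => (q j).1) (s := fun j => (q j).2) ?_)
  refine squeeze_zero (fun j => integral_nonneg fun _ => sq_nonneg _) (fun j => ?_)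
    (by simpa only [mul_zero] using (tendsto_one_div_add_atTop_nhds_zero_nat (𝕜 := ℝ)).const_mul (eps N γ ^ 2)⁻¹)
  rw [le_inv_mul_iff₀ he, ← integral_const_mul]
  have h1 : MemLp (fun p => h1Fn φ p - (q j).1 * cylBubble N γ (p.1 + (q j).2)) 2 (cylMeasure N) :=
    (memLp_h1Fn φ).sub ((memLp_cylBubble hN hγ (q j).2).const_mul (q j).1)
  have h2 : MemLp (fun p => h1Grad φ p -
      (q j).1 • cylGrad N (fun z => cylBubble N γ (z.1 + (q j).2)) p) 2 (cylMeasure N) :=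
    (memLp_h1Grad φ).sub ((memLp_cylGrad_cylBubble hN hγ (q j).2).const_smul (q j).1)
  refine (integral_mono (h1.integrable_sq.const_mul _)
    ((h2.integrable_norm_pow (by simp)).add (h1.integrable_sq.const_mul (eps N γ ^ 2)))
    fun p => ?_).trans (hq j).le
  exact le_add_of_nonneg_left (sq_nonneg _)

/-! ### Relative compactness up to translations -/

/-- Pairing the function component with `g` is the inner product in `H1Cyl` with the orthogonal
projection of `(g, 0)`. -/
theorem tendsto_inner_fst {ψ : ℕ → H1Cyl N} {φ₀ : H1Cyl N}
    (h : ∀ x : H1Cyl N, Tendsto (fun j => inner ℝ (ψ j) x) atTop (𝓝 (inner ℝ φ₀ x)))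
    (g : Lp ℝ 2 (cylMeasure N)) :
    Tendsto (fun j => (inner ℝ g (ψ j).1.fst : ℝ)) atTop (𝓝 (inner ℝ g φ₀.1.fst)) := by
  have : CompleteSpace (H1Cyl N) := (Submodule.isClosed_topologicalClosure _).completeSpace_coe
  have e : ∀ φ : H1Cyl N, (inner ℝ g φ.1.fst : ℝ) =
      inner ℝ φ ((H1Cyl N).orthogonalProjectionOnto (WithLp.toLp 2 (g, 0))) := by
    intro φ
    rw [real_inner_comm, Submodule.inner_orthogonalProjectionOnto_eq_of_mem_left, WithLp.prod_inner_apply]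
    simp
  simp only [e]
  exact h _

/-- Strong convergence of the kernels against weak convergence of the functions. -/
theorem tendsto_cylAvg {δ : ℝ} (hδ : 0 < δ) (hδ' : δ ≤ 1 / 2) {ψ : ℕ → H1Cyl N} {φ₀ : H1Cyl N}
    {R : ℝ} (hR : ∀ j, ‖ψ j‖ ≤ R)
    (h : ∀ x : H1Cyl N, Tendsto (fun j => inner ℝ (ψ j) x) atTop (𝓝 (inner ℝ φ₀ x)))
    {σ : ℕ → Metric.sphere (0 : Eu N) 1} {σ₀ : Metric.sphere (0 : Eu N) 1}
    (hσ : Tendsto σ atTop (𝓝 σ₀)) :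
    Tendsto (fun j => cylAvg δ (σ j) (ψ j)) atTop (𝓝 (cylAvg δ σ₀ φ₀)) := by
  obtain ⟨C, hC, -, hC2⟩ := exists_norm_avgKernel_le (N := N) hδ hδ'
  have hR0 : 0 ≤ R := (norm_nonneg _).trans (hR 0)
  have h1 : Tendsto (fun j => cylAvg δ σ₀ (ψ j)) atTop (𝓝 (cylAvg δ σ₀ φ₀)) := by
    simp only [cylAvg_eq_inner hδ hδ']
    exact tendsto_inner_fst h _
  have h2 : Tendsto (fun j => cylAvg δ (σ j) (ψ j) - cylAvg δ σ₀ (ψ j)) atTop (𝓝 0) := by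
    refine squeeze_zero_norm (a := fun j => C * dist (σ j) σ₀ * R) (fun j => ?_) ?_
    · rw [cylAvg_eq_inner hδ hδ', cylAvg_eq_inner hδ hδ', ← inner_sub_left]
      refine (norm_inner_le_norm _ _).trans ?_
      exact mul_le_mul (hC2 _ _) ((norm_fst_le _).trans (hR j)) (norm_nonneg _) (by positivity)
    · simpa using ((tendsto_iff_dist_tendsto_zero.1 hσ).const_mul C).mul_const R
  simpa using h2.add h1

theorem exists_subseq_tau_weaklyConverges (hN : 3 ≤ N) {e B : ℝ} (he : 0 < e)
    (hB : B < sobolevConst N) {φ : ℕ → H1Cyl N}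
    (hnorm : ∀ n, lpNorm (h1Fn (φ n)) (critExp N) (cylMeasure N) = 1)
    (hE : ∀ n, gradSq (φ n) + e * massSq (φ n) ≤ B) :
    ∃ (s : ℕ → ℝ) (k : ℕ → ℕ) (φ₀ : H1Cyl N), StrictMono k ∧
      (¬ h1Fn φ₀ =ᵐ[cylMeasure N] 0) ∧
      WeaklyConverges (fun j => tau (s (k j)) (φ (k j))) φ₀ := by
  obtain ⟨δ, hδ, hδ', hlow⟩ := exists_cylAvg_lower_bound hN he hB
  choose s σ hs using fun n => hlow (φ n) (hnorm n) (hE n)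
  have hbd : ∀ n, ‖tau (s n) (φ n)‖ ≤ Real.sqrt (B / e + B) := by
    intro n
    rw [norm_tau]
    refine Real.le_sqrt_of_sq_le ?_
    have hm := massSq_nonneg (φ n)
    have hg := gradSq_nonneg (φ n)
    have hem := mul_nonneg he.le hm
    have h1 : massSq (φ n) ≤ B / e := by rw [le_div_iff₀ he]; linarith [hE n]
    rw [norm_sq_eq]
    linarith [hE n]
  obtain ⟨k, φ₀, hk, hlim⟩ := exists_weaklyConverges hbd
  -- Translations do not act on the sphere, so the points `σ` where the average is large are handled
  -- by compactness.
  obtain ⟨σ₀, l, hl, hσ⟩ := CompactSpace.tendsto_subseq (σ ∘ k)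
  have hlim' : ∀ x : H1Cyl N, Tendsto (fun j => inner ℝ (tau (s (k (l j))) (φ (k (l j)))) x) atTop
      (𝓝 (inner ℝ φ₀ x)) := fun x => (hlim x).comp hl.tendsto_atTop
  refine ⟨s, k ∘ l, φ₀, hk.comp hl, fun h0 => ?_, weaklyConverges_of_inner hlim'⟩
  have h1 := (tendsto_cylAvg hδ hδ' (fun j => hbd (k (l j))) hlim' hσ).abs
  have h2 : δ / 2 ≤ |cylAvg δ σ₀ φ₀| := ge_of_tendsto h1 (.of_forall fun j => hs (k (l j)))
  have h3 : cylAvg δ σ₀ φ₀ = 0 := by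
    rw [cylAvg, ← integral_zero (Cyl N) ℝ]
    refine integral_congr_ae ?_
    filter_upwards [h0] with p hp
    simp [hp]
  rw [h3, abs_zero] at h2
  linarith

theorem exists_eventually_cylEnergy_le (hN : 3 ≤ N) {γ : ℝ} (hγ : γ < ((N : ℝ) - 2) ^ 2 / 4)
    (hlevel : bianchiEgnellConst N γ < 1 - hardySobolevConst N γ / sobolevConst N)
    {φ : ℕ → H1Cyl N} (hmin : IsMinimizingSeq N γ φ)
    (hnorm : ∀ n, lpNorm (h1Fn (φ n)) (critExp N) (cylMeasure N) = 1) :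
    ∃ B < sobolevConst N, ∀ᶠ n in atTop, cylEnergy N γ (h1Fn (φ n)) (h1Grad (φ n)) ≤ B := by
  have hS := sobolevConst_pos hN
  have hSγ := (hardySobolevConst_spec hN hγ.le).1
  obtain ⟨θ, hθ, hθ1⟩ := exists_between hlevel
  have hr : hardySobolevConst N γ / sobolevConst N < 1 - θ := by linarith
  have h1θ : 0 < 1 - θ := (div_nonneg hSγ hS.le).trans_lt hr
  refine ⟨hardySobolevConst N γ / (1 - θ), ?_, ?_⟩
  · rw [div_lt_iff₀ h1θ, mul_comm, ← div_lt_iff₀ hS]; exact hr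
  filter_upwards [hmin.2.eventually_lt_const hθ] with n hn
  have hD := cylDistSq_pos hN hγ (hmin.1 n)
  have hDE := cylDistSq_le γ (φ n)
  have hES := hardySobolevConst_mul_le_h1 hN hγ.le (φ n)
  rw [← cylEnergy_eq] at hES
  rw [cylDeficit, hnorm, one_pow, mul_one, div_lt_iff₀ hD] at hn
  rw [hnorm, one_pow, mul_one] at hES
  rw [le_div_iff₀ h1θ]
  -- For `θ ≤ 0` the deficit would be negative, against the Hardy-Sobolev inequality; for `θ > 0`
  -- the distance may be replaced by the energy.
  rcases le_or_gt θ 0 with h0 | h0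
  · have := mul_nonpos_of_nonpos_of_nonneg h0 hD.le
    linarith
  · have := mul_le_mul_of_nonneg_left hDE h0.le
    linarith

end HardySobolev

end

theorem mainTheorem3 (N : ℕ) (hN : 3 ≤ N) (γ : ℝ) (hγ : 0 < γ) (hγ' : γ < ((N : ℝ) - 2) ^ 2 / 4)
    (hlevel : HardySobolev.bianchiEgnellConst N γ <
      1 - HardySobolev.hardySobolevConst N γ / HardySobolev.sobolevConst N)
    (φ : ℕ → HardySobolev.H1Cyl N)
    (hmin : HardySobolev.IsMinimizingSeq N γ φ)
    (hnorm : ∀ n, lpNorm (HardySobolev.h1Fn (φ n)) (HardySobolev.critExp N) (HardySobolev.cylMeasure N) = 1) :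
    ∃ (s : ℕ → ℝ) (k : ℕ → ℕ) (φ₀ : HardySobolev.H1Cyl N), StrictMono k ∧
      (¬ HardySobolev.h1Fn φ₀ =ᵐ[HardySobolev.cylMeasure N] 0) ∧
      HardySobolev.WeaklyConverges (fun j => HardySobolev.tau (s (k j)) (φ (k j))) φ₀ := by
  obtain ⟨B, hB, hev⟩ := HardySobolev.exists_eventually_cylEnergy_le hN hγ' hlevel hmin hnorm
  obtain ⟨n₀, hn₀⟩ := eventually_atTop.1 hev
  obtain ⟨s, k, φ₀, hk, h0, hlim⟩ := HardySobolev.exists_subseq_tau_weaklyConverges hN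
    (pow_pos (HardySobolev.eps_pos hγ') 2) hB (φ := fun n => φ (n + n₀)) (fun n => hnorm _)
    (fun n => by rw [← HardySobolev.cylEnergy_eq]; exact hn₀ _ (Nat.le_add_left n₀ n))
  -- The energy bound holds only from `n₀` on, so the shifts found for the tail are reindexed to the
  -- original sequence; values below `n₀` are never used.
  refine ⟨fun m => s (m - n₀), fun j => k j + n₀, φ₀, hk.add_const n₀, h0, ?_⟩
  simpa only [Nat.add_sub_cancel] using hlim
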